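/- **Setting.** Let $A$ be a $C^*$-algebra (not necessarily unital). A $C^*$-correspondence over $A$ is a right Hilbert $C^*$-module $E$ over $A$ with a $*$-homomorphism $\varphi_E$ from $A$ into the adjointable operators on $E$; it is *essential* if $\varphi_E(A)E$ spans a dense subspace of $E$. For a representation $\sigma$ of $A$ on a Hilbert space $H$, $E\otimes_\sigma H$ (or $E\otimes H$) is the Hausdorff completion of the algebraic tensor product for $\langle \xi\otimes h,\eta\otimes k\rangle=\langle h,\sigma(\langle\xi,\eta\rangle)k\rangle$; $A$ acts on it by $a\mapsto \varphi_E(a)\otimes I$. If $S$ is bounded and intertwines the representations of $A$, then $I_E\otimes S$ is the operator $\xi\otimes h\mapsto \xi\otimes Sh$. A *completely contractive covariant representation* $(\sigma,T)$ of $E$ on $H$ is a $*$-representation $\sigma$ of $A$ on $H$ with a linear map $T:E\to B(H)$ that is completely contractive (for the operator space structure of $E$ in its linking algebra) and satisfies $T(a\xi b)=\sigma(a)T(\xi)\sigma(b)$. Then $\tilde T:E\otimes_\sigma H\to H$, $\tilde T(\xi\otimes h)=T(\xi)h$, is a contraction. Let $X=(X(\mathbf n))_{\mathbf n\in\mathbb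 Z_+^k}$ be a product system over $\mathbb Z_+^k$: $C^*$-correspondences over $A$ with an associative multiplication $X(\mathbf n)\times X(\mathbf m)\to X(\mathbf n+\mathbf m)$ which, for $\mathbf n,\mathbf m\neq \mathbf 0$, extends to an isomorphism of correspondences $X(\mathbf n)\otimes_A X(\mathbf m)\cong X(\mathbf n+\mathbf m)$, with $X(\mathbf 0)=A$ and with the multiplications by $X(\mathbf 0)$ given by the left and right actions of $A$. Let $\mathbf e_i$ be the $i$-th unit vector, $E_i=X(\mathbf e_i)$, $\mathbf e(u)=\sum_{i\in u}\mathbf e_i$ for $u\subseteq\{1,\dots,k\}$, and let $t_{i,j}:E_i\otimes E_j\to E_j\otimes E_i$ be the isomorphism given by the identification of both sides with $X(\mathbf e_i+\mathbf e_j)$. A *representation* $(\sigma,\{T^{(i)}\})$ of $X$ on $H$ consists of completely contractive covariant representations $(\sigma,T^{(i)})$ of $E_i$ on $H$, $1\le i\le k$, such that for all $i,j$ $$\tilde T^{(i)}(I_{E_i}\otimes\tilde T^{(j)})=\tilde T^{(j)}(I_{E_j}\otimes\tilde T^{(i)})(t_{i,j}\otimes I_H).$$ For $\mathbf n\in\mathbb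 Z_+^k$ define $\tilde T_{\mathbf n}:X(\mathbf n)\otimes H\to H$ by $\tilde T_{\mathbf 0}(a\otimes h)=\sigma(a)h$ and by $\tilde T_{\mathbf n}=\tilde T^{(i)}(I_{E_i}\otimes\tilde T_{\mathbf n-\mathbf e_i})$ for the least $i$ with $n_i\ne0$, where $X(\mathbf n)\otimes H=E_i\otimes(X(\mathbf n-\mathbf e_i)\otimes H)$. For $\mathbf n\in\mathbb Z^k$ let $\mathbf n_+$ have entries $\max(n_i,0)$, let $\mathbf n_-=\mathbf n_+-\mathbf n$, and put $T(\mathbf n)=\tilde T_{\mathbf n_-}^*\tilde T_{\mathbf n_+}:X(\mathbf n_+)\otimes H\to X(\mathbf n_-)\otimes H$. A *regular isometric dilation* of a representation $(\sigma,\{T^{(i)}\})$ on $H$ is a representation $(\rho,\{V^{(i)}\})$ of $X$ (with $\rho$ possibly degenerate) on a Hilbert space $K\supseteq H$ such that (i) each $\tilde V^{(i)}$ is an isometry; (ii) $H$ is invariant under $V^{(i)}(\xi)^*$ for all $i$ and $\xi\in E_i$; (iii) $H$ reduces $\rho$ and $\rho(a)|_H=\sigma(a)$ for $a\in A$; (iv)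 $(I_{X(\mathbf n_-)}\otimes P_H)V(\mathbf n)|_{X(\mathbf n_+)\otimes H}=T(\mathbf n)$ for every $\mathbf n\in\mathbb Z^k$. It is *minimal* if the smallest closed subspace of $K$ that contains $H$ and is invariant under all $V^{(i)}(\xi)$, $\xi\in E_i$, $1\le i\le k$, is $K$. **Theorem.** Let $(\sigma,\{T^{(i)}\})$ be a representation of $X$ on $H$ with $\sigma$ nondegenerate. 1. $(\sigma,\{T^{(i)}\})$ has a regular isometric dilation if and only if, for every $v\subseteq\{1,\dots,k\}$, $$\sum_{u\subseteq v}(-1)^{|u|}\bigl(I_{X(\mathbf e(v)-\mathbf e(u))}\otimes \tilde T_{\mathbf e(u)}^*\tilde T_{\mathbf e(u)}\bigr)\ \ge\ 0$$ as an operator on $X(\mathbf e(v))\otimes H$; here $X(\mathbf e(v)-\mathbf e(u))\otimes(X(\mathbf e(u))\otimes H)$ is identified with $X(\mathbf e(v))\otimes H$, and the summand for $u=v$ is $\tilde T_{\mathbf e(v)}^*\tilde T_{\mathbf e(v)}$. 2. When a regular isometric dilation exists, it can be chosen minimal. 3. If moreover every $E_i$ is essential, then, when a regular isometric dilation exists,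 it can be chosen minimal and with $\rho$ nondegenerate. -/

import Mathlib

open scoped ComplexOrder RightActions TensorProduct

set_option linter.unusedSectionVars false
open MulOpposite

universe uA uX uH w

/-- Approximate factorization in a `C⋆`-algebra, used to bound operators on tensor products. -/
lemma CStarCorrespondence.exists_factor {B : Type*} [NonUnitalCStarAlgebra B] (M : B)
    (h : ∃ s, M = star s * s) :
    ∃ N : B, IsSelfAdjoint N ∧ M = N * N ∧
      ∀ ε : ℝ, 0 < ε → ∃ d : B, ‖star d * M * d‖ ≤ 1 ∧
        ‖M - M * (d * N) - star (d * N) * M + star (d * N) * M * (d * N)‖ ≤ ε := by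
  let _ := CStarAlgebra.spectralOrder B
  have _ := CStarAlgebra.spectralOrderedRing B
  have hpos : 0 ≤ M := CStarAlgebra.nonneg_iff_eq_star_mul_self.mpr h
  have hsa : IsSelfAdjoint M := .of_nonneg hpos
  have hsp : ∀ t ∈ quasispectrum ℝ M, 0 ≤ t := quasispectrum_nonneg_of_nonneg M hpos
  have key : ∀ f : ℝ → ℝ, Continuous f → f 0 = 0 → IsSelfAdjoint (cfcₙ f M) :=
    fun f _ _ => cfcₙ_predicate f M
  refine ⟨cfcₙ Real.sqrt M, key _ (by fun_prop) (by simp), ?_, fun ε hε => ?_⟩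
  · rw [← cfcₙ_mul Real.sqrt Real.sqrt M]
    conv_lhs => rw [← cfcₙ_id' ℝ M]
    exact cfcₙ_congr fun t ht => (Real.mul_self_sqrt (hsp t ht)).symm
  · have hne : ∀ t : ℝ, |t| + ε ≠ 0 := fun t => by positivity
    set f : ℝ → ℝ := fun t => Real.sqrt t / (|t| + ε) with hf
    have hfc : Continuous f := by
      refine Continuous.div (by fun_prop) (by fun_prop) hne
    have hf0 : f 0 = 0 := by simp [hf]
    set d := cfcₙ f M with hd
    have hdsa : IsSelfAdjoint d := key f hfc hf0
    have hid : cfcₙ (fun t : ℝ => t) M = M := cfcₙ_id' ℝ M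
    set g : ℝ → ℝ := fun t => f t * Real.sqrt t with hg
    have hgc : Continuous g := by fun_prop
    have hg0 : g 0 = 0 := by simp [hg]
    have hdN : d * cfcₙ Real.sqrt M = cfcₙ g M :=
      (cfcₙ_mul f Real.sqrt M hfc.continuousOn hf0 (by fun_prop) (by simp)).symm
    have hMg : M * cfcₙ g M = cfcₙ (fun t => t * g t) M := by
      rw [cfcₙ_mul (fun t : ℝ => t) g M (by fun_prop) rfl hgc.continuousOn hg0, hid]
    have hgM : cfcₙ g M * M = cfcₙ (fun t => g t * t) M := by
      rw [cfcₙ_mul g (fun t : ℝ => t) M hgc.continuousOn hg0 (by fun_prop) rfl, hid]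
    refine ⟨d, ?_, ?_⟩
    · have : star d * M * d = cfcₙ (fun t => f t * t * f t) M := by
        rw [cfcₙ_mul (fun t => f t * t) f M (by fun_prop) (by simp) hfc.continuousOn hf0,
          cfcₙ_mul f (fun t : ℝ => t) M hfc.continuousOn hf0 (by fun_prop) rfl, hid, hdsa.star_eq]
      rw [this]
      refine norm_cfcₙ_le fun t ht => ?_
      have h0 := hsp t ht
      have : f t * t * f t = (t / (t + ε)) ^ 2 := by
        have hne' : t + ε ≠ 0 := by positivity
        simp only [hf, abs_of_nonneg h0]
        field_simp
        rw [Real.sq_sqrt h0]; ring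
      rw [this, Real.norm_of_nonneg (by positivity)]
      refine pow_le_one₀ (by positivity) ?_
      rw [div_le_one (by positivity)]
      linarith
    · rw [hdN, (key g hgc hg0).star_eq, hMg, hgM]
      have e1 : cfcₙ (fun t => g t * t) M * cfcₙ g M = cfcₙ (fun t => g t * t * g t) M :=
        (cfcₙ_mul (fun t => g t * t) g M (by fun_prop) (by simp) hgc.continuousOn hg0).symm
      have e2 : M - cfcₙ (fun t => t * g t) M = cfcₙ (fun t => t - t * g t) M := by
        rw [cfcₙ_sub (fun t : ℝ => t) (fun t => t * g t) M (by fun_prop) rfl (by fun_prop)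
          (by simp), hid]
      have e3 : cfcₙ (fun t => t - t * g t) M - cfcₙ (fun t => g t * t) M =
          cfcₙ (fun t => t - t * g t - g t * t) M :=
        (cfcₙ_sub (fun t : ℝ => t - t * g t) (fun t => g t * t) M (by fun_prop) (by simp)
          (by fun_prop) (by simp)).symm
      have e4 : cfcₙ (fun t => t - t * g t - g t * t) M + cfcₙ (fun t => g t * t * g t) M =
          cfcₙ (fun t => t - t * g t - g t * t + g t * t * g t) M :=
        (cfcₙ_add (a := M) (fun t : ℝ => t - t * g t - g t * t) (fun t => g t * t * g t)
          (by fun_prop) (by simp) (by fun_prop) (by simp)).symm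
      rw [e1, e2, e3, e4]
      refine norm_cfcₙ_le fun t ht => ?_
      have h0 := hsp t ht
      have hgt : g t = t / (t + ε) := by
        simp only [hg, hf, abs_of_nonneg h0]
        rw [div_mul_eq_mul_div, Real.mul_self_sqrt h0]
      have hne' : t + ε ≠ 0 := by positivity
      have : t - t * g t - g t * t + g t * t * g t = t / (t + ε) * (ε / (t + ε)) * ε := by
        rw [hgt]; field_simp; ring
      rw [this, Real.norm_of_nonneg (by positivity)]
      have a1 : t / (t + ε) ≤ 1 := by rw [div_le_one (by positivity)]; linarith
      have a2 : ε / (t + ε) ≤ 1 := by rw [div_le_one (by positivity)]; linarith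
      have a3 : t / (t + ε) * (ε / (t + ε)) ≤ 1 := mul_le_one₀ a1 (by positivity) a2
      nlinarith


/-- A self-adjoint element `M` is of the form `s⋆ s` as soon as `C M C = -(Q⋆ Q)` with
`Q⋆ Q = C ^ 3` and `C` self-adjoint forces `Q = 0`. -/
lemma CStarCorrespondence.exists_star_mul_self {B : Type*} [NonUnitalCStarAlgebra B] (M : B)
    (hsa : IsSelfAdjoint M)
    (h : ∀ C Q : B, IsSelfAdjoint C → C * M * C = - (star Q * Q) → Q = 0) :
    ∃ s, M = star s * s := by
  let _ := CStarAlgebra.spectralOrder B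
  have _ := CStarAlgebra.spectralOrderedRing B
  refine CStarAlgebra.nonneg_iff_eq_star_mul_self.mp ?_
  set C := M⁻ with hC
  have hC0 : 0 ≤ C := CFC.negPart_nonneg M
  have hCsa : IsSelfAdjoint C := .of_nonneg hC0
  obtain ⟨s, hs⟩ := CStarAlgebra.nonneg_iff_eq_star_mul_self.mp hC0
  have h6 : star (s * C) * (s * C) = C * C * C := by
    rw [star_mul, hCsa.star_eq, mul_assoc C, ← mul_assoc (star s), ← hs, mul_assoc]
  have h1 : C * M * C = - (star (s * C) * (s * C)) := by
    have : C * M = - (C * C) := by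
      conv_lhs => rw [← CFC.posPart_sub_negPart M hsa, mul_sub, ← hC, CFC.negPart_mul_posPart]
      simp
    rw [this, h6, neg_mul]
  have hQ0 := h C (s * C) hCsa h1
  have hCC : star (star C * C) * (star C * C) = 0 := by
    rw [hQ0, mul_zero] at h6
    rw [star_mul, star_star, hCsa.star_eq, ← mul_assoc, ← h6, zero_mul]
  have hC00 : C = 0 := (CStarRing.star_mul_self_eq_zero_iff _).mp
    ((CStarRing.star_mul_self_eq_zero_iff _).mp hCC)
  rw [← CFC.posPart_sub_negPart M hsa, ← hC, hC00, sub_zero]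
  exact CFC.posPart_nonneg M

/-- A `C⋆`-correspondence over the `C⋆`-algebra `A` (completeness of `E` is a separate
`CompleteSpace E` assumption): a right Hilbert `C⋆`-module over `A`, that is, in Mathlib's
convention, a `CStarModule` over `Aᵐᵒᵖ`, together with a `⋆`-homomorphism `φ` of `A` into the
adjointable operators on `E`. -/
class CStarCorrespondence (A E : Type*) [NonUnitalCStarAlgebra A] [PartialOrder A]
    [NormedAddCommGroup E] [NormedSpace ℂ E] extends SMul Aᵐᵒᵖ E, CStarModule Aᵐᵒᵖ E where
  /-- the left action of `A` -/
  φ : A →ₙₐ[ℂ] (E →L[ℂ] E)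
  inner_φ_left : ∀ (a : A) (x y : E), inner (φ a x) y = inner x (φ (star a) y)

namespace CStarCorrespondence

variable {A E : Type*} [NonUnitalCStarAlgebra A] [PartialOrder A]
  [NormedAddCommGroup E] [NormedSpace ℂ E] [CStarCorrespondence A E]

variable (A) in
/-- The `A`-valued inner product `⟨x, y⟩`, conjugate linear in `x` and linear in `y`, with
`⟨x, y a⟩ = ⟨x, y⟩ a`. -/
def inn (x y : E) : A := unop (inner Aᵐᵒᵖ x y)

lemma inn_add_right (x y z : E) : inn A x (y + z) = inn A x y + inn A x z := by simp [inn]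
lemma inn_add_left (x y z : E) : inn A (x + y) z = inn A x z + inn A y z := by simp [inn]
lemma inn_smul_right (c : ℂ) (x y : E) : inn A x (c • y) = c • inn A x y := by simp [inn]
lemma inn_smul_left (c : ℂ) (x y : E) : inn A (c • x) y = star c • inn A x y := by simp [inn]
lemma inn_op_right (a : A) (x y : E) : inn A x (y <• a) = inn A x y * a := by simp [inn]
lemma inn_op_left (a : A) (x y : E) : inn A (x <• a) y = star a * inn A x y := by simp [inn]
lemma star_inn (x y : E) : star (inn A x y) = inn A y x := by
  rw [inn, inn, ← unop_star, CStarModule.star_inner]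
lemma inn_self_nonneg (x : E) : 0 ≤ inn A x x :=
  CStarModule.inner_self_nonneg (A := Aᵐᵒᵖ) (x := x)
lemma inn_φ_left (a : A) (x y : E) : inn A (φ a x) y = inn A x (φ (star a) y) := by
  simp [inn, inner_φ_left]
lemma inn_φ_right (a : A) (x y : E) : inn A x (φ a y) = inn A (φ (star a) x) y := by
  simp [inn_φ_left]
lemma norm_sq_eq (x : E) : ‖x‖ ^ 2 = ‖inn A x x‖ := by
  rw [CStarModule.norm_sq_eq Aᵐᵒᵖ]; rfl
lemma inn_sum_right {ι : Type*} (s : Finset ι) (x : E) (y : ι → E) :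
    inn A x (∑ i ∈ s, y i) = ∑ i ∈ s, inn A x (y i) := by simp [inn]
lemma inn_sum_left {ι : Type*} (s : Finset ι) (x : ι → E) (y : E) :
    inn A (∑ i ∈ s, x i) y = ∑ i ∈ s, inn A (x i) y := by simp [inn]
lemma inn_sub_right (x y z : E) : inn A x (y - z) = inn A x y - inn A x z := by simp [inn]
lemma inn_sub_left (x y z : E) : inn A (x - y) z = inn A x z - inn A y z := by simp [inn]

/-- The inner product as a sesquilinear map. -/
noncomputable def innₛₗ : E →ₗ⋆[ℂ] E →ₗ[ℂ] A :=
  LinearMap.mk₂'ₛₗ (starRingEnd ℂ) (RingHom.id ℂ) (inn A) inn_add_left inn_smul_left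
    inn_add_right inn_smul_right

/-- The matrix `(⟨x i, x j⟩)` of inner products of a finite family of vectors. -/
def gram {ι : Type*} (x : ι → E) : CStarMatrix ι ι A :=
  CStarMatrix.ofMatrix (Matrix.of fun i j => inn A (x i) (x j))

lemma gram_apply {ι : Type*} (x : ι → E) (i j : ι) : gram (A := A) x i j = inn A (x i) (x j) := rfl

lemma gram_isSelfAdjoint {ι : Type*} [Fintype ι] (x : ι → E) :
    IsSelfAdjoint (gram (A := A) x) := by
  ext i j
  simp [gram_apply, CStarMatrix.star_apply, star_inn]

/-- Right multiplication of a row of vectors by a matrix over `A`. -/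
def rowMul {ι : Type*} [Fintype ι] (x : ι → E) (c : CStarMatrix ι ι A) (j : ι) : E :=
  ∑ i, x i <• c i j

lemma gram_rowMul {ι : Type*} [Fintype ι] (x : ι → E) (c : CStarMatrix ι ι A) :
    gram (rowMul x c) = star c * gram x * c := by
  ext i j
  simp only [gram_apply, rowMul, inn_sum_left, inn_sum_right, inn_op_left, inn_op_right,
    CStarMatrix.mul_apply, CStarMatrix.star_apply, Finset.sum_mul, mul_assoc]

lemma inn_rowMul_right {ι : Type*} [Fintype ι] (x : ι → E) (c : CStarMatrix ι ι A) (i j : ι) :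
    inn A (x i) (rowMul x c j) = (gram (A := A) x * c : CStarMatrix ι ι A) i j := by
  simp only [rowMul, inn_sum_right, inn_op_right, CStarMatrix.mul_apply, gram_apply]

lemma inn_ext {x y : E} (h : ∀ z : E, inn A z x = inn A z y) : x = y := by
  rw [← sub_eq_zero, ← norm_eq_zero, ← sq_eq_zero_iff, norm_sq_eq (A := A), inn_sub_right, h,
    sub_self, norm_zero]

lemma rowMul_mul {ι : Type*} [Fintype ι] (x : ι → E) (c d : CStarMatrix ι ι A) (j : ι) :
    rowMul x (c * d) j = ∑ l, rowMul x c l <• d l j := by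
  refine inn_ext (A := A) fun z => ?_
  simp only [rowMul, inn_sum_right, inn_op_right, CStarMatrix.mul_apply, Finset.mul_sum,
    Finset.sum_mul, mul_assoc]
  exact Finset.sum_comm

variable [StarOrderedRing A]

/-- The matrix of inner products is positive in the matrix algebra. -/
lemma gram_eq_star_mul_self {ι : Type*} [Fintype ι] (x : ι → E) :
    ∃ s : CStarMatrix ι ι A, gram x = star s * s := by
  refine exists_star_mul_self _ (gram_isSelfAdjoint x) fun C Q hCsa h1 => ?_
  have h2 : ∀ l j, star (Q j l) * Q j l = 0 := by
    intro l
    have hd : (star Q * Q) l l = ∑ j, star (Q j l) * Q j l := by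
      simp [CStarMatrix.mul_apply, CStarMatrix.star_apply]
    have hg : gram (rowMul x C) = - (star Q * Q) := by
      rw [gram_rowMul, hCsa.star_eq, ← h1]
    have h3 : 0 ≤ - (star Q * Q) l l := by
      have := inn_self_nonneg (A := A) (rowMul x C l)
      rw [← gram_apply, hg] at this
      simpa using this
    have h4 : ∀ j ∈ Finset.univ, 0 ≤ star (Q j l) * Q j l := fun j _ => star_mul_self_nonneg _
    have h5 : ∑ j, star (Q j l) * Q j l = 0 :=
      le_antisymm (by rw [← hd]; exact neg_nonneg.mp h3) (Finset.sum_nonneg h4)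
    intro j
    exact (Finset.sum_eq_zero_iff_of_nonneg h4).mp h5 j (Finset.mem_univ j)
  ext j l
  exact (CStarRing.star_mul_self_eq_zero_iff _).mp (h2 l j)

end CStarCorrespondence

/-! ### The Hilbert space `E ⊗_σ H` -/

namespace CStarCorrespondence

section Tensor

variable {A : Type*} [NonUnitalCStarAlgebra A]
variable {H : Type*} [NormedAddCommGroup H] [InnerProductSpace ℂ H] [CompleteSpace H]

/-- The algebraic tensor product `E ⊗ H`, to be equipped with the semi-inner product
`⟨x ⊗ h, y ⊗ k⟩ = ⟨h, σ(⟨x, y⟩) k⟩` determined by a representation `σ` of `A` on `H`. -/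
@[nolint unusedArguments]
def PreTensor (E : Type*) [NormedAddCommGroup E] [NormedSpace ℂ E]
    (_σ : A →⋆ₙₐ[ℂ] (H →L[ℂ] H)) : Type _ := E ⊗[ℂ] H

variable {E : Type*} [NormedAddCommGroup E] [NormedSpace ℂ E]
variable (σ : A →⋆ₙₐ[ℂ] (H →L[ℂ] H))

noncomputable instance : AddCommGroup (PreTensor E σ) := inferInstanceAs (AddCommGroup (E ⊗[ℂ] H))
noncomputable instance : Module ℂ (PreTensor E σ) := inferInstanceAs (Module ℂ (E ⊗[ℂ] H))

/-- The elementary tensor `x ⊗ h` in the algebraic tensor product. -/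
def PreTensor.mk (x : E) (h : H) : PreTensor E σ := TensorProduct.tmul ℂ x h

/-- The elementary tensor as a bilinear map. -/
noncomputable def PreTensor.mkₗ : E →ₗ[ℂ] H →ₗ[ℂ] PreTensor E σ := TensorProduct.mk ℂ E H

@[simp] lemma PreTensor.mkₗ_apply (x : E) (h : H) : PreTensor.mkₗ σ x h = PreTensor.mk σ x h := rfl

variable {σ} in
/-- Linear maps out of the algebraic tensor product. -/
noncomputable def PreTensor.lift {K : Type*} [AddCommGroup K] [Module ℂ K]
    (f : E →ₗ[ℂ] H →ₗ[ℂ] K) : PreTensor E σ →ₗ[ℂ] K := TensorProduct.lift f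

@[simp] lemma PreTensor.lift_mk {K : Type*} [AddCommGroup K] [Module ℂ K]
    (f : E →ₗ[ℂ] H →ₗ[ℂ] K) (x : E) (h : H) :
    PreTensor.lift f (PreTensor.mk σ x h) = f x h := rfl

lemma PreTensor.exists_sum (z : PreTensor E σ) :
    ∃ (n : ℕ) (x : Fin n → E) (h : Fin n → H), z = ∑ i, PreTensor.mk σ (x i) (h i) := by
  induction z using TensorProduct.induction_on with
  | zero => exact ⟨0, Fin.elim0, Fin.elim0, by simp; rfl⟩
  | tmul x h => exact ⟨1, fun _ => x, fun _ => h, by simp; rfl⟩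
  | add z w hz hw =>
    obtain ⟨n, x, h, rfl⟩ := hz
    obtain ⟨m, y, k, rfl⟩ := hw
    refine ⟨n + m, Fin.append x y, Fin.append h k, ?_⟩
    rw [Fin.sum_univ_add]
    simp only [Fin.append_left, Fin.append_right]
    rfl

variable [PartialOrder A] [CStarCorrespondence A E]

/-- The sesquilinear form `⟨x ⊗ h, y ⊗ k⟩ = ⟨h, σ(⟨x, y⟩) k⟩` on the algebraic tensor product. -/
noncomputable def PreTensor.form : PreTensor E σ →ₗ⋆[ℂ] PreTensor E σ →ₗ[ℂ] ℂ :=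
  TensorProduct.lift <| LinearMap.mk₂'ₛₗ (starRingEnd ℂ) (starRingEnd ℂ)
    (fun (x : E) (h : H) => PreTensor.lift <| LinearMap.mk₂ ℂ
      (fun (y : E) (k : H) => inner ℂ h (σ (inn A x y) k))
      (fun _ _ _ => by simp [inn_add_right])
      (fun _ _ _ => by simp [inn_smul_right])
      (fun _ _ _ => by simp)
      (fun _ _ _ => by simp))
    (fun x x' h => by
      apply TensorProduct.ext'; intro y k
      exact (by simp [inn_add_left] : inner ℂ h (σ (inn A (x + x') y) k) =
        inner ℂ h (σ (inn A x y) k) + inner ℂ h (σ (inn A x' y) k)))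
    (fun c x h => by
      apply TensorProduct.ext'; intro y k
      exact (by simp [inn_smul_left] : inner ℂ h (σ (inn A (c • x) y) k) =
        star c * inner ℂ h (σ (inn A x y) k)))
    (fun x h h' => by
      apply TensorProduct.ext'; intro y k
      exact (by simp : inner ℂ (h + h') (σ (inn A x y) k) =
        inner ℂ h (σ (inn A x y) k) + inner ℂ h' (σ (inn A x y) k)))
    (fun c x h => by
      apply TensorProduct.ext'; intro y k
      exact (by simp [mul_comm] : inner ℂ (c • h) (σ (inn A x y) k) =
        star c * inner ℂ h (σ (inn A x y) k)))

lemma PreTensor.form_mk (x y : E) (h k : H) :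
    PreTensor.form σ (PreTensor.mk σ x h) (PreTensor.mk σ y k) = inner ℂ h (σ (inn A x y) k) := rfl

lemma PreTensor.form_conj_symm (z w : PreTensor E σ) :
    starRingEnd ℂ (PreTensor.form σ w z) = PreTensor.form σ z w := by
  obtain ⟨n, x, h, rfl⟩ := PreTensor.exists_sum σ z
  obtain ⟨m, y, k, rfl⟩ := PreTensor.exists_sum σ w
  simp only [map_sum, LinearMap.sum_apply, PreTensor.form_mk]
  rw [Finset.sum_comm]
  refine Finset.sum_congr rfl fun i _ => Finset.sum_congr rfl fun j _ => ?_
  rw [inner_conj_symm, ← star_inn, map_star, ContinuousLinearMap.star_eq_adjoint,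
    ContinuousLinearMap.adjoint_inner_left]

/-- The value of the form, computed from a factorization of the matrix of inner products. -/
lemma PreTensor.form_self_eq {n : ℕ} (x : Fin n → E) (h : Fin n → H)
    (s : CStarMatrix (Fin n) (Fin n) A) (hs : gram x = star s * s) :
    PreTensor.form σ (∑ i, PreTensor.mk σ (x i) (h i)) (∑ i, PreTensor.mk σ (x i) (h i)) =
      ((∑ l, ‖∑ j, σ (s l j) (h j)‖ ^ 2 : ℝ) : ℂ) := by
  have h1 : ∀ i j, inn A (x i) (x j) = ∑ l, star (s l i) * s l j := by
    intro i j
    rw [← gram_apply, hs]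
    simp [CStarMatrix.mul_apply, CStarMatrix.star_apply]
  have h2 : ∀ i j, inner ℂ (h i) (σ (inn A (x i) (x j)) (h j)) =
      ∑ l, inner ℂ (σ (s l i) (h i)) (σ (s l j) (h j)) := by
    intro i j
    rw [h1, map_sum, sum_apply, inner_sum]
    refine Finset.sum_congr rfl fun l _ => ?_
    rw [map_mul, map_star, ContinuousLinearMap.star_eq_adjoint, ContinuousLinearMap.mul_def, ContinuousLinearMap.comp_apply,
      ContinuousLinearMap.adjoint_inner_right]
  have h3 : ∀ l, ((‖∑ j, σ (s l j) (h j)‖ ^ 2 : ℝ) : ℂ) =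
      ∑ i, ∑ j, inner ℂ (σ (s l i) (h i)) (σ (s l j) (h j)) := by
    intro l
    have := inner_self_eq_norm_sq_to_K (𝕜 := ℂ) (∑ j, σ (s l j) (h j))
    rw [sum_inner] at this
    simp only [inner_sum] at this
    rw [this]
    simp
  simp only [map_sum, LinearMap.sum_apply, PreTensor.form_mk, h2]
  rw [Complex.ofReal_sum]
  simp only [h3]
  rw [Finset.sum_comm]
  conv_rhs => rw [Finset.sum_comm]; enter [2, i]; rw [Finset.sum_comm]

variable [StarOrderedRing A]

/-- The semi-inner product on `E ⊗ H`. -/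
noncomputable abbrev PreTensor.core : PreInnerProductSpace.Core ℂ (PreTensor E σ) where
  inner z w := PreTensor.form σ z w
  conj_inner_symm z w := PreTensor.form_conj_symm σ z w
  re_inner_nonneg z := by
    obtain ⟨n, x, h, rfl⟩ := PreTensor.exists_sum σ z
    obtain ⟨s, hs⟩ := gram_eq_star_mul_self (A := A) x
    rw [PreTensor.form_self_eq σ x h s hs]
    simp only [RCLike.re_eq_complex_re, Complex.ofReal_re]
    positivity
  add_left _ _ _ := by simp
  smul_left _ _ _ := by simp

noncomputable instance : SeminormedAddCommGroup (PreTensor E σ) :=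
  InnerProductSpace.Core.toSeminormedAddCommGroup (c := PreTensor.core σ)
noncomputable instance : InnerProductSpace ℂ (PreTensor E σ) :=
  InnerProductSpace.ofCore (PreTensor.core σ)

lemma PreTensor.inner_def (z w : PreTensor E σ) : inner ℂ z w = PreTensor.form σ z w := rfl

lemma PreTensor.norm_sq_eq {n : ℕ} (x : Fin n → E) (h : Fin n → H)
    (s : CStarMatrix (Fin n) (Fin n) A) (hs : gram x = star s * s) :
    ‖∑ i, PreTensor.mk σ (x i) (h i)‖ ^ 2 = ∑ l, ‖∑ j, σ (s l j) (h j)‖ ^ 2 := by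
  rw [← inner_self_eq_norm_sq (𝕜 := ℂ), PreTensor.inner_def, PreTensor.form_self_eq σ x h s hs]
  simp only [RCLike.re_eq_complex_re, Complex.ofReal_re]

variable (E) in
/-- The Hilbert space `E ⊗_σ H`: the Hausdorff completion of the algebraic tensor product. -/
abbrev Tensor : Type _ := UniformSpace.Completion (PreTensor E σ)

/-- The elementary tensor `x ⊗ h` in `E ⊗_σ H`. -/
noncomputable def tmul (x : E) (h : H) : Tensor E σ := (PreTensor.mk σ x h : PreTensor E σ)

lemma inner_tmul (x y : E) (h k : H) :
    inner ℂ (tmul σ x h) (tmul σ y k) = inner ℂ h (σ (inn A x y) k) := by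
  rw [tmul, tmul, UniformSpace.Completion.inner_coe]; rfl

/-- The class of a finite sum of elementary tensors. -/
lemma coe_sum_mk {n : ℕ} (x : Fin n → E) (h : Fin n → H) :
    ((∑ i, PreTensor.mk σ (x i) (h i) : PreTensor E σ) : Tensor E σ) = ∑ i, tmul σ (x i) (h i) :=
  map_sum (UniformSpace.Completion.toComplL (𝕜 := ℂ) (E := PreTensor E σ)) _ _

section lift

variable {K : Type*} [NormedAddCommGroup K] [InnerProductSpace ℂ K] [CompleteSpace K]

variable {σ}

/-- Extension to `E ⊗_σ H` of a linear map that is bounded on the algebraic tensor product. -/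
noncomputable def liftCLM (f : E →ₗ[ℂ] H →ₗ[ℂ] K) (C : ℝ)
    (hC : ∀ z : PreTensor E σ, ‖PreTensor.lift f z‖ ≤ C * ‖z‖) : Tensor E σ →L[ℂ] K :=
  ((PreTensor.lift f).mkContinuous C hC).extend
    (UniformSpace.Completion.toComplL (𝕜 := ℂ) (E := PreTensor E σ))

lemma liftCLM_coe (f : E →ₗ[ℂ] H →ₗ[ℂ] K) (C : ℝ)
    (hC : ∀ z : PreTensor E σ, ‖PreTensor.lift f z‖ ≤ C * ‖z‖) (z : PreTensor E σ) :
    liftCLM f C hC z = PreTensor.lift f z :=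
  ContinuousLinearMap.extend_eq _ UniformSpace.Completion.denseRange_coe
    (UniformSpace.Completion.isUniformInducing_coe _) z

@[simp] lemma liftCLM_tmul (f : E →ₗ[ℂ] H →ₗ[ℂ] K) (C : ℝ)
    (hC : ∀ z : PreTensor E σ, ‖PreTensor.lift f z‖ ≤ C * ‖z‖) (x : E) (h : H) :
    liftCLM f C hC (tmul σ x h) = f x h := by
  rw [tmul, liftCLM_coe, PreTensor.lift_mk]

/-- Bounded operators on `E ⊗_σ H` that agree on elementary tensors are equal. -/
lemma clm_ext {L : Type*} [NormedAddCommGroup L] [NormedSpace ℂ L] {f g : Tensor E σ →L[ℂ] L}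
    (hfg : ∀ x h, f (tmul σ x h) = g (tmul σ x h)) : f = g := by
  ext z
  induction z using UniformSpace.Completion.induction_on with
  | hp => exact isClosed_eq f.continuous g.continuous
  | ih z =>
    obtain ⟨n, x, h, rfl⟩ := PreTensor.exists_sum σ z
    rw [coe_sum_mk, map_sum, map_sum]
    exact Finset.sum_congr rfl fun i _ => hfg _ _

lemma liftCLM_norm_le (f : E →ₗ[ℂ] H →ₗ[ℂ] K) (C : ℝ)
    (hC : ∀ z : PreTensor E σ, ‖PreTensor.lift f z‖ ≤ C * ‖z‖) (z : Tensor E σ) :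
    ‖liftCLM f C hC z‖ ≤ C * ‖z‖ := by
  induction z using UniformSpace.Completion.induction_on with
  | hp => exact isClosed_le (by fun_prop) (by fun_prop)
  | ih z => rw [liftCLM_coe, UniformSpace.Completion.norm_coe]; exact hC z

end lift

variable (E) in
/-- The elementary tensor as a bilinear map into `E ⊗_σ H`. -/
noncomputable def tmulₗ : E →ₗ[ℂ] H →ₗ[ℂ] Tensor E σ :=
  (PreTensor.mkₗ σ).compr₂
    (UniformSpace.Completion.toComplL (𝕜 := ℂ) (E := PreTensor E σ)).toLinearMap

@[simp] lemma tmulₗ_apply (x : E) (h : H) : tmulₗ E σ x h = tmul σ x h := rfl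

/-! #### The left action of `A` on `E ⊗_σ H` -/

/-- The action `a (x ⊗ h) = (φ(a) x) ⊗ h` on the algebraic tensor product. -/
noncomputable def PreTensor.action : A →ₙₐ[ℂ] Module.End ℂ (PreTensor E σ) where
  toFun a := PreTensor.lift ((PreTensor.mkₗ σ).comp (φ a : E →L[ℂ] E).toLinearMap)
  map_smul' c a := by apply TensorProduct.ext'; intro x h; simp; rfl
  map_zero' := by apply TensorProduct.ext'; intro x h; simp; rfl
  map_add' a b := by
    apply TensorProduct.ext'; intro x h
    exact (by simp : PreTensor.mkₗ σ (φ (a + b) x) h =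
      PreTensor.mkₗ σ (φ a x) h + PreTensor.mkₗ σ (φ b x) h)
  map_mul' a b := by apply TensorProduct.ext'; intro x h; simp; rfl

lemma PreTensor.action_mk (a : A) (x : E) (h : H) :
    PreTensor.action σ a (PreTensor.mk σ x h) = PreTensor.mk σ (φ a x) h := rfl

lemma PreTensor.inner_action (a : A) (z w : PreTensor E σ) :
    inner ℂ (PreTensor.action σ a z) w = inner ℂ z (PreTensor.action σ (star a) w) := by
  obtain ⟨n, x, h, rfl⟩ := PreTensor.exists_sum σ z
  obtain ⟨m, y, k, rfl⟩ := PreTensor.exists_sum σ w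
  simp only [map_sum, PreTensor.action_mk, sum_inner, inner_sum, PreTensor.inner_def,
    PreTensor.form_mk, inn_φ_left]

lemma PreTensor.norm_action_le (a : A) (z : PreTensor E σ) :
    ‖PreTensor.action σ a z‖ ≤ ‖a‖ * ‖z‖ := by
  set π := Unitization.lift (PreTensor.action (E := E) σ) with hπ
  have hinr : ∀ a : A, π (a : Unitization ℂ A) = PreTensor.action σ a := fun a => by
    simp [hπ]
  have hadj : ∀ (u : Unitization ℂ A) (z w : PreTensor E σ),
      inner ℂ (π u z) w = inner ℂ z (π (star u) w) := by
    intro u z w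
    induction u with
    | inl_add_inr c b =>
      rw [star_add, map_add, map_add, LinearMap.add_apply, LinearMap.add_apply, inner_add_left,
        inner_add_right, ← Unitization.inr_star, hinr, hinr, PreTensor.inner_action]
      congr 1
      have h1 : ∀ c : ℂ, π (Unitization.inl c) = c • 1 := fun c => by
        have := AlgHomClass.commutes π c
        rwa [Unitization.algebraMap_eq_inl, Algebra.algebraMap_eq_smul_one] at this
      rw [← Unitization.inl_star, h1, h1]
      simp [inner_smul_left, inner_smul_right]
  let _ := CStarAlgebra.spectralOrder (Unitization ℂ A)
  have _ := CStarAlgebra.spectralOrderedRing (Unitization ℂ A)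
  have hle := CStarAlgebra.star_mul_le_algebraMap_norm_sq (a := (a : Unitization ℂ A))
  obtain ⟨c, hc⟩ := CStarAlgebra.nonneg_iff_eq_star_mul_self.mp (sub_nonneg.mpr hle)
  have h2 : inner ℂ (π c z) (π c z) = ((‖a‖ ^ 2 * ‖z‖ ^ 2 : ℝ) : ℂ) -
      ((‖PreTensor.action σ a z‖ ^ 2 : ℝ) : ℂ) := by
    rw [hadj, ← Module.End.mul_apply, ← map_mul, ← hc, map_sub, LinearMap.sub_apply,
      inner_sub_right, map_mul, Module.End.mul_apply, ← hadj, hinr, Unitization.norm_inr]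
    congr 1
    · have : π (algebraMap ℝ (Unitization ℂ A) (‖a‖ ^ 2)) = ((‖a‖ ^ 2 : ℝ) : ℂ) • 1 := by
        rw [IsScalarTower.algebraMap_apply ℝ ℂ (Unitization ℂ A), AlgHomClass.commutes π,
          Algebra.algebraMap_eq_smul_one]
        simp
      rw [this, LinearMap.smul_apply, inner_smul_right, Module.End.one_apply,
        inner_self_eq_norm_sq_to_K]
      simp
    · rw [inner_self_eq_norm_sq_to_K]
      simp
  have h3 : ‖π c z‖ ^ 2 = ‖a‖ ^ 2 * ‖z‖ ^ 2 - ‖PreTensor.action σ a z‖ ^ 2 := by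
    rw [inner_self_eq_norm_sq_to_K] at h2
    have h5 : ((‖π c z‖ ^ 2 : ℝ) : ℂ) =
        ((‖a‖ ^ 2 * ‖z‖ ^ 2 - ‖PreTensor.action σ a z‖ ^ 2 : ℝ) : ℂ) := by
      rw [Complex.ofReal_sub, ← h2]; simp
    exact_mod_cast h5
  have h4 := sq_nonneg ‖π c z‖
  rw [h3] at h4
  rw [← sq_le_sq₀ (by positivity) (by positivity), mul_pow]
  linarith

variable (E) in
/-- The representation `a ↦ φ(a) ⊗ I_H` of `A` on `E ⊗_σ H`. -/
noncomputable def leftRep : A →⋆ₙₐ[ℂ] (Tensor E σ →L[ℂ] Tensor E σ) where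
  toFun a := liftCLM ((tmulₗ E σ).comp (φ a : E →L[ℂ] E).toLinearMap) ‖a‖ fun z => by
    have : PreTensor.lift ((tmulₗ E σ).comp (φ a : E →L[ℂ] E).toLinearMap) z =
        ((PreTensor.action σ a z : PreTensor E σ) : Tensor E σ) := by
      obtain ⟨n, x, h, rfl⟩ := PreTensor.exists_sum σ z
      simp only [map_sum, PreTensor.action_mk, coe_sum_mk]
      rfl
    rw [this, UniformSpace.Completion.norm_coe]
    exact PreTensor.norm_action_le σ a z
  map_smul' c a := by apply clm_ext; intro x h; simp [-tmulₗ_apply]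
  map_zero' := by apply clm_ext; intro x h; simp [-tmulₗ_apply]
  map_add' a b := by apply clm_ext; intro x h; simp [-tmulₗ_apply]
  map_mul' a b := by apply clm_ext; intro x h; simp
  map_star' a := by
    rw [ContinuousLinearMap.star_eq_adjoint, ContinuousLinearMap.eq_adjoint_iff]
    intro z w
    induction z, w using UniformSpace.Completion.induction_on₂ with
    | hp => exact isClosed_eq (by fun_prop) (by fun_prop)
    | ih z w =>
      obtain ⟨n, x, h, rfl⟩ := PreTensor.exists_sum σ z
      obtain ⟨m, y, k, rfl⟩ := PreTensor.exists_sum σ w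
      rw [liftCLM_coe, liftCLM_coe]
      simp only [coe_sum_mk, map_sum, sum_inner, inner_sum, PreTensor.lift_mk, LinearMap.comp_apply,
        tmulₗ_apply, ContinuousLinearMap.coe_coe, inner_tmul, inn_φ_left, star_star]

@[simp] lemma leftRep_tmul (a : A) (x : E) (h : H) :
    leftRep E σ a (tmul σ x h) = tmul σ (φ a x) h := by
  simp [leftRep]

variable {σ}

/-! #### Intertwining operators -/

variable {K : Type*} [NormedAddCommGroup K] [InnerProductSpace ℂ K] [CompleteSpace K]
  {τ : A →⋆ₙₐ[ℂ] (K →L[ℂ] K)}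
variable {L : Type*} [NormedAddCommGroup L] [InnerProductSpace ℂ L] [CompleteSpace L]
  {υ : A →⋆ₙₐ[ℂ] (L →L[ℂ] L)}

variable (σ τ) in
/-- `S` intertwines the representations `σ` and `τ`: `S σ(a) = τ(a) S`. -/
def Intertwines (S : H →L[ℂ] K) : Prop := ∀ a, S ∘L σ a = τ a ∘L S

lemma Intertwines.comp {S : K →L[ℂ] L} {R : H →L[ℂ] K} (hS : Intertwines τ υ S)
    (hR : Intertwines σ τ R) : Intertwines σ υ (S ∘L R) := fun a => by
  rw [ContinuousLinearMap.comp_assoc, hR a, ← ContinuousLinearMap.comp_assoc, hS a,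
    ContinuousLinearMap.comp_assoc]

lemma Intertwines.adjoint {S : H →L[ℂ] K} (hS : Intertwines σ τ S) :
    Intertwines τ σ (ContinuousLinearMap.adjoint S) := fun a => by
  have := congrArg ContinuousLinearMap.adjoint (hS (star a))
  simp only [ContinuousLinearMap.adjoint_comp, map_star, ContinuousLinearMap.star_eq_adjoint,
    ContinuousLinearMap.adjoint_adjoint] at this
  exact this.symm

lemma PreTensor.norm_sum_map_le {S : H →L[ℂ] K} (hS : Intertwines σ τ S) {n : ℕ}
    (x : Fin n → E) (h : Fin n → H) :
    ‖∑ i, PreTensor.mk τ (x i) (S (h i))‖ ≤ ‖S‖ * ‖∑ i, PreTensor.mk σ (x i) (h i)‖ := by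
  obtain ⟨s, hs⟩ := gram_eq_star_mul_self (A := A) x
  rw [← sq_le_sq₀ (by positivity) (by positivity), mul_pow, PreTensor.norm_sq_eq τ x _ s hs,
    PreTensor.norm_sq_eq σ x h s hs, Finset.mul_sum]
  refine Finset.sum_le_sum fun l _ => ?_
  have : ∑ j, τ (s l j) (S (h j)) = S (∑ j, σ (s l j) (h j)) := by
    rw [map_sum]
    exact Finset.sum_congr rfl fun j _ => (DFunLike.congr_fun (hS (s l j)) (h j)).symm
  rw [this, ← mul_pow]
  gcongr
  exact S.le_opNorm _

variable (E) in
/-- The operator `I_E ⊗ S : E ⊗_σ H → E ⊗_τ K`, for `S` intertwining `σ` and `τ`. -/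
noncomputable def ampl (S : H →L[ℂ] K) (hS : Intertwines σ τ S) : Tensor E σ →L[ℂ] Tensor E τ :=
  liftCLM ((tmulₗ E τ).compl₂ S.toLinearMap) ‖S‖ fun z => by
    obtain ⟨n, x, h, rfl⟩ := PreTensor.exists_sum σ z
    refine le_trans (le_of_eq ?_) (PreTensor.norm_sum_map_le hS x h)
    rw [← UniformSpace.Completion.norm_coe (∑ i, PreTensor.mk τ (x i) (S (h i))), coe_sum_mk,
      map_sum]
    rfl

@[simp] lemma ampl_tmul (S : H →L[ℂ] K) (hS : Intertwines σ τ S) (x : E) (h : H) :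
    ampl E S hS (tmul σ x h) = tmul τ x (S h) := by
  simp [ampl]

lemma ampl_intertwines (S : H →L[ℂ] K) (hS : Intertwines σ τ S) :
    Intertwines (leftRep E σ) (leftRep E τ) (ampl E S hS) := fun a => by
  apply clm_ext; intro x h; simp

/-! #### Completely contractive covariant representations -/

/-- The norm of the `n × n` matrix `x` over `E`, seen as a matrix over the linking algebra:
`‖x‖² = ‖x⋆ x‖`, where `x⋆ x` is the `A`-valued matrix `(∑ l, ⟨x l i, x l j⟩)`. -/
noncomputable def matNorm (A : Type*) [NonUnitalCStarAlgebra A] [PartialOrder A]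
    [StarOrderedRing A] {E : Type*} [NormedAddCommGroup E] [NormedSpace ℂ E]
    [CStarCorrespondence A E] {n : ℕ} (x : Matrix (Fin n) (Fin n) E) : ℝ :=
  √‖CStarMatrix.ofMatrix (Matrix.of fun i j => ∑ l, inn A (x l i) (x l j))‖

/-- A linear map `T : E → B(H)` is completely contractive: for every `n × n` matrix `x` over `E`
the operator `(T (x i j))` on `Hⁿ` has norm at most the norm of `x`. -/
def CompletelyContractive (A : Type*) [NonUnitalCStarAlgebra A] [PartialOrder A]
    [StarOrderedRing A] {E : Type*} [NormedAddCommGroup E] [NormedSpace ℂ E]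
    [CStarCorrespondence A E] {H : Type*} [NormedAddCommGroup H] [InnerProductSpace ℂ H]
    (T : E →ₗ[ℂ] (H →L[ℂ] H)) : Prop :=
  ∀ (n : ℕ) (x : Matrix (Fin n) (Fin n) E) (h : Fin n → H),
    ∑ i, ‖∑ j, T (x i j) (h j)‖ ^ 2 ≤ matNorm A x ^ 2 * ∑ j, ‖h j‖ ^ 2

variable (σ) in
/-- `(σ, T)` is a completely contractive covariant representation of `E` on `H`. -/
structure IsCCRep (T : E →ₗ[ℂ] (H →L[ℂ] H)) : Prop where
  completelyContractive : CompletelyContractive A T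
  map_left : ∀ (a : A) (x : E), T (φ a x) = σ a ∘L T x
  map_right : ∀ (a : A) (x : E), T (x <• a) = T x ∘L σ a

lemma CompletelyContractive.norm_le {T : E →ₗ[ℂ] (H →L[ℂ] H)} (hT : CompletelyContractive A T)
    (x : E) (h : H) : ‖T x h‖ ≤ ‖x‖ * ‖h‖ := by
  have h1 := hT 1 (fun _ _ => x) (fun _ => h)
  have h2 : matNorm A (n := 1) (fun _ _ => x) ≤ ‖x‖ := by
    let f : A →⋆ₙₐ[ℂ] CStarMatrix (Fin 1) (Fin 1) A :=
      { toFun := fun a => CStarMatrix.ofMatrix (Matrix.of fun _ _ => a)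
        map_smul' := fun _ _ => rfl
        map_zero' := rfl
        map_add' := fun _ _ => rfl
        map_mul' := fun _ _ => by ext; simp [CStarMatrix.mul_apply]
        map_star' := fun _ => by ext; simp [CStarMatrix.star_apply] }
    have h3 : CStarMatrix.ofMatrix (Matrix.of fun i j : Fin 1 => ∑ _l : Fin 1, inn A x x) =
        f (inn A x x) := by
      ext i j; simp; rfl
    unfold matNorm
    rw [Real.sqrt_le_left (norm_nonneg _), norm_sq_eq (A := A), h3]
    exact NonUnitalStarAlgHom.norm_apply_le f _
  have h3 : 0 ≤ matNorm A (n := 1) (fun _ _ => x) := Real.sqrt_nonneg _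
  rw [← sq_le_sq₀ (by positivity) (by positivity), mul_pow]
  simp only [Finset.univ_unique, Finset.sum_singleton] at h1
  exact h1.trans (by gcongr)

lemma CompletelyContractive.row_le {T : E →ₗ[ℂ] (H →L[ℂ] H)} (hT : CompletelyContractive A T)
    {n : ℕ} (x : Fin n → E) (h : Fin n → H) :
    ‖∑ j, T (x j) (h j)‖ ^ 2 ≤ ‖gram (A := A) x‖ * ∑ j, ‖h j‖ ^ 2 := by
  rcases n with _ | n
  · simp
  have h1 := hT (n + 1) (fun i j => if i = 0 then x j else 0) h
  have h2 : matNorm A (n := n + 1) (fun i j => if i = 0 then x j else 0) ^ 2 =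
      ‖gram (A := A) x‖ := by
    unfold matNorm
    rw [Real.sq_sqrt (norm_nonneg _)]
    congr 1
    ext i j
    simp only [CStarMatrix.ofMatrix_apply, Matrix.of_apply, gram_apply]
    rw [Finset.sum_eq_single 0]
    · simp
    · intro b _ hb; simp [hb, inn]
    · simp
  rw [h2, Fin.sum_univ_succ] at h1
  simpa using h1

lemma IsCCRep.norm_sum_le {T : E →ₗ[ℂ] (H →L[ℂ] H)} (hT : IsCCRep σ T) {n : ℕ}
    (x : Fin n → E) (h : Fin n → H) :
    ‖∑ i, T (x i) (h i)‖ ≤ ‖∑ i, PreTensor.mk σ (x i) (h i)‖ := by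
  obtain ⟨N, hN, hgN, hd⟩ := exists_factor _ (gram_eq_star_mul_self (A := A) x)
  have hz := PreTensor.norm_sq_eq σ x h N (by rw [hN.star_eq, hgN])
  refine le_of_forall_pos_le_add fun δ hδ => ?_
  set c : ℝ := ∑ i, ‖h i‖ with hc
  have hc0 : 0 ≤ c := by positivity
  set r : ℝ := δ / (c + 1) with hr
  have hr0 : 0 < r := by positivity
  obtain ⟨d, hd1, hd2⟩ := hd (r ^ 2) (by positivity)
  have hw : ∀ j, ‖x j - rowMul x (d * N) j‖ ≤ r := by
    intro j
    rw [← sq_le_sq₀ (by positivity) (by positivity), norm_sq_eq (A := A)]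
    have e1 : (star (d * N) * gram (A := A) x) j j = inn A (rowMul x (d * N) j) (x j) := by
      rw [← star_inn, inn_rowMul_right]
      have := congrFun (congrFun (star_mul (gram (A := A) x) (d * N)) j) j
      rw [(gram_isSelfAdjoint x).star_eq] at this
      exact this.symm
    have e2 : (star (d * N) * gram (A := A) x * (d * N)) j j =
        inn A (rowMul x (d * N) j) (rowMul x (d * N) j) := by
      rw [← gram_rowMul]; rfl
    have e3 : inn A (x j - rowMul x (d * N) j) (x j - rowMul x (d * N) j) =
        (gram x - gram x * (d * N) - star (d * N) * gram x +
          star (d * N) * gram x * (d * N) : CStarMatrix (Fin n) (Fin n) A) j j := by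
      simp only [CStarMatrix.add_apply, CStarMatrix.sub_apply, e1, e2, ← inn_rowMul_right,
        inn_sub_right, inn_sub_left, gram_apply]
      abel
    rw [e3]
    exact CStarMatrix.norm_entry_le_norm.trans hd2
  set k : Fin n → H := fun l => ∑ j, σ (N l j) (h j) with hk
  have h1 : ∑ l, T (rowMul x d l) (k l) = ∑ j, T (rowMul x (d * N) j) (h j) := by
    simp only [hk, map_sum, rowMul_mul, hT.map_right, sum_apply,
      ContinuousLinearMap.comp_apply]
    exact Finset.sum_comm
  have h2 : ‖∑ j, T (rowMul x (d * N) j) (h j)‖ ≤ ‖∑ i, PreTensor.mk σ (x i) (h i)‖ := by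
    rw [← h1, ← sq_le_sq₀ (by positivity) (by positivity), hz]
    refine (hT.completelyContractive.row_le _ _).trans ?_
    rw [gram_rowMul]
    exact mul_le_of_le_one_left (by positivity) hd1
  have h3 : ∑ i, T (x i) (h i) = ∑ j, T (rowMul x (d * N) j) (h j) +
      ∑ j, T (x j - rowMul x (d * N) j) (h j) := by
    simp [map_sub]
  rw [h3]
  refine (norm_add_le _ _).trans (add_le_add h2 ?_)
  refine (_root_.norm_sum_le _ _).trans ?_
  calc ∑ j, ‖T (x j - rowMul x (d * N) j) (h j)‖ ≤ ∑ j, r * ‖h j‖ :=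
        Finset.sum_le_sum fun j _ => (hT.completelyContractive.norm_le _ _).trans (by
          gcongr; exact hw j)
    _ = r * c := by rw [Finset.mul_sum]
    _ ≤ δ := by
      rw [hr, div_mul_eq_mul_div, div_le_iff₀ (by positivity)]
      nlinarith

/-- The contraction `T̃ : E ⊗_σ H → H`, `T̃ (x ⊗ h) = T(x) h`. -/
noncomputable def IsCCRep.tilde {T : E →ₗ[ℂ] (H →L[ℂ] H)} (hT : IsCCRep σ T) :
    Tensor E σ →L[ℂ] H :=
  liftCLM ((ContinuousLinearMap.coeLM ℂ).comp T) 1 fun z => by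
    obtain ⟨n, x, h, rfl⟩ := PreTensor.exists_sum σ z
    rw [one_mul, map_sum]
    exact hT.norm_sum_le x h

@[simp] lemma IsCCRep.tilde_tmul {T : E →ₗ[ℂ] (H →L[ℂ] H)} (hT : IsCCRep σ T) (x : E) (h : H) :
    hT.tilde (tmul σ x h) = T x h := by
  simp [IsCCRep.tilde]

lemma IsCCRep.tilde_intertwines {T : E →ₗ[ℂ] (H →L[ℂ] H)} (hT : IsCCRep σ T) :
    Intertwines (leftRep E σ) σ hT.tilde := fun a => by
  apply clm_ext; intro x h; simp [hT.map_left]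

/-! #### The identification of `E ⊗ (F ⊗ H)` with `G ⊗ H` for a product `E × F → G` -/

variable {F : Type*} [NormedAddCommGroup F] [NormedSpace ℂ F] [CStarCorrespondence A F]
variable {G : Type*} [NormedAddCommGroup G] [NormedSpace ℂ G] [CStarCorrespondence A G]

/-- The bilinear map `E × F → G` induces an inner product preserving map on `E ⊗_A F`. -/
def PreservesInn (A : Type*) [NonUnitalCStarAlgebra A] [PartialOrder A]
    {E F G : Type*} [NormedAddCommGroup E] [NormedSpace ℂ E] [CStarCorrespondence A E]
    [NormedAddCommGroup F] [NormedSpace ℂ F] [CStarCorrespondence A F]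
    [NormedAddCommGroup G] [NormedSpace ℂ G] [CStarCorrespondence A G]
    (m : E →ₗ[ℂ] F →ₗ[ℂ] G) : Prop :=
  ∀ x x' y y', inn A (m x y) (m x' y') = inn A y (φ (inn A x x') y')

lemma PreservesInn.inner_lift {m : E →ₗ[ℂ] F →ₗ[ℂ] G} (hm : PreservesInn A m) (x x' : E)
    (z w : PreTensor F σ) :
    inner ℂ (PreTensor.lift ((tmulₗ G σ).comp (m x)) z)
      (PreTensor.lift ((tmulₗ G σ).comp (m x')) w) =
    inner ℂ (z : Tensor F σ) (leftRep F σ (inn A x x') (w : Tensor F σ)) := by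
  obtain ⟨n, y, h, rfl⟩ := PreTensor.exists_sum σ z
  obtain ⟨l, y', h', rfl⟩ := PreTensor.exists_sum σ w
  simp only [map_sum, coe_sum_mk, sum_inner, inner_sum, PreTensor.lift_mk, LinearMap.comp_apply,
    tmulₗ_apply, leftRep_tmul, inner_tmul, hm x x' _ _]

variable (σ) in
/-- For fixed `x`, the operator `F ⊗_σ H → G ⊗_σ H`, `y ⊗ h ↦ m(x, y) ⊗ h`. -/
noncomputable def PreservesInn.creation {m : E →ₗ[ℂ] F →ₗ[ℂ] G} (hm : PreservesInn A m) (x : E) :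
    Tensor F σ →L[ℂ] Tensor G σ :=
  liftCLM ((tmulₗ G σ).comp (m x)) (√‖leftRep F σ (inn A x x)‖) fun z => by
    rw [← sq_le_sq₀ (by positivity) (by positivity), mul_pow, Real.sq_sqrt (by positivity),
      ← inner_self_eq_norm_sq (𝕜 := ℂ), hm.inner_lift]
    refine (RCLike.re_le_norm _).trans ((norm_inner_le_norm _ _).trans ?_)
    refine (mul_le_mul_of_nonneg_left (ContinuousLinearMap.le_opNorm _ _)
      (norm_nonneg _)).trans (le_of_eq ?_)
    rw [UniformSpace.Completion.norm_coe]
    ring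

@[simp] lemma PreservesInn.creation_tmul {m : E →ₗ[ℂ] F →ₗ[ℂ] G} (hm : PreservesInn A m) (x : E)
    (y : F) (h : H) : hm.creation σ x (tmul σ y h) = tmul σ (m x y) h := by
  simp [PreservesInn.creation]

lemma PreservesInn.inner_creation {m : E →ₗ[ℂ] F →ₗ[ℂ] G} (hm : PreservesInn A m) (x x' : E)
    (z w : Tensor F σ) : inner ℂ (hm.creation σ x z) (hm.creation σ x' w) =
      inner ℂ z (leftRep F σ (inn A x x') w) := by
  induction z, w using UniformSpace.Completion.induction_on₂ with
  | hp => exact isClosed_eq (by fun_prop) (by fun_prop)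
  | ih z w =>
    rw [← hm.inner_lift, creation, creation, liftCLM_coe, liftCLM_coe]

variable (σ) in
/-- The isometry `E ⊗ (F ⊗_σ H) → G ⊗_σ H`, `x ⊗ (y ⊗ h) ↦ m(x, y) ⊗ h`. -/
noncomputable def PreservesInn.assoc {m : E →ₗ[ℂ] F →ₗ[ℂ] G} (hm : PreservesInn A m) :
    Tensor E (leftRep F σ) →L[ℂ] Tensor G σ :=
  liftCLM (LinearMap.mk₂ ℂ (fun x z => hm.creation σ x z)
      (fun x x' z => by
        have : hm.creation σ (x + x') = hm.creation σ x + hm.creation σ x' := by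
          apply clm_ext; intro y h
          simp only [add_apply, creation_tmul, map_add, LinearMap.add_apply]
          simp only [← tmulₗ_apply, map_add, LinearMap.add_apply]
        rw [this]; rfl)
      (fun c x z => by
        have : hm.creation σ (c • x) = c • hm.creation σ x := by
          apply clm_ext; intro y h
          simp only [smul_apply, creation_tmul, map_smul, LinearMap.smul_apply]
          simp only [← tmulₗ_apply, map_smul, LinearMap.smul_apply]
        rw [this]; rfl)
      (fun x z z' => by simp) (fun c x z => by simp)) 1 fun z => by
    obtain ⟨n, x, z, rfl⟩ := PreTensor.exists_sum _ z
    rw [one_mul, ← sq_le_sq₀ (by positivity) (by positivity), ← inner_self_eq_norm_sq (𝕜 := ℂ),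
      ← inner_self_eq_norm_sq (𝕜 := ℂ)]
    refine le_of_eq ?_
    congr 1
    simp only [map_sum, sum_inner, inner_sum, PreTensor.lift_mk, LinearMap.mk₂_apply,
      hm.inner_creation, PreTensor.inner_def, PreTensor.form_mk]

@[simp] lemma PreservesInn.assoc_tmul {m : E →ₗ[ℂ] F →ₗ[ℂ] G} (hm : PreservesInn A m) (x : E)
    (y : F) (h : H) :
    hm.assoc σ (tmul (leftRep F σ) x (tmul σ y h)) = tmul σ (m x y) h := by
  simp [PreservesInn.assoc]

lemma PreservesInn.assoc_intertwines {m : E →ₗ[ℂ] F →ₗ[ℂ] G} (hm : PreservesInn A m)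
    (hl : ∀ (a : A) (x : E) (y : F), m (φ a x) y = φ a (m x y)) :
    Intertwines (leftRep E (leftRep F σ)) (leftRep G σ) (hm.assoc σ) := fun a => by
  apply clm_ext; intro x z
  have : hm.creation σ (φ a x) = leftRep G σ a ∘L hm.creation σ x := by
    apply clm_ext; intro y h; simp [hl]
  simp only [ContinuousLinearMap.comp_apply, leftRep_tmul, PreservesInn.assoc, liftCLM_tmul,
    LinearMap.mk₂_apply, this]

end Tensor

end CStarCorrespondence

namespace CStarCorrespondence

/-- The correspondence `E` is essential: `φ(A) E` spans a dense subspace of `E`. -/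
def Essential (A E : Type*) [NonUnitalCStarAlgebra A] [PartialOrder A] [NormedAddCommGroup E]
    [NormedSpace ℂ E] [CStarCorrespondence A E] : Prop :=
  (Submodule.span ℂ {y : E | ∃ (a : A) (x : E), φ a x = y}).topologicalClosure = ⊤

end CStarCorrespondence

/-! ### Product systems over `ℤ₊ᵏ` -/

open CStarCorrespondence

/-- A family `X` of correspondences over `A`, indexed by `ℤ₊ᵏ = (Fin k → ℕ)`, with the structure
of a product system. The multiplication `X n × X m → X (n + m)` is written with an index `p` and a
proof of `n + m = p`, so that associativity can be stated. For `n, m ≠ 0` the multiplication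
extends to an isomorphism of correspondences `X n ⊗_A X m → X (n + m)`: it preserves the inner
products `⟨x ⊗ y, x' ⊗ y'⟩ = ⟨y, φ(⟨x, x'⟩) y'⟩` and products span a dense subspace (that it is a
bimodule map follows from associativity and from `unit_mul` and `mul_unit`).
The correspondence `X 0` is `A`, through the isomorphism `unit`, and the multiplication by elements
of `X 0` is given by the left and right actions of `A`. -/
class ProductSystem (A : Type*) [NonUnitalCStarAlgebra A] [PartialOrder A] [StarOrderedRing A]
    {k : ℕ} (X : (Fin k → ℕ) → Type*) [∀ n, NormedAddCommGroup (X n)] [∀ n, NormedSpace ℂ (X n)]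
    [∀ n, CStarCorrespondence A (X n)] where
  mul : ∀ {n m p : Fin k → ℕ}, n + m = p → (X n →ₗ[ℂ] X m →ₗ[ℂ] X p)
  mul_assoc : ∀ {n m l nm ml p : Fin k → ℕ} (h₁ : n + m = nm) (h₂ : nm + l = p) (h₃ : m + l = ml)
    (h₄ : n + ml = p) (x : X n) (y : X m) (z : X l),
    mul h₂ (mul h₁ x y) z = mul h₄ x (mul h₃ y z)
  unit : A ≃ₗ[ℂ] X 0
  inn_unit : ∀ a b : A, inn A (unit a) (unit b) = star a * b
  φ_unit : ∀ a b : A, φ a (unit b) = unit (a * b)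
  unit_op : ∀ a b : A, unit a <• b = unit (a * b)
  unit_mul : ∀ {n : Fin k → ℕ} (a : A) (x : X n), mul (zero_add n) (unit a) x = φ a x
  mul_unit : ∀ {n : Fin k → ℕ} (x : X n) (a : A), mul (add_zero n) x (unit a) = x <• a
  inn_mul : ∀ {n m p : Fin k → ℕ} (h : n + m = p), n ≠ 0 → m ≠ 0 → PreservesInn A (mul h)
  dense_mul : ∀ {n m p : Fin k → ℕ} (h : n + m = p), n ≠ 0 → m ≠ 0 →
    (Submodule.span ℂ {z : X p | ∃ x y, mul h x y = z}).topologicalClosure = ⊤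

namespace ProductSystem

/-- The multi-index `e(u) = ∑_{i ∈ u} e_i`. -/
def eSet {k : ℕ} (u : Finset (Fin k)) : Fin k → ℕ := fun i => if i ∈ u then 1 else 0

/-- The multi-index `e_i`. -/
def eIdx {k : ℕ} (i : Fin k) : Fin k → ℕ := Pi.single i 1

lemma eSet_mono {k : ℕ} {u v : Finset (Fin k)} (h : u ⊆ v) : eSet u ≤ eSet v := fun i => by
  by_cases hu : i ∈ u
  · simp [eSet, hu, h hu]
  · simp [eSet, hu]

/-- The least index at which a nonzero multi-index is nonzero. -/
def firstIdx {k : ℕ} (n : Fin k → ℕ) (hn : n ≠ 0) : Fin k :=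
  (Finset.univ.filter fun i => n i ≠ 0).min' <| by
    obtain ⟨i, hi⟩ := Function.ne_iff.mp hn
    exact ⟨i, by simpa using hi⟩

lemma firstIdx_spec {k : ℕ} (n : Fin k → ℕ) (hn : n ≠ 0) : n (firstIdx n hn) ≠ 0 :=
  (Finset.mem_filter.mp (Finset.min'_mem (Finset.univ.filter fun i => n i ≠ 0) _)).2

lemma eIdx_firstIdx_add {k : ℕ} (n : Fin k → ℕ) (hn : n ≠ 0) :
    eIdx (firstIdx n hn) + (n - eIdx (firstIdx n hn)) = n := by
  refine add_tsub_cancel_of_le fun i => ?_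
  by_cases hi : i = firstIdx n hn
  · rw [hi, eIdx, Pi.single_eq_same]
    exact Nat.one_le_iff_ne_zero.mpr (firstIdx_spec n hn)
  · simp [eIdx, hi]

variable {A : Type*} [NonUnitalCStarAlgebra A] [PartialOrder A] [StarOrderedRing A]
variable {k : ℕ} {X : (Fin k → ℕ) → Type*} [∀ n, NormedAddCommGroup (X n)]
  [∀ n, NormedSpace ℂ (X n)] [∀ n, CStarCorrespondence A (X n)] [ProductSystem A X]
variable {H : Type*} [NormedAddCommGroup H] [InnerProductSpace ℂ H] [CompleteSpace H]

variable (A) in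
lemma preservesInn_mul {n m p : Fin k → ℕ} (h : n + m = p) :
    PreservesInn A (mul A h : X n →ₗ[ℂ] X m →ₗ[ℂ] X p) := by
  by_cases hn : n = 0
  · subst hn
    obtain rfl : m = p := by rw [← h, zero_add]
    intro x x' y y'
    obtain ⟨a, rfl⟩ := (unit (A := A) (X := X)).surjective x
    obtain ⟨a', rfl⟩ := (unit (A := A) (X := X)).surjective x'
    rw [unit_mul, unit_mul, inn_unit, inn_φ_left, map_mul]
    rfl
  by_cases hm : m = 0
  · subst hm
    obtain rfl : n = p := by rw [← h, add_zero]
    intro x x' y y'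
    obtain ⟨a, rfl⟩ := (unit (A := A) (X := X)).surjective y
    obtain ⟨a', rfl⟩ := (unit (A := A) (X := X)).surjective y'
    rw [mul_unit, mul_unit, inn_op_left, inn_op_right, φ_unit, inn_unit]
  exact inn_mul h hn hm

lemma mul_φ {n m p : Fin k → ℕ} (h : n + m = p) (a : A) (x : X n) (y : X m) :
    mul A h (φ a x) y = φ a (mul A h x y : X p) := by
  rw [← unit_mul, ← unit_mul, mul_assoc (zero_add n) h h (zero_add p)]

/-- The identification `X n ⊗ (X m ⊗_σ H) → X (n + m) ⊗_σ H`, `x ⊗ (y ⊗ h) ↦ (x y) ⊗ h`. It is an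
isometry; if `n ≠ 0` or `m = 0` it is onto, and its adjoint is its inverse. -/
noncomputable def ident {n m p : Fin k → ℕ} (h : n + m = p) (σ : A →⋆ₙₐ[ℂ] (H →L[ℂ] H)) :
    Tensor (X n) (leftRep (X m) σ) →L[ℂ] Tensor (X p) σ :=
  (preservesInn_mul A h).assoc σ

lemma ident_intertwines {n m p : Fin k → ℕ} (h : n + m = p) (σ : A →⋆ₙₐ[ℂ] (H →L[ℂ] H)) :
    Intertwines (leftRep (X n) (leftRep (X m) σ)) (leftRep (X p) σ) (ident h σ) :=
  (preservesInn_mul A h).assoc_intertwines (mul_φ h)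

/-- The isomorphism `t_{i,j} ⊗ I_H : E_i ⊗ E_j ⊗ H → E_j ⊗ E_i ⊗ H`, where `E_i = X e_i` and
`t_{i,j}` identifies `E_i ⊗ E_j` and `E_j ⊗ E_i` through their isomorphisms with
`X (e_i + e_j)`. -/
noncomputable def swap (X : (Fin k → ℕ) → Type*) [∀ n, NormedAddCommGroup (X n)]
    [∀ n, NormedSpace ℂ (X n)] [∀ n, CStarCorrespondence A (X n)] [ProductSystem A X]
    (i j : Fin k) (σ : A →⋆ₙₐ[ℂ] (H →L[ℂ] H)) :
    Tensor (X (eIdx i)) (leftRep (X (eIdx j)) σ) →L[ℂ]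
      Tensor (X (eIdx j)) (leftRep (X (eIdx i)) σ) :=
  ContinuousLinearMap.adjoint (ident (add_comm (eIdx j) (eIdx i)) σ) ∘L ident rfl σ

/-- The map `A ⊗_σ H → H`, `a ⊗ h ↦ σ(a) h`, with `X 0` in place of `A`. -/
noncomputable def tildeZero (X : (Fin k → ℕ) → Type*) [∀ n, NormedAddCommGroup (X n)]
    [∀ n, NormedSpace ℂ (X n)] [∀ n, CStarCorrespondence A (X n)] [ProductSystem A X]
    (σ : A →⋆ₙₐ[ℂ] (H →L[ℂ] H)) : Tensor (X 0) σ →L[ℂ] H :=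
  liftCLM ((ContinuousLinearMap.coeLM ℂ).comp
      ((σ : A →ₗ[ℂ] (H →L[ℂ] H)).comp (unit (A := A) (X := X)).symm.toLinearMap)) 1 fun z => by
    obtain ⟨n, x, h, rfl⟩ := PreTensor.exists_sum σ z
    rw [one_mul, ← sq_le_sq₀ (by positivity) (by positivity), ← inner_self_eq_norm_sq (𝕜 := ℂ),
      ← inner_self_eq_norm_sq (𝕜 := ℂ)]
    refine le_of_eq ?_
    congr 1
    simp only [map_sum, sum_inner, inner_sum, PreTensor.lift_mk, PreTensor.inner_def,
      PreTensor.form_mk]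
    refine Finset.sum_congr rfl fun i _ => Finset.sum_congr rfl fun j _ => ?_
    obtain ⟨a, ha⟩ := (unit (A := A) (X := X)).surjective (x i)
    obtain ⟨b, hb⟩ := (unit (A := A) (X := X)).surjective (x j)
    rw [← ha, ← hb, inn_unit, map_mul, map_star, ContinuousLinearMap.star_eq_adjoint,
      ContinuousLinearMap.mul_def, ContinuousLinearMap.comp_apply,
      ContinuousLinearMap.adjoint_inner_right]
    simp

@[simp] lemma tildeZero_tmul (σ : A →⋆ₙₐ[ℂ] (H →L[ℂ] H)) (a : A) (h : H) :
    tildeZero X σ (tmul σ (unit a) h) = σ a h := by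
  simp [tildeZero]

lemma tildeZero_intertwines (σ : A →⋆ₙₐ[ℂ] (H →L[ℂ] H)) :
    Intertwines (leftRep (X 0) σ) σ (tildeZero X σ) := fun a => by
  apply clm_ext; intro x h
  obtain ⟨b, rfl⟩ := (unit (A := A) (X := X)).surjective x
  simp [φ_unit]

variable (A X) in
/-- A completely contractive representation `(σ, T⁽¹⁾, …, T⁽ᵏ⁾)` of the product system `X` on `H`.
Nondegeneracy of `σ` is the separate predicate `Rep.Nondegenerate`. -/
structure Rep (H : Type*) [NormedAddCommGroup H] [InnerProductSpace ℂ H] [CompleteSpace H] where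
  σ : A →⋆ₙₐ[ℂ] (H →L[ℂ] H)
  T : ∀ i : Fin k, X (eIdx i) →ₗ[ℂ] (H →L[ℂ] H)
  isCCRep : ∀ i, IsCCRep σ (T i)
  commute : ∀ i j : Fin k,
    (isCCRep i).tilde ∘L ampl (X (eIdx i)) (isCCRep j).tilde (isCCRep j).tilde_intertwines =
      (isCCRep j).tilde ∘L ampl (X (eIdx j)) (isCCRep i).tilde (isCCRep i).tilde_intertwines ∘L
        swap X i j σ

namespace Rep

variable (R : Rep A X H)

/-- The representation `σ` of `A` is nondegenerate. -/
def Nondegenerate : Prop :=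
  (Submodule.span ℂ {y : H | ∃ a h, R.σ a h = y}).topologicalClosure = ⊤

/-- The contraction `T̃⁽ⁱ⁾ : E_i ⊗ H → H`. -/
noncomputable def tilde (i : Fin k) : Tensor (X (eIdx i)) R.σ →L[ℂ] H := (R.isCCRep i).tilde

lemma tilde_intertwines (i : Fin k) : Intertwines (leftRep (X (eIdx i)) R.σ) R.σ (R.tilde i) :=
  (R.isCCRep i).tilde_intertwines

/-- The operators `T̃_n`, together with their covariance. They are defined by
`T̃_0 (a ⊗ h) = σ(a) h` and, if `i` is the first index with `n_i ≠ 0`, by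
`T̃_n = T̃⁽ⁱ⁾ (I ⊗ T̃_{n - e_i})`, where `X n ⊗ H` is identified with
`E_i ⊗ (X (n - e_i) ⊗ H)`. -/
noncomputable def tildeAux (n : Fin k → ℕ) :
    {S : Tensor (X n) R.σ →L[ℂ] H // Intertwines (leftRep (X n) R.σ) R.σ S} :=
  if hn : n = 0 then
    hn ▸ ⟨tildeZero X R.σ, tildeZero_intertwines R.σ⟩
  else
    ⟨R.tilde (firstIdx n hn) ∘L
        ampl (X (eIdx (firstIdx n hn))) (tildeAux (n - eIdx (firstIdx n hn))).1
          (tildeAux (n - eIdx (firstIdx n hn))).2 ∘L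
        ContinuousLinearMap.adjoint (ident (eIdx_firstIdx_add n hn) R.σ),
      (R.tilde_intertwines _).comp
        ((ampl_intertwines _ _).comp (ident_intertwines _ _).adjoint)⟩
termination_by ∑ i, n i
decreasing_by
  all_goals
    refine Finset.sum_lt_sum (fun i _ => Nat.sub_le _ _) ⟨firstIdx n hn, Finset.mem_univ _, ?_⟩
    have := firstIdx_spec n hn
    simp only [Pi.sub_apply, eIdx, Pi.single_eq_same]
    omega

/-- The operator `T̃_n : X n ⊗ H → H`. -/
noncomputable def tildeN (n : Fin k → ℕ) : Tensor (X n) R.σ →L[ℂ] H := (R.tildeAux n).1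

lemma tildeN_intertwines (n : Fin k → ℕ) : Intertwines (leftRep (X n) R.σ) R.σ (R.tildeN n) :=
  (R.tildeAux n).2

/-- The operator `I_p ⊗ T̃_q⋆ T̃_q` on `X (p + q) ⊗ H`, identified with `X p ⊗ (X q ⊗ H)`. (For
`p = 0` and nondegenerate `σ` this is `T̃_q⋆ T̃_q`.) -/
noncomputable def amplSq {p q r : Fin k → ℕ} (h : p + q = r) :
    Tensor (X r) R.σ →L[ℂ] Tensor (X r) R.σ :=
  ident h R.σ ∘L
    ampl (X p) (ContinuousLinearMap.adjoint (R.tildeN q) ∘L R.tildeN q)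
      ((R.tildeN_intertwines q).adjoint.comp (R.tildeN_intertwines q)) ∘L
    ContinuousLinearMap.adjoint (ident h R.σ)

/-- The operator `∑_{u ⊆ v} (-1)^{|u|} (I_{e(v) - e(u)} ⊗ T̃_{e(u)}⋆ T̃_{e(u)})` on
`X (e(v)) ⊗ H`. -/
noncomputable def defect (v : Finset (Fin k)) :
    Tensor (X (eSet v)) R.σ →L[ℂ] Tensor (X (eSet v)) R.σ :=
  ∑ u : v.powerset, (-1 : ℂ) ^ u.1.card •
    R.amplSq (tsub_add_cancel_of_le (eSet_mono (Finset.mem_powerset.mp u.2)))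

/-- The positive part `n₊` of `n ∈ ℤᵏ`. -/
def posIdx (n : Fin k → ℤ) : Fin k → ℕ := fun i => (n i).toNat

/-- The negative part `n₋ = n₊ - n` of `n ∈ ℤᵏ`. -/
def negIdx (n : Fin k → ℤ) : Fin k → ℕ := fun i => (-n i).toNat

/-- The operator `T(n) = T̃_{n₋}⋆ T̃_{n₊}`, for `n ∈ ℤᵏ`. -/
noncomputable def opZ (n : Fin k → ℤ) :
    Tensor (X (posIdx n)) R.σ →L[ℂ] Tensor (X (negIdx n)) R.σ :=
  ContinuousLinearMap.adjoint (R.tildeN (negIdx n)) ∘L R.tildeN (posIdx n)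

/-- `V = (ρ, V⁽¹⁾, …, V⁽ᵏ⁾)` on `K` is a regular isometric dilation of `R = (σ, T⁽¹⁾, …, T⁽ᵏ⁾)`
on `H`, where `H` is regarded as a subspace of `K` through the isometry `ι`. -/
structure IsRegularIsometricDilation {K : Type*} [NormedAddCommGroup K] [InnerProductSpace ℂ K]
    [CompleteSpace K] (V : Rep A X K) (ι : H →ₗᵢ[ℂ] K) : Prop where
  /-- each `Ṽ⁽ⁱ⁾` is an isometry -/
  isometry : ∀ i, Isometry (V.tilde i)
  /-- `H` is invariant under all `V⁽ⁱ⁾(x)⋆` -/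
  invariant : ∀ (i : Fin k) (x : X (eIdx i)) (h : H),
    ContinuousLinearMap.adjoint (V.T i x) (ι h) ∈ Set.range ι
  /-- `H` reduces `ρ`, and `ρ` restricts to `σ` on `H` (the invariance of `H` under the
  self-adjoint set `ρ(A)` is part of the equality) -/
  restrict : Intertwines R.σ V.σ ι.toContinuousLinearMap
  /-- `(I ⊗ P_H) V(n) = T(n)` on `X (n₊) ⊗ H`, where `P_H = ι⋆` -/
  regular : ∀ n : Fin k → ℤ,
    ampl (X (negIdx n)) (ContinuousLinearMap.adjoint ι.toContinuousLinearMap) restrict.adjoint ∘L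
      V.opZ n ∘L ampl (X (posIdx n)) ι.toContinuousLinearMap restrict = R.opZ n

/-- `K` is the smallest closed subspace of `K` that contains `H` and is invariant under all
`V⁽ⁱ⁾(x)`. -/
def IsMinimal {K : Type*} [NormedAddCommGroup K] [InnerProductSpace ℂ K] [CompleteSpace K]
    (V : Rep A X K) (ι : H →ₗᵢ[ℂ] K) : Prop :=
  ∀ M : Submodule ℂ K, IsClosed (M : Set K) → (∀ h, ι h ∈ M) →
    (∀ (i : Fin k) (x : X (eIdx i)), ∀ y ∈ M, V.T i x y ∈ M) → M = ⊤

/-- `R` has a regular isometric dilation. (The universe of `K` is large enough for all dilations to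
be considered, up to a change of universe.) -/
def HasRegularIsometricDilation {A : Type uA} [NonUnitalCStarAlgebra A] [PartialOrder A]
    [StarOrderedRing A] {k : ℕ} {X : (Fin k → ℕ) → Type uX} [∀ n, NormedAddCommGroup (X n)]
    [∀ n, NormedSpace ℂ (X n)] [∀ n, CStarCorrespondence A (X n)] [ProductSystem A X]
    {H : Type uH} [NormedAddCommGroup H] [InnerProductSpace ℂ H] [CompleteSpace H]
    (R : Rep A X H) : Prop :=
  ∃ (K : Type (max uX uH w)) (_ : NormedAddCommGroup K) (_ : InnerProductSpace ℂ K)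
    (_ : CompleteSpace K) (V : Rep A X K) (ι : H →ₗᵢ[ℂ] K), IsRegularIsometricDilation R V ι

/-- `R` has a minimal regular isometric dilation. -/
def HasMinimalRegularIsometricDilation {A : Type uA} [NonUnitalCStarAlgebra A] [PartialOrder A]
    [StarOrderedRing A] {k : ℕ} {X : (Fin k → ℕ) → Type uX} [∀ n, NormedAddCommGroup (X n)]
    [∀ n, NormedSpace ℂ (X n)] [∀ n, CStarCorrespondence A (X n)] [ProductSystem A X]
    {H : Type uH} [NormedAddCommGroup H] [InnerProductSpace ℂ H] [CompleteSpace H]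
    (R : Rep A X H) : Prop :=
  ∃ (K : Type (max uX uH w)) (_ : NormedAddCommGroup K) (_ : InnerProductSpace ℂ K)
    (_ : CompleteSpace K) (V : Rep A X K) (ι : H →ₗᵢ[ℂ] K),
    IsRegularIsometricDilation R V ι ∧ IsMinimal V ι

/-- `R` has a minimal regular isometric dilation `(ρ, V⁽¹⁾, …, V⁽ᵏ⁾)` with `ρ` nondegenerate. -/
def HasMinimalNondegenerateRegularIsometricDilation {A : Type uA} [NonUnitalCStarAlgebra A]
    [PartialOrder A] [StarOrderedRing A] {k : ℕ} {X : (Fin k → ℕ) → Type uX}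
    [∀ n, NormedAddCommGroup (X n)] [∀ n, NormedSpace ℂ (X n)] [∀ n, CStarCorrespondence A (X n)]
    [ProductSystem A X] {H : Type uH} [NormedAddCommGroup H] [InnerProductSpace ℂ H]
    [CompleteSpace H] (R : Rep A X H) : Prop :=
  ∃ (K : Type (max uX uH w)) (_ : NormedAddCommGroup K) (_ : InnerProductSpace ℂ K)
    (_ : CompleteSpace K) (V : Rep A X K) (ι : H →ₗᵢ[ℂ] K),
    IsRegularIsometricDilation R V ι ∧ IsMinimal V ι ∧ V.Nondegenerate

end Rep

end ProductSystem

/-! Everything is governed by one kernel. For `p ≤ n` write `L(p, n) = I ⊗ T̃_{n-p}`, an operator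
from `X n ⊗ H` to `X p ⊗ H` (`low`). If `V` is a regular isometric dilation, then on `X m ⊗ H` and
`X n ⊗ H` the operators satisfy `Ṽ_n⋆ Ṽ_m = L(n ∧ m, n)⋆ L(n ∧ m, m)`: the common factor of degree
`n ∧ m` cancels because `V` is isometric, the remaining degrees have disjoint supports, and there
regularity gives the value (`IsRegularIsometricDilation.inner_restr`). So `T` determines the kernel,
and the question is whether it is positive.

Necessity: `Z = ∑_{u ⊆ v} (-1)^|u| Ṽ_{e(v)-e(u)} L(e(v)-e(u), e(v))` satisfies `Z⋆ Z = defect v`,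
because the cross term of `u` and `w` depends only on `u ∪ w` and inclusion-exclusion collapses the
double sum (`Finset.sum_powerset_union`).

Sufficiency: Möbius inversion on the grid (`sum_Iic_alternating`) writes the kernel as `∑_{p ≤ n ∧
m} L(p, n)⋆ D_p L(p, m)`, where `D_p` is the alternating sum over `u ⊆ supp p`. Up to identification
`D_p` is `I ⊗ defect (supp p)`, hence positive (`defectAt_isPositive`), with a root `C_p` commuting
with `A`. Then `Φ(n) z = (C_p L(p, n) z)_p` in an `ℓ²` sum realizes the kernel
(`exists_generatingFamily`). The kernel is invariant under left multiplication by `X p`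
(`inner_Φ_lmul`), so `V(x) Φ(n) z = Φ(p + n)(x z)` defines isometric operators, and restricting to
the closed span of the ranges makes the dilation minimal. If the `E_i` are essential, `ρ(A)` reaches
all of this span.

A recurrent obstacle is that `X 0 ⊗ X m → X m` need not be onto, the left action being possibly
degenerate. Wherever the index `0` stands on the left, nondegeneracy of `σ` takes the place of
density of products. -/

namespace CStarCorrespondence

/-! ### Hilbert tensor products: amplifications, adjoints, positivity, complete contractivity. -/

section TensorLemmas

variable {A : Type*} [NonUnitalCStarAlgebra A] [PartialOrder A] [StarOrderedRing A]
variable {H : Type*} [NormedAddCommGroup H] [InnerProductSpace ℂ H] [CompleteSpace H]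
variable {K : Type*} [NormedAddCommGroup K] [InnerProductSpace ℂ K] [CompleteSpace K]
variable {L : Type*} [NormedAddCommGroup L] [InnerProductSpace ℂ L] [CompleteSpace L]
variable {E : Type*} [NormedAddCommGroup E] [NormedSpace ℂ E] [CStarCorrespondence A E]
variable {F : Type*} [NormedAddCommGroup F] [NormedSpace ℂ F] [CStarCorrespondence A F]
variable {G : Type*} [NormedAddCommGroup G] [NormedSpace ℂ G] [CStarCorrespondence A G]
variable {σ : A →⋆ₙₐ[ℂ] (H →L[ℂ] H)} {τ : A →⋆ₙₐ[ℂ] (K →L[ℂ] K)} {υ : A →⋆ₙₐ[ℂ] (L →L[ℂ] L)}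

lemma norm_rep_apply_le (a : A) (h : H) : ‖σ a h‖ ≤ ‖a‖ * ‖h‖ :=
  ((σ a).le_opNorm h).trans
    (mul_le_mul_of_nonneg_right (NonUnitalStarAlgHom.norm_apply_le σ a) (norm_nonneg h))

lemma inner_rep_left (a : A) (h k : H) : inner ℂ (σ a h) k = inner ℂ h (σ (star a) k) := by
  rw [map_star, ContinuousLinearMap.star_eq_adjoint, ContinuousLinearMap.adjoint_inner_right]

lemma norm_tmul_le (x : E) (h : H) : ‖tmul σ x h‖ ≤ ‖x‖ * ‖h‖ := by
  rw [← sq_le_sq₀ (by positivity) (by positivity), mul_pow,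
    CStarCorrespondence.norm_sq_eq (A := A) x, ← inner_self_eq_norm_sq (𝕜 := ℂ) (tmul σ x h),
    inner_tmul]
  refine (RCLike.re_le_norm _).trans ((norm_inner_le_norm _ _).trans ?_)
  refine (mul_le_mul_of_nonneg_left (norm_rep_apply_le _ _) (norm_nonneg _)).trans (le_of_eq ?_)
  ring

lemma tmul_add_left (x y : E) (h : H) : tmul σ (x + y) h = tmul σ x h + tmul σ y h := by
  simp only [← tmulₗ_apply, map_add, LinearMap.add_apply]

lemma tmul_smul_left (c : ℂ) (x : E) (h : H) : tmul σ (c • x) h = c • tmul σ x h := by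
  simp only [← tmulₗ_apply, map_smul, LinearMap.smul_apply]

/-- The algebraic tensor product is over `ℂ`, so balancing over `A` comes from the form: the
difference of the two sides is a null vector. -/
lemma tmul_op (x : E) (a : A) (h : H) : tmul σ (x <• a) h = tmul σ x (σ a h) := by
  rw [← sub_eq_zero, ← inner_self_eq_zero (𝕜 := ℂ)]
  simp only [inner_sub_left, inner_sub_right, inner_tmul, inn_op_left, inn_op_right, map_mul,
    inner_rep_left, map_star, ContinuousLinearMap.mul_def, ContinuousLinearMap.comp_apply]
  simp

variable (σ E) in
/-- The elementary tensor as a bounded operator in its first variable. -/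
noncomputable def tmulLeft (h : H) : E →L[ℂ] Tensor E σ :=
  LinearMap.mkContinuous ((tmulₗ E σ).flip h) ‖h‖ fun x => by
    rw [mul_comm]; exact norm_tmul_le x h

@[simp] lemma tmulLeft_apply (x : E) (h : H) : tmulLeft E σ h x = tmul σ x h := rfl

variable (σ) in
/-- The elementary tensor as a bounded operator in its second variable. -/
noncomputable def tmulRight (x : E) : H →L[ℂ] Tensor E σ :=
  LinearMap.mkContinuous (tmulₗ E σ x) ‖x‖ fun h => norm_tmul_le x h

@[simp] lemma tmulRight_apply (x : E) (h : H) : tmulRight σ x h = tmul σ x h := rfl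

/-- Two bounded operators on a Hilbert tensor product agree if they agree on the tensors `x ⊗ h`,
where `x` runs over a set with dense span. -/
lemma clm_ext_of_dense {N : Type*} [NormedAddCommGroup N] [NormedSpace ℂ N] {s : Set E}
    (hs : (Submodule.span ℂ s).topologicalClosure = ⊤) {f g : Tensor E σ →L[ℂ] N}
    (hfg : ∀ x ∈ s, ∀ h, f (tmul σ x h) = g (tmul σ x h)) : f = g := by
  refine clm_ext fun x h => ?_
  have hd : Dense (Submodule.span ℂ s : Set E) :=
    (Submodule.dense_iff_topologicalClosure_eq_top).mpr hs
  have : f ∘L tmulLeft E σ h = g ∘L tmulLeft E σ h :=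
    ContinuousLinearMap.ext_on hd fun x hx => hfg x hx h
  exact DFunLike.congr_fun this x

lemma norm_sq_sub_op (x : E) (a : A) :
    ‖x - x <• a‖ ^ 2 = ‖inn A x x - inn A x x * a - star a * inn A x x +
      star a * inn A x x * a‖ := by
  rw [norm_sq_eq (A := A)]
  congr 1
  simp only [inn_sub_left, inn_sub_right, inn_op_left, inn_op_right, mul_assoc, sub_mul]
  abel

/-- `E A` is dense in `E`. -/
lemma dense_op :
    (Submodule.span ℂ {z : E | ∃ (x : E) (a : A), x <• a = z}).topologicalClosure = ⊤ := by
  refine Submodule.dense_iff_topologicalClosure_eq_top.mp ?_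
  rw [Metric.dense_iff]
  intro x r hr
  obtain ⟨N, -, -, hd⟩ := exists_factor (inn A x x)
    (CStarAlgebra.nonneg_iff_eq_star_mul_self.mp (inn_self_nonneg x))
  -- The element `d * N` is an approximate unit for `⟨x, x⟩`, and the quantity bounded here is `‖x -
  -- x (d N)‖ ^ 2`; the choice `(r / 2) ^ 2` makes the distance strictly less than `r`.
  obtain ⟨d, -, hd2⟩ := hd ((r / 2) ^ 2) (by positivity)
  refine ⟨x <• (d * N), ?_, Submodule.subset_span ⟨x, _, rfl⟩⟩
  rw [← norm_sq_sub_op, sq_le_sq₀ (by positivity) (by positivity)] at hd2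
  rw [Metric.mem_ball, dist_comm, dist_eq_norm]
  linarith

lemma ampl_comp (S : K →L[ℂ] L) (hS : Intertwines τ υ S) (R : H →L[ℂ] K)
    (hR : Intertwines σ τ R) :
    ampl E S hS ∘L ampl E R hR = ampl E (S ∘L R) (hS.comp hR) := by
  apply clm_ext; intro x h; simp

lemma adjoint_ampl (S : H →L[ℂ] K) (hS : Intertwines σ τ S) :
    ContinuousLinearMap.adjoint (ampl E S hS) =
      ampl E (ContinuousLinearMap.adjoint S) hS.adjoint := by
  symm
  rw [ContinuousLinearMap.eq_adjoint_iff]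
  intro z w
  have h1 : ∀ x h, ContinuousLinearMap.adjoint (ampl E (ContinuousLinearMap.adjoint S) hS.adjoint)
      (tmul σ x h) = ampl E S hS (tmul σ x h) := by
    intro x h
    refine ext_inner_left ℂ fun v => ?_
    rw [ContinuousLinearMap.adjoint_inner_right]
    -- `clm_ext` tests bounded linear maps only, so the inner product is conjugated into a
    -- functional of `v`, which can then be checked on elementary tensors. The same device serves in
    -- later proofs.
    have : innerSL ℂ (tmul σ x h) ∘L (ampl E (ContinuousLinearMap.adjoint S) hS.adjoint) =
        innerSL ℂ (ampl E S hS (tmul σ x h)) := by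
      apply clm_ext; intro y k
      simp only [ContinuousLinearMap.comp_apply, innerSL_apply_apply, ampl_tmul, inner_tmul]
      have h2 := DFunLike.congr_fun (hS.adjoint (inn A x y)) k
      simp only [ContinuousLinearMap.comp_apply] at h2
      rw [← h2, ContinuousLinearMap.adjoint_inner_right]
    have := DFunLike.congr_fun this v
    simp only [ContinuousLinearMap.comp_apply, innerSL_apply_apply] at this
    rw [← inner_conj_symm, this, inner_conj_symm]
  rw [← clm_ext h1, ContinuousLinearMap.adjoint_inner_right]

lemma PreservesInn.assoc_tmul' {m : E →ₗ[ℂ] F →ₗ[ℂ] G} (hm : PreservesInn A m) (x : E)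
    (z : Tensor F σ) :
    hm.assoc σ (tmul (leftRep F σ) x z) = hm.creation σ x z := by
  simp [PreservesInn.assoc]

lemma PreservesInn.adjoint_assoc_comp {m : E →ₗ[ℂ] F →ₗ[ℂ] G} (hm : PreservesInn A m) :
    ContinuousLinearMap.adjoint (hm.assoc σ) ∘L hm.assoc σ = .id ℂ _ := by
  apply clm_ext; intro x z
  refine ext_inner_left ℂ fun v => ?_
  simp only [ContinuousLinearMap.comp_apply, ContinuousLinearMap.adjoint_inner_right,
    ContinuousLinearMap.id_apply]
  have : innerSL ℂ (hm.assoc σ (tmul _ x z)) ∘L hm.assoc σ = innerSL ℂ (tmul _ x z) := by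
    apply clm_ext; intro y w
    simp only [ContinuousLinearMap.comp_apply, innerSL_apply_apply, hm.assoc_tmul',
      hm.inner_creation, inner_tmul]
  have := DFunLike.congr_fun this v
  simp only [ContinuousLinearMap.comp_apply, innerSL_apply_apply] at this
  rw [← inner_conj_symm, this, inner_conj_symm]

/-- A positive operator that commutes with a representation has a positive square root that
commutes with it. -/
lemma exists_sqrt_intertwines {D : H →L[ℂ] H} (hD : D.IsPositive) (hi : Intertwines σ σ D) :
    ∃ C : H →L[ℂ] H, Intertwines σ σ C ∧ ContinuousLinearMap.adjoint C ∘L C = D := by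
  have h0 : 0 ≤ D := (ContinuousLinearMap.nonneg_iff_isPositive D).mpr hD
  refine ⟨CFC.sqrt D, fun a => ?_, ?_⟩
  · have h1 : Commute D (σ a) := hi a
    -- The functional calculus of `D` commutes with everything that commutes with `D`.
    have : Commute (CFC.sqrt D) (σ a) := by
      rw [CFC.sqrt_eq_cfc]
      exact Commute.cfc_nnreal h1 _
    exact this
  · have h2 : IsSelfAdjoint (CFC.sqrt D) := .of_nonneg (CFC.sqrt_nonneg D)
    rw [← ContinuousLinearMap.star_eq_adjoint, h2.star_eq]
    exact CFC.sqrt_mul_sqrt_self D h0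

/-- `I ⊗ S` exists only for intertwiners, so a square root in the commutant is needed: from `D = C⋆
C` follows `I ⊗ D = (I ⊗ C)⋆ (I ⊗ C)`. -/
lemma ampl_isPositive {D : H →L[ℂ] H} (hD : D.IsPositive) (hi : Intertwines σ σ D) :
    (ampl E D hi).IsPositive := by
  obtain ⟨C, hC, rfl⟩ := exists_sqrt_intertwines hD hi
  rw [← ampl_comp _ hC.adjoint _ hC, ← adjoint_ampl]
  exact ContinuousLinearMap.isPositive_adjoint_comp_self _

variable (σ) in
/-- The representation of the matrix algebra over `A` on `Hⁿ`. -/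
noncomputable def matRep (n : ℕ) : CStarMatrix (Fin n) (Fin n) A →⋆ₙₐ[ℂ]
    (PiLp 2 (fun _ : Fin n => H) →L[ℂ] PiLp 2 (fun _ : Fin n => H)) where
  toFun s := (PiLp.continuousLinearEquiv 2 ℂ (fun _ : Fin n => H)).symm.toContinuousLinearMap ∘L
    ContinuousLinearMap.pi fun i => ∑ j, σ (s i j) ∘L PiLp.proj 2 (fun _ : Fin n => H) j
  map_smul' c s := by ext h i; simp [Finset.smul_sum]
  map_zero' := by ext h i; simp
  map_add' s t := by ext h i; simp [Finset.sum_add_distrib]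
  map_mul' s t := by
    ext h i
    simp [CStarMatrix.mul_apply]
    exact Finset.sum_comm
  map_star' s := by
    rw [ContinuousLinearMap.star_eq_adjoint, ContinuousLinearMap.eq_adjoint_iff]
    intro h k
    simp only [PiLp.inner_apply, CStarMatrix.star_apply]
    simp [sum_inner, inner_sum]
    simp only [inner_rep_left, star_star]
    exact Finset.sum_comm

/-- The double sum is the quadratic form of `matRep σ n s` on `Hⁿ`, and a `⋆`-homomorphism of
`C⋆`-algebras is contractive. -/
lemma re_sum_inner_le {n : ℕ} (s : CStarMatrix (Fin n) (Fin n) A) (h : Fin n → H) :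
    RCLike.re (∑ i, ∑ j, inner ℂ (h i) (σ (s i j) (h j))) ≤ ‖s‖ * ∑ j, ‖h j‖ ^ 2 := by
  have h1 : ∑ i, ∑ j, inner ℂ (h i) (σ (s i j) (h j)) =
      inner ℂ (WithLp.toLp 2 h) (matRep σ n s (WithLp.toLp 2 h)) := by
    simp [PiLp.inner_apply, matRep, inner_sum]
  rw [h1, ← PiLp.norm_sq_eq_of_L2 _ (WithLp.toLp 2 h)]
  refine (RCLike.re_le_norm _).trans ((norm_inner_le_norm _ _).trans ?_)
  refine (mul_le_mul_of_nonneg_left (norm_rep_apply_le _ _) (norm_nonneg _)).trans (le_of_eq ?_)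
  ring

/-- A linear map `T : E → B(H)` with `T(x)⋆ T(y) = σ(⟨x, y⟩)` is completely contractive. -/
lemma completelyContractive_of_inner {T : E →ₗ[ℂ] (H →L[ℂ] H)}
    (hT : ∀ x y h k, inner ℂ (T x h) (T y k) = inner ℂ h (σ (inn A x y) k)) :
    CompletelyContractive A T := by
  intro n x h
  rw [matNorm, Real.sq_sqrt (norm_nonneg _)]
  -- The left side equals the quadratic form of the `A`-valued matrix `x⋆ x`, whose norm is the
  -- square of `matNorm`.
  refine le_trans (le_of_eq ?_) (re_sum_inner_le (σ := σ) _ h)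
  simp only [← inner_self_eq_norm_sq (𝕜 := ℂ), ← map_sum]
  congr 1
  simp only [sum_inner, inner_sum, hT, CStarMatrix.ofMatrix_apply, Matrix.of_apply, map_sum,
    sum_apply]
  rw [Finset.sum_comm]
  conv_rhs => rw [Finset.sum_comm]
  exact Finset.sum_congr rfl fun i _ => Finset.sum_comm

end TensorLemmas

end CStarCorrespondence

/-! ### Left multiplication operators and the identification `X n ⊗ (X m ⊗ H) → X (n + m) ⊗ H`. -/

namespace ProductSystem

section Multiplication

variable {A : Type*} [NonUnitalCStarAlgebra A] [PartialOrder A] [StarOrderedRing A]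
variable {k : ℕ} {X : (Fin k → ℕ) → Type*} [∀ n, NormedAddCommGroup (X n)]
  [∀ n, NormedSpace ℂ (X n)] [∀ n, CStarCorrespondence A (X n)] [ProductSystem A X]
variable {H : Type*} [NormedAddCommGroup H] [InnerProductSpace ℂ H] [CompleteSpace H]
variable {σ : A →⋆ₙₐ[ℂ] (H →L[ℂ] H)}

lemma eIdx_ne_zero (i : Fin k) : eIdx i ≠ 0 := fun h => by
  have := congrFun h i
  simp [eIdx] at this

/-- Bounded operators on `X p ⊗ H` that agree on the tensors `(x y) ⊗ h` are equal. -/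
lemma clm_ext_mul {n m p : Fin k → ℕ} (h : n + m = p) (hn : n ≠ 0 ∨ m = 0) {N : Type*}
    [NormedAddCommGroup N] [NormedSpace ℂ N] {f g : Tensor (X p) σ →L[ℂ] N}
    (hfg : ∀ (x : X n) (y : X m) (v : H),
      f (tmul σ (mul A h x y) v) = g (tmul σ (mul A h x y) v)) : f = g := by
  -- For `m = 0` the products are `x a`, which span a dense subspace in every degree by `dense_op`.
  -- The excluded case `n = 0`, `m ≠ 0` would need density of `φ(A) X m`.
  by_cases hm : m = 0
  · subst hm
    obtain rfl : n = p := by rw [← h, add_zero]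
    refine clm_ext_of_dense (dense_op (A := A)) ?_
    rintro _ ⟨x, a, rfl⟩ v
    rw [← mul_unit]
    exact hfg _ _ _
  · refine clm_ext_of_dense (dense_mul (A := A) h (hn.resolve_right hm) hm) ?_
    rintro _ ⟨x, y, rfl⟩ v
    exact hfg _ _ _

variable (σ) in
/-- The operator `z ↦ x z` from `X m ⊗ H` to `X (n + m) ⊗ H`, for `x ∈ X n`. -/
noncomputable def lmul {n m p : Fin k → ℕ} (h : n + m = p) (x : X n) :
    Tensor (X m) σ →L[ℂ] Tensor (X p) σ :=
  (preservesInn_mul A h).creation σ x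

@[simp] lemma lmul_tmul {n m p : Fin k → ℕ} (h : n + m = p) (x : X n) (y : X m) (v : H) :
    lmul σ h x (tmul σ y v) = tmul σ (mul A h x y) v :=
  (preservesInn_mul A h).creation_tmul x y v

lemma ident_tmul {n m p : Fin k → ℕ} (h : n + m = p) (x : X n) (z : Tensor (X m) σ) :
    ident h σ (tmul (leftRep (X m) σ) x z) = lmul σ h x z :=
  (preservesInn_mul A h).assoc_tmul' x z

lemma inner_lmul {n m p : Fin k → ℕ} (h : n + m = p) (x y : X n) (z w : Tensor (X m) σ) :
    inner ℂ (lmul σ h x z) (lmul σ h y w) = inner ℂ z (leftRep (X m) σ (inn A x y) w) :=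
  (preservesInn_mul A h).inner_creation x y z w

lemma adjoint_ident_comp {n m p : Fin k → ℕ} (h : n + m = p) :
    ContinuousLinearMap.adjoint (ident (X := X) h σ) ∘L ident h σ = .id ℂ _ :=
  (preservesInn_mul A h).adjoint_assoc_comp

lemma adjoint_ident_lmul {n m p : Fin k → ℕ} (h : n + m = p) (x : X n) (z : Tensor (X m) σ) :
    ContinuousLinearMap.adjoint (ident h σ) (lmul σ h x z) = tmul (leftRep (X m) σ) x z := by
  rw [← ident_tmul]
  exact DFunLike.congr_fun (adjoint_ident_comp h) _

/-- Density of products makes the isometry `ident` onto; without it only the opposite composite is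
the identity. -/
lemma ident_comp_adjoint {n m p : Fin k → ℕ} (h : n + m = p) (hn : n ≠ 0 ∨ m = 0) :
    ident h σ ∘L ContinuousLinearMap.adjoint (ident (X := X) h σ) = .id ℂ _ := by
  refine clm_ext_mul h hn fun x y v => ?_
  rw [ContinuousLinearMap.comp_apply, ← lmul_tmul, adjoint_ident_lmul, ident_tmul,
    ContinuousLinearMap.id_apply]

lemma lmul_unit {n : Fin k → ℕ} (a : A) :
    lmul σ (zero_add n) (unit a) = leftRep (X n) σ a := by
  apply clm_ext; intro x v; simp [unit_mul]

lemma lmul_lmul {n m l nm ml p : Fin k → ℕ} (h₁ : n + m = nm) (h₂ : nm + l = p) (h₃ : m + l = ml)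
    (h₄ : n + ml = p) (x : X n) (y : X m) (z : Tensor (X l) σ) :
    lmul σ h₄ x (lmul σ h₃ y z) = lmul σ h₂ (mul A h₁ x y) z := by
  have : lmul σ h₄ x ∘L lmul σ h₃ y = lmul σ h₂ (mul A h₁ x y) := by
    apply clm_ext; intro z v; simp [mul_assoc h₁ h₂ h₃ h₄]
  exact DFunLike.congr_fun this z

lemma lmul_add_left {n m p : Fin k → ℕ} (h : n + m = p) (x y : X n) :
    lmul σ h (x + y) = lmul σ h x + lmul σ h y := by
  apply clm_ext; intro z v; simp [tmul_add_left]

lemma lmul_smul_left {n m p : Fin k → ℕ} (h : n + m = p) (c : ℂ) (x : X n) :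
    lmul σ h (c • x) = c • lmul σ h x := by
  apply clm_ext; intro z v; simp [tmul_smul_left]

/-- The form on `A ⊗ H` is `⟨a ⊗ h, b ⊗ k⟩ = ⟨σ(a) h, σ(b) k⟩`, so `T̃_0` is isometric for any `σ`.
That it is onto requires nondegeneracy. -/
lemma adjoint_tildeZero_comp :
    ContinuousLinearMap.adjoint (tildeZero X σ) ∘L tildeZero X σ = .id ℂ _ := by
  apply clm_ext; intro x z
  refine ext_inner_left ℂ fun v => ?_
  simp only [ContinuousLinearMap.comp_apply, ContinuousLinearMap.adjoint_inner_right,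
    ContinuousLinearMap.id_apply]
  obtain ⟨a, rfl⟩ := (unit (A := A) (X := X)).surjective x
  have : innerSL ℂ (tildeZero X σ (tmul _ (unit a) z)) ∘L tildeZero X σ =
      innerSL ℂ (tmul _ (unit a) z) := by
    apply clm_ext; intro y w
    obtain ⟨b, rfl⟩ := (unit (A := A) (X := X)).surjective y
    simp only [ContinuousLinearMap.comp_apply, innerSL_apply_apply, tildeZero_tmul, inner_tmul,
      inn_unit, inner_rep_left, map_mul, ContinuousLinearMap.mul_def]
  have := DFunLike.congr_fun this v
  simp only [ContinuousLinearMap.comp_apply, innerSL_apply_apply] at this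
  rw [← inner_conj_symm, this, inner_conj_symm]

/-- This is the balancing `(x a) ⊗ v = x ⊗ σ(a) v`. -/
lemma lmul_zero_right {n : Fin k → ℕ} (x : X n) :
    lmul σ (add_zero n) x = tmulRight σ x ∘L tildeZero X σ := by
  apply clm_ext; intro y v
  obtain ⟨a, rfl⟩ := (unit (A := A) (X := X)).surjective y
  simp [mul_unit, tmul_op]

end Multiplication

/-! ### Multiplicativity of the operators `T̃_n`. -/

namespace Rep

section TildeMul

variable {A : Type*} [NonUnitalCStarAlgebra A] [PartialOrder A] [StarOrderedRing A]
variable {k : ℕ} {X : (Fin k → ℕ) → Type*} [∀ n, NormedAddCommGroup (X n)]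
  [∀ n, NormedSpace ℂ (X n)] [∀ n, CStarCorrespondence A (X n)] [ProductSystem A X]
variable {H : Type*} [NormedAddCommGroup H] [InnerProductSpace ℂ H] [CompleteSpace H]
variable (R : Rep A X H)

@[simp] lemma tilde_tmul (i : Fin k) (x : X (eIdx i)) (v : H) :
    R.tilde i (tmul R.σ x v) = R.T i x v :=
  (R.isCCRep i).tilde_tmul x v

lemma tildeN_zero : R.tildeN 0 = tildeZero X R.σ := by
  rw [tildeN, tildeAux]; simp

lemma tildeN_of_ne_zero (n : Fin k → ℕ) (hn : n ≠ 0) :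
    R.tildeN n = R.tilde (firstIdx n hn) ∘L
        ampl (X (eIdx (firstIdx n hn))) (R.tildeN (n - eIdx (firstIdx n hn)))
          (R.tildeN_intertwines _) ∘L
        ContinuousLinearMap.adjoint (ident (eIdx_firstIdx_add n hn) R.σ) := by
  rw [tildeN, tildeAux, dif_neg hn]; rfl

lemma tildeN_zero_tmul (a : A) (v : H) : R.tildeN 0 (tmul R.σ (unit a) v) = R.σ a v := by
  rw [tildeN_zero, tildeZero_tmul]

/-- The recursive definition, evaluated on products. Only the least index can be split off in this
way; other indices need the commutation relations. -/
lemma tildeN_firstIdx_lmul {n m : Fin k → ℕ} {i : Fin k} (hn : n ≠ 0) (hi : firstIdx n hn = i)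
    (h : eIdx i + m = n) (x : X (eIdx i)) (z : Tensor (X m) R.σ) :
    R.tildeN n (lmul R.σ h x z) = R.T i x (R.tildeN m z) := by
  subst hi
  obtain rfl : m = n - eIdx (firstIdx n hn) := eq_tsub_of_add_eq (by rw [add_comm, h])
  rw [tildeN_of_ne_zero _ n hn]
  simp only [ContinuousLinearMap.comp_apply]
  rw [adjoint_ident_lmul, ampl_tmul, tilde_tmul]

/-- The operator `X (e_i + e_j) ⊗ H → H` given by both `T⁽ⁱ⁾ T⁽ʲ⁾` and `T⁽ʲ⁾ T⁽ⁱ⁾`. -/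
noncomputable def tildePair (i j : Fin k) : Tensor (X (eIdx i + eIdx j)) R.σ →L[ℂ] H :=
  R.tilde i ∘L ampl (X (eIdx i)) (R.tilde j) (R.tilde_intertwines j) ∘L
    ContinuousLinearMap.adjoint (ident rfl R.σ)

lemma tildePair_tmul (i j : Fin k) (x : X (eIdx i)) (y : X (eIdx j)) (v : H) :
    R.tildePair i j (tmul R.σ (mul A rfl x y) v) = R.T i x (R.T j y v) := by
  rw [← lmul_tmul, tildePair]
  simp only [ContinuousLinearMap.comp_apply]
  rw [adjoint_ident_lmul, ampl_tmul, tilde_tmul, tilde_tmul]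

lemma tildePair_tmul' (i j : Fin k) (x : X (eIdx i)) (y : X (eIdx j)) (v : H) :
    R.tildePair i j (tmul R.σ (mul A (add_comm _ _) y x) v) = R.T j y (R.T i x v) := by
  have h : R.tildePair i j = R.tilde j ∘L
      ampl (X (eIdx j)) (R.tilde i) (R.tilde_intertwines i) ∘L
        ContinuousLinearMap.adjoint (ident (add_comm (eIdx j) (eIdx i)) R.σ) := by
    -- Composing the commutation relation with `ident⋆` on the right turns `swap` into `ident⋆ ident
    -- ident⋆`, and the last two factors cancel because `ident` is onto in degree `e_i + e_j`.
    have h1 := congrArg (fun S => S ∘L ContinuousLinearMap.adjoint (ident rfl R.σ))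
      (R.commute i j)
    have h2 := ident_comp_adjoint (X := X) (σ := R.σ) (rfl : eIdx i + eIdx j = _)
      (Or.inl (eIdx_ne_zero i))
    simp only [swap, ContinuousLinearMap.comp_assoc, h2, ContinuousLinearMap.comp_id] at h1
    exact h1
  rw [← lmul_tmul, h]
  simp only [ContinuousLinearMap.comp_apply]
  rw [adjoint_ident_lmul, ampl_tmul, tilde_tmul, tilde_tmul]

/-- If `i` is not the least index `j` of `n`, elements of `X m` are split as `y y'` with `y ∈ E_j`,
and `x` is exchanged with `y` inside `X (e_i + e_j)`. The induction is on the total degree of `m`.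
-/
lemma tildeN_eIdx_lmul {n m : Fin k → ℕ} (i : Fin k) (h : eIdx i + m = n) (x : X (eIdx i))
    (z : Tensor (X m) R.σ) :
    R.tildeN n (lmul R.σ h x z) = R.T i x (R.tildeN m z) := by
  induction hN : ∑ l, m l using Nat.strong_induction_on generalizing n m i with
  | _ N ih =>
  have hn : n ≠ 0 := fun h0 => eIdx_ne_zero i (by
    rw [h0] at h; exact (add_eq_zero.mp h).1)
  by_cases hi : firstIdx n hn = i
  · exact R.tildeN_firstIdx_lmul hn hi h x z
  set j := firstIdx n hn with hj
  have hmj : m j ≠ 0 := by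
    have h1 := firstIdx_spec n hn
    rw [← hj, ← h] at h1
    simpa [eIdx, Pi.single_apply, hi] using h1
  have hjm : eIdx j + (m - eIdx j) = m := by
    refine add_tsub_cancel_of_le fun l => ?_
    by_cases hl : l = j
    · subst hl; simp only [eIdx, Pi.single_eq_same]; omega
    · simp [eIdx, hl]
  set m' := m - eIdx j with hm'
  have hlt : ∑ l, m' l < N := by
    rw [← hN, ← hjm]
    simp [Finset.sum_add_distrib, eIdx]
  have hw : eIdx i + eIdx j + m' = n := by rw [add_assoc, hjm, h]
  have hi' : eIdx j + (eIdx i + m') = n := by rw [← hw]; abel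
  -- This operator identity is verified on products `y x` with the `E_j` factor in front, where the
  -- recursion for `T̃_n` applies to `y`. It can then be evaluated on products `x y`, which is how
  -- the two factors are exchanged.
  have hop : R.tildeN n ∘L ident hw R.σ = R.tildePair i j ∘L
      ampl (X (eIdx i + eIdx j)) (R.tildeN m') (R.tildeN_intertwines m') := by
    refine clm_ext_mul (add_comm (eIdx j) (eIdx i)) (Or.inl (eIdx_ne_zero j)) fun y x z => ?_
    simp only [ContinuousLinearMap.comp_apply]
    rw [ampl_tmul, tildePair_tmul', ident_tmul, ← lmul_lmul _ hw rfl hi',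
      R.tildeN_firstIdx_lmul hn rfl, ih _ hlt i rfl x z rfl]
  have key : R.tildeN n ∘L lmul R.σ h x = R.T i x ∘L R.tildeN m := by
    refine clm_ext_mul hjm (Or.inl (eIdx_ne_zero j)) fun y y' v => ?_
    simp only [ContinuousLinearMap.comp_apply]
    rw [← lmul_tmul, ih _ hlt j hjm y _ rfl, lmul_lmul rfl hw hjm h, ← ident_tmul]
    have := DFunLike.congr_fun hop (tmul _ (mul A rfl x y) (tmul R.σ y' v))
    simp only [ContinuousLinearMap.comp_apply] at this
    rw [this, ampl_tmul, tildePair_tmul]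
  exact DFunLike.congr_fun key z

lemma tildeN_zero_lmul {m n : Fin k → ℕ} (h : 0 + m = n) (x : X 0) (z : Tensor (X m) R.σ) :
    R.tildeN n (lmul R.σ h x z) = R.tildeN 0 (tmul R.σ x (R.tildeN m z)) := by
  obtain rfl : m = n := by rw [← h, zero_add]
  obtain ⟨a, rfl⟩ := (unit (A := A) (X := X)).surjective x
  rw [tildeN_zero_tmul, lmul_unit]
  exact DFunLike.congr_fun (R.tildeN_intertwines _ a) z

/-- An induction principle for multi-indices. -/
lemma idx_induction {P : (Fin k → ℕ) → Prop} (h0 : P 0)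
    (h1 : ∀ (i : Fin k) (m n : Fin k → ℕ), eIdx i + m = n → P m → P n) (n : Fin k → ℕ) : P n := by
  induction hN : ∑ l, n l generalizing n with
  | zero =>
    obtain rfl : n = 0 := by
      ext l
      exact (Finset.sum_eq_zero_iff.mp hN) l (Finset.mem_univ l)
    exact h0
  | succ N ih =>
    have hn : n ≠ 0 := by rintro rfl; simp at hN
    have h := eIdx_firstIdx_add n hn
    refine h1 _ _ _ h (ih _ ?_)
    have := congrArg (fun f : Fin k → ℕ => ∑ l, f l) h
    simp only [Pi.add_apply, Finset.sum_add_distrib, hN] at this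
    simp [eIdx] at this
    simp only [eIdx, Pi.sub_apply]
    omega

/-- The operators `T̃_n` are multiplicative. -/
lemma tildeN_lmul {n m p : Fin k → ℕ} (h : n + m = p) (x : X n) (z : Tensor (X m) R.σ) :
    R.tildeN p (lmul R.σ h x z) = R.tildeN n (tmul R.σ x (R.tildeN m z)) := by
  induction n using idx_induction generalizing p z with
  | h0 => exact R.tildeN_zero_lmul h x z
  | h1 i n' n hi ih =>
    have hp : eIdx i + (n' + m) = p := by rw [← add_assoc, hi, h]
    have : R.tildeN p ∘L ident h R.σ =
        R.tildeN n ∘L ampl (X n) (R.tildeN m) (R.tildeN_intertwines m) := by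
      refine clm_ext_mul hi (Or.inl (eIdx_ne_zero i)) fun y x z => ?_
      simp only [ContinuousLinearMap.comp_apply]
      rw [ampl_tmul, ident_tmul, ← lmul_lmul hi h rfl hp, tildeN_eIdx_lmul, ih rfl,
        ← lmul_tmul, tildeN_eIdx_lmul]
    have := DFunLike.congr_fun this (tmul _ x z)
    simpa only [ContinuousLinearMap.comp_apply, ident_tmul, ampl_tmul] using this

/-- A characterization of the operators `T̃_n`. -/
lemma tildeN_unique (W : ∀ n : Fin k → ℕ, Tensor (X n) R.σ →L[ℂ] H)
    (h0 : ∀ a v, W 0 (tmul R.σ (unit a) v) = R.σ a v)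
    (h1 : ∀ (i : Fin k) (m n : Fin k → ℕ) (h : eIdx i + m = n) (x : X (eIdx i)) (y : X m) (v : H),
      W n (tmul R.σ (mul A h x y) v) = R.T i x (W m (tmul R.σ y v))) (n : Fin k → ℕ) :
    R.tildeN n = W n := by
  induction n using idx_induction with
  | h0 =>
    apply clm_ext; intro x v
    obtain ⟨a, rfl⟩ := (unit (A := A) (X := X)).surjective x
    rw [tildeN_zero_tmul, h0]
  | h1 i m n hi ih =>
    refine clm_ext_mul hi (Or.inl (eIdx_ne_zero i)) fun x y v => ?_
    rw [h1, ← ih, ← lmul_tmul, tildeN_eIdx_lmul]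

/-- If the `T̃⁽ⁱ⁾` are isometries, then so are the `T̃_n`. -/
lemma adjoint_tildeN_comp (hR : ∀ i, Isometry (R.tilde i)) (n : Fin k → ℕ) :
    ContinuousLinearMap.adjoint (R.tildeN n) ∘L R.tildeN n = .id ℂ _ := by
  induction n using idx_induction with
  | h0 => rw [tildeN_zero, adjoint_tildeZero_comp]
  | h1 i m n hi ih =>
    have h1 : ContinuousLinearMap.adjoint (R.tilde i) ∘L R.tilde i = .id ℂ _ :=
      (ContinuousLinearMap.norm_map_iff_adjoint_comp_self _).mp
        ((AddMonoidHomClass.isometry_iff_norm _).mp (hR i))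
    -- `T̃_n` becomes a composite of isometries: `ident⋆` is unitary since `e_i ≠ 0`, and `I ⊗ T̃_m`
    -- is isometric by induction.
    have h2 : R.tildeN n = R.tilde i ∘L ampl (X (eIdx i)) (R.tildeN m) (R.tildeN_intertwines m) ∘L
        ContinuousLinearMap.adjoint (ident hi R.σ) := by
      refine clm_ext_mul hi (Or.inl (eIdx_ne_zero i)) fun x y v => ?_
      simp only [ContinuousLinearMap.comp_apply]
      rw [← lmul_tmul, tildeN_eIdx_lmul, adjoint_ident_lmul, ampl_tmul, tilde_tmul]
    rw [← (ident_comp_adjoint (X := X) (σ := R.σ) hi (Or.inl (eIdx_ne_zero i))), h2]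
    ext z
    have h3 := fun y => DFunLike.congr_fun h1 y
    have h4 := fun y => DFunLike.congr_fun (adjoint_ampl (E := X (eIdx i)) _
      (R.tildeN_intertwines m)) y
    have h5 := ampl_comp (E := X (eIdx i)) _ (R.tildeN_intertwines m).adjoint _
      (R.tildeN_intertwines m)
    have h6 : ampl (X (eIdx i)) _ ((R.tildeN_intertwines m).adjoint.comp
        (R.tildeN_intertwines m)) = .id ℂ _ := by
      apply clm_ext; intro x v
      rw [ampl_tmul, ih]; rfl
    have h7 := fun y => DFunLike.congr_fun (h5.trans h6) y
    simp only [ContinuousLinearMap.comp_apply, ContinuousLinearMap.id_apply] at h3 h7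
    simp only [ContinuousLinearMap.adjoint_comp, ContinuousLinearMap.comp_apply,
      ContinuousLinearMap.adjoint_adjoint, h3, h4, h7]

end TildeMul

end Rep

end ProductSystem

/-! ### Alternating sums -/

/-- For fixed `t`, the signs of the pairs with `u ∪ w = t` multiply over the elements of `t`: each
lies in `u` only, in `w` only or in both, contributing `-1 - 1 + 1 = -1`. Hence `g t` gets the
coefficient `(-1)^|t|`. -/
lemma Finset.sum_powerset_union {ι : Type*} [DecidableEq ι] (v : Finset ι) (g : Finset ι → ℂ) :
    ∑ u ∈ v.powerset, ∑ w ∈ v.powerset, (-1 : ℂ) ^ u.card * (-1) ^ w.card * g (u ∪ w) =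
      ∑ u ∈ v.powerset, (-1 : ℂ) ^ u.card * g u := by
  induction v using Finset.induction_on generalizing g with
  | empty => simp
  | insert i v hi ih =>
    have hc : ∀ u ∈ v.powerset, (insert i u).card = u.card + 1 := fun u hu =>
      Finset.card_insert_of_notMem fun h => hi (Finset.mem_powerset.mp hu h)
    simp only [Finset.sum_powerset_insert hi]
    have h1 : ∑ u ∈ v.powerset, (-1 : ℂ) ^ (insert i u).card * g (insert i u) =
        - ∑ u ∈ v.powerset, (-1 : ℂ) ^ u.card * g (insert i u) := by
      rw [← Finset.sum_neg_distrib]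
      exact Finset.sum_congr rfl fun u hu => by rw [hc u hu]; ring
    rw [h1, ← ih, ← ih fun u => g (insert i u), ← sub_eq_add_neg, ← Finset.sum_sub_distrib,
      ← Finset.sum_add_distrib]
    refine Finset.sum_congr rfl fun u hu => ?_
    rw [← Finset.sum_sub_distrib, ← Finset.sum_add_distrib, ← Finset.sum_add_distrib,
      ← Finset.sum_add_distrib]
    refine Finset.sum_congr rfl fun w hw => ?_
    rw [hc u hu, hc w hw, Finset.insert_union, Finset.union_insert, Finset.insert_union,
      Finset.union_insert, Finset.insert_idem]
    ring

namespace ProductSystem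

/-- The support of a multi-index. -/
def supp {k : ℕ} (p : Fin k → ℕ) : Finset (Fin k) := Finset.univ.filter fun i => p i ≠ 0

lemma mem_supp {k : ℕ} {p : Fin k → ℕ} {i : Fin k} : i ∈ supp p ↔ p i ≠ 0 := by simp [supp]

/-- Möbius inversion for the product order: the inner sum is the mixed backward difference of `f` at
`p` in the directions where `p` is nonzero, and summing it over the box telescopes. -/
lemma sum_Iic_alternating {k : ℕ} (f : (Fin k → ℕ) → ℂ) (N : Fin k → ℕ) :
    ∑ p ∈ Finset.Iic N, ∑ u ∈ (supp p).powerset, (-1 : ℂ) ^ u.card * f (p - eSet u) = f N := by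
  have h1 : ∑ p ∈ Finset.Iic N, ∑ u ∈ (supp p).powerset, (-1 : ℂ) ^ u.card * f (p - eSet u) =
      ∑ q ∈ Finset.Iic N, ∑ u ∈ (supp (N - q)).powerset, (-1 : ℂ) ^ u.card * f q := by
    rw [Finset.sum_sigma', Finset.sum_sigma']
    -- Substitute `q = p - e(u)`. The condition `u ⊆ supp p` means that the subtraction is not
    -- truncated, and it becomes `u ⊆ supp (N - q)`; the coefficient of `f q` is then an alternating
    -- sum over a powerset, zero unless `q = N`.
    refine Finset.sum_nbij' (fun x => ⟨x.1 - eSet x.2, x.2⟩) (fun x => ⟨x.1 + eSet x.2, x.2⟩)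
      ?_ ?_ ?_ ?_ ?_
    · rintro ⟨p, u⟩ h
      simp only [Finset.mem_sigma, Finset.mem_Iic, Finset.mem_powerset] at h ⊢
      refine ⟨fun i => le_trans (Nat.sub_le _ _) (h.1 i), fun i hi => ?_⟩
      have h2 := mem_supp.mp (h.2 hi)
      have h3 : p i ≤ N i := h.1 i
      rw [mem_supp]
      simp only [Pi.sub_apply, eSet, if_pos hi]
      omega
    · rintro ⟨q, u⟩ h
      simp only [Finset.mem_sigma, Finset.mem_Iic, Finset.mem_powerset] at h ⊢
      refine ⟨fun i => ?_, fun i hi => ?_⟩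
      · have h3 : q i ≤ N i := h.1 i
        by_cases hi : i ∈ u
        · have h2 := mem_supp.mp (h.2 hi)
          simp only [Pi.sub_apply, Pi.add_apply, eSet, if_pos hi] at h2 ⊢
          omega
        · simpa [eSet, hi] using h3
      · rw [mem_supp]
        simp [eSet, hi]
    · rintro ⟨p, u⟩ h
      simp only [Finset.mem_sigma, Finset.mem_Iic, Finset.mem_powerset] at h
      have : p - eSet u + eSet u = p := by
        ext i
        by_cases hi : i ∈ u
        · have h2 := mem_supp.mp (h.2 hi)
          simp only [Pi.add_apply, Pi.sub_apply, eSet, hi, if_true]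
          omega
        · simp [eSet, hi]
      simp [this]
    · rintro ⟨q, u⟩ _
      simp
    · rintro ⟨p, u⟩ _
      rfl
  rw [h1, Finset.sum_eq_single N]
  · simp [supp]
  · intro q hq hqN
    rw [← Finset.sum_mul]
    have hne : (supp (N - q)).Nonempty := by
      obtain ⟨i, hi⟩ := Function.ne_iff.mp hqN
      have h3 : q i ≤ N i := Finset.mem_Iic.mp hq i
      refine ⟨i, mem_supp.mpr ?_⟩
      rw [Pi.sub_apply]
      omega
    have h2 := Finset.sum_powerset_neg_one_pow_card_of_nonempty hne
    have h3 : ∑ u ∈ (supp (N - q)).powerset, (-1 : ℂ) ^ u.card = 0 := by exact_mod_cast h2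
    rw [h3, zero_mul]
  · intro h; simp at h

/-! ### The operators `I ⊗ T̃_q` and positivity of the defect operators in all degrees. -/

namespace Rep

section Lower

variable {A : Type*} [NonUnitalCStarAlgebra A] [PartialOrder A] [StarOrderedRing A]
variable {k : ℕ} {X : (Fin k → ℕ) → Type*} [∀ n, NormedAddCommGroup (X n)]
  [∀ n, NormedSpace ℂ (X n)] [∀ n, CStarCorrespondence A (X n)] [ProductSystem A X]
variable {H : Type*} [NormedAddCommGroup H] [InnerProductSpace ℂ H] [CompleteSpace H]
variable (R : Rep A X H)

variable {R} in
-- The common kernel of `σ(A)` is the orthogonal complement of `σ(A) H`. This replaces density of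
-- products when the left factor has degree `0`.
lemma Nondegenerate.eq_zero (hR : R.Nondegenerate) {y : H} (hy : ∀ a, R.σ a y = 0) : y = 0 := by
  have hd : Dense (Submodule.span ℂ {y : H | ∃ a h, R.σ a h = y} : Set H) :=
    Submodule.dense_iff_topologicalClosure_eq_top.mpr hR
  have : innerSL ℂ y = 0 := by
    refine ContinuousLinearMap.ext_on hd ?_
    rintro _ ⟨a, h, rfl⟩
    rw [innerSL_apply_apply, ← star_star a, ← inner_rep_left, hy]
    simp
  rw [← inner_self_eq_zero (𝕜 := ℂ), ← innerSL_apply_apply, this]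
  rfl

variable {R} in
-- After applying `σ(a)`, which commutes with `T̃_0 T̃_0⋆`, the vector `σ(a) v = T̃_0 (a ⊗ v)` lies
-- in the range of the isometry `T̃_0`, where `T̃_0 T̃_0⋆` is the identity.
lemma Nondegenerate.tildeZero_comp_adjoint (hR : R.Nondegenerate) :
    tildeZero X R.σ ∘L ContinuousLinearMap.adjoint (tildeZero X R.σ) = .id ℂ _ := by
  ext v
  rw [← sub_eq_zero]
  refine hR.eq_zero fun a => ?_
  have h1 := DFunLike.congr_fun ((tildeZero_intertwines (X := X) R.σ).comp
    (tildeZero_intertwines R.σ).adjoint a) v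
  have h2 := DFunLike.congr_fun (adjoint_tildeZero_comp (X := X) (σ := R.σ))
    (tmul R.σ (unit a) v)
  simp only [ContinuousLinearMap.comp_apply, tildeZero_tmul, ContinuousLinearMap.id_apply] at h1 h2
  rw [map_sub, ContinuousLinearMap.comp_apply, ← h1, h2, tildeZero_tmul,
    ContinuousLinearMap.id_apply, sub_self]

/-- The operator `I_p ⊗ T̃_q` from `X r ⊗ H`, identified with `X p ⊗ (X q ⊗ H)`, to `X p ⊗ H`. -/
noncomputable def lower {p q r : Fin k → ℕ} (h : p + q = r) :
    Tensor (X r) R.σ →L[ℂ] Tensor (X p) R.σ :=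
  ampl (X p) (R.tildeN q) (R.tildeN_intertwines q) ∘L ContinuousLinearMap.adjoint (ident h R.σ)

lemma lower_lmul {p q r : Fin k → ℕ} (h : p + q = r) (x : X p) (z : Tensor (X q) R.σ) :
    R.lower h (lmul R.σ h x z) = tmul R.σ x (R.tildeN q z) := by
  rw [lower, ContinuousLinearMap.comp_apply, adjoint_ident_lmul, ampl_tmul]

lemma adjoint_lower_tmul {p q r : Fin k → ℕ} (h : p + q = r) (x : X p) (v : H) :
    ContinuousLinearMap.adjoint (R.lower h) (tmul R.σ x v) =
      lmul R.σ h x (ContinuousLinearMap.adjoint (R.tildeN q) v) := by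
  rw [lower, ContinuousLinearMap.adjoint_comp, ContinuousLinearMap.adjoint_adjoint,
    ContinuousLinearMap.comp_apply, adjoint_ampl, ampl_tmul, ident_tmul]

lemma lower_intertwines {p q r : Fin k → ℕ} (h : p + q = r) :
    Intertwines (leftRep (X r) R.σ) (leftRep (X p) R.σ) (R.lower h) :=
  (ampl_intertwines _ _).comp (ident_intertwines _ _).adjoint

lemma amplSq_eq {p q r : Fin k → ℕ} (h : p + q = r) :
    R.amplSq h = ContinuousLinearMap.adjoint (R.lower h) ∘L R.lower h := by
  rw [amplSq, lower, ContinuousLinearMap.adjoint_comp, ContinuousLinearMap.adjoint_adjoint,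
    adjoint_ampl, ← ampl_comp]
  rfl

variable {R}

/-- For `p ≠ 0` this is multiplicativity on the dense span of products. For `p = 0` one applies
`σ(a)`, which replaces `z` by the product `a z`, and nondegeneracy removes `σ(a)` again. -/
lemma tildeN_lower (hR : R.Nondegenerate) {p q r : Fin k → ℕ} (h : p + q = r) :
    R.tildeN p ∘L R.lower h = R.tildeN r := by
  by_cases hp : p = 0
  · subst hp
    obtain rfl : q = r := by rw [← h, zero_add]
    ext z
    rw [← sub_eq_zero]
    refine hR.eq_zero fun a => ?_
    have h1 := DFunLike.congr_fun (((R.tildeN_intertwines 0).comp (R.lower_intertwines h)) a) z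
    have h2 := DFunLike.congr_fun (R.tildeN_intertwines q a) z
    simp only [ContinuousLinearMap.comp_apply] at h1 h2
    rw [map_sub, ContinuousLinearMap.comp_apply, ← h1, ← h2, ← lmul_unit, lower_lmul,
      tildeN_lmul, sub_self]
  · refine clm_ext_mul h (Or.inl hp) fun x y v => ?_
    rw [ContinuousLinearMap.comp_apply, ← lmul_tmul, lower_lmul, tildeN_lmul]

lemma lower_zero_left (hR : R.Nondegenerate) {q r : Fin k → ℕ} (h : 0 + q = r) :
    R.lower h = ContinuousLinearMap.adjoint (tildeZero X R.σ) ∘L R.tildeN r := by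
  rw [← tildeN_lower hR h, ← ContinuousLinearMap.comp_assoc, tildeN_zero, adjoint_tildeZero_comp,
    ContinuousLinearMap.id_comp]

lemma lower_zero_right {p : Fin k → ℕ} : R.lower (add_zero p) = .id ℂ (Tensor (X p) R.σ) := by
  refine clm_ext_mul (add_zero p) (Or.inr rfl) fun x y v => ?_
  obtain ⟨a, rfl⟩ := (unit (A := A) (X := X)).surjective y
  rw [← lmul_tmul, lower_lmul, lmul_tmul, mul_unit, tmul_op, tildeN_zero_tmul,
    ContinuousLinearMap.id_apply]

lemma lower_lmul_lmul (hR : R.Nondegenerate) {j q s r q' t : Fin k → ℕ} (h₁ : j + q = s)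
    (h₂ : s + r = t) (h₃ : q + r = q') (h₄ : j + q' = t) (x : X j) (z : Tensor (X q') R.σ) :
    R.lower h₂ (lmul R.σ h₄ x z) = lmul R.σ h₁ x (R.lower h₃ z) := by
  -- Products of `X 0` and `X r` need not be dense in `X r`; for `q = 0` the explicit form `T̃_0⋆
  -- T̃_r` is used, together with `T̃_0 T̃_0⋆ = I`.
  by_cases hq : q = 0
  · subst hq
    obtain rfl : r = q' := by rw [← h₃, zero_add]
    obtain rfl : j = s := by rw [← h₁, add_zero]
    rw [lower_lmul, lmul_zero_right, lower_zero_left hR]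
    have := DFunLike.congr_fun hR.tildeZero_comp_adjoint (R.tildeN r z)
    simp only [ContinuousLinearMap.comp_apply, ContinuousLinearMap.id_apply] at this ⊢
    rw [this, tmulRight_apply]
  · have : R.lower h₂ ∘L lmul R.σ h₄ x = lmul R.σ h₁ x ∘L R.lower h₃ := by
      refine clm_ext_mul h₃ (Or.inl hq) fun y w v => ?_
      simp only [ContinuousLinearMap.comp_apply]
      rw [← lmul_tmul, lmul_lmul h₁ h₂ h₃ h₄, lower_lmul, lower_lmul, lmul_tmul]
    exact DFunLike.congr_fun this z

/-- The adjoint of `lower` has an explicit formula on every elementary tensor, so neither a case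
distinction nor nondegeneracy is needed. -/
lemma adjoint_lower_lmul {j q s r q' t : Fin k → ℕ} (h₁ : j + q = s)
    (h₂ : s + r = t) (h₃ : q + r = q') (h₄ : j + q' = t) (x : X j) (z : Tensor (X q) R.σ) :
    ContinuousLinearMap.adjoint (R.lower h₂) (lmul R.σ h₁ x z) =
      lmul R.σ h₄ x (ContinuousLinearMap.adjoint (R.lower h₃) z) := by
  have : ContinuousLinearMap.adjoint (R.lower h₂) ∘L lmul R.σ h₁ x =
      lmul R.σ h₄ x ∘L ContinuousLinearMap.adjoint (R.lower h₃) := by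
    apply clm_ext; intro y v
    simp only [ContinuousLinearMap.comp_apply]
    rw [lmul_tmul, adjoint_lower_tmul, adjoint_lower_tmul, lmul_lmul h₁ h₂ h₃ h₄]
  exact DFunLike.congr_fun this z

/-- `I_p ⊗ -` is functorial, so this reduces to `T̃_q (I_q ⊗ T̃_r) = T̃_{q + r}`, which is
`tildeN_lower`. -/
lemma lower_lower (hR : R.Nondegenerate) {p q s r q' t : Fin k → ℕ} (h₁ : p + q = s)
    (h₂ : s + r = t) (h₃ : q + r = q') (h₄ : p + q' = t) :
    R.lower h₁ ∘L R.lower h₂ = R.lower h₄ := by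
  by_cases hp : p = 0
  · subst hp
    rw [lower_zero_left hR, lower_zero_left hR, ContinuousLinearMap.comp_assoc,
      tildeN_lower hR]
  · refine clm_ext_mul h₄ (Or.inl hp) fun x y v => ?_
    rw [ContinuousLinearMap.comp_apply, ← lmul_tmul, lower_lmul_lmul hR h₁ h₂ h₃ h₄, lower_lmul,
      lower_lmul]
    congr 1
    exact DFunLike.congr_fun (tildeN_lower hR h₃) _

variable (R)

open Classical in
/-- The operator `I_p ⊗ T̃_{r - p}` from `X r ⊗ H` to `X p ⊗ H`, for `p ≤ r`, extended by zero. -/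
noncomputable def low (p r : Fin k → ℕ) : Tensor (X r) R.σ →L[ℂ] Tensor (X p) R.σ :=
  if h : p ≤ r then R.lower (add_tsub_cancel_of_le h) else 0

lemma low_eq {p q r : Fin k → ℕ} (h : p + q = r) : R.low p r = R.lower h := by
  have hp : p ≤ r := by rw [← h]; exact le_self_add
  obtain rfl : q = r - p := eq_tsub_of_add_eq (by rw [add_comm, h])
  rw [low, dif_pos hp]

lemma low_of_not_le {p r : Fin k → ℕ} (h : ¬ p ≤ r) : R.low p r = 0 := by
  rw [low, dif_neg h]

lemma low_self (p : Fin k → ℕ) : R.low p p = .id ℂ _ := by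
  rw [R.low_eq (add_zero p), lower_zero_right]

lemma low_intertwines (p r : Fin k → ℕ) :
    Intertwines (leftRep (X r) R.σ) (leftRep (X p) R.σ) (R.low p r) := by
  rw [low]
  split_ifs with h
  · exact R.lower_intertwines _
  · intro a; simp

variable {R}

lemma low_zero (hR : R.Nondegenerate) (r : Fin k → ℕ) :
    R.low 0 r = ContinuousLinearMap.adjoint (tildeZero X R.σ) ∘L R.tildeN r := by
  rw [R.low_eq (zero_add r), lower_zero_left hR]

lemma low_low (hR : R.Nondegenerate) {p q r : Fin k → ℕ} (hpq : p ≤ q) (hqr : q ≤ r) :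
    R.low p q ∘L R.low q r = R.low p r := by
  obtain ⟨a, rfl⟩ := exists_add_of_le hpq
  obtain ⟨b, rfl⟩ := exists_add_of_le hqr
  rw [R.low_eq rfl, R.low_eq rfl, R.low_eq (add_assoc p a b).symm, lower_lower hR rfl rfl rfl]

lemma low_lmul (hR : R.Nondegenerate) {j p q r s : Fin k → ℕ} (h : p ≤ q) (hp : j + p = r)
    (hq : j + q = s) (x : X j) (z : Tensor (X q) R.σ) :
    R.low r s (lmul R.σ hq x z) = lmul R.σ hp x (R.low p q z) := by
  obtain ⟨a, rfl⟩ := exists_add_of_le h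
  have h₂ : r + a = s := by rw [← hp, ← hq, add_assoc]
  rw [R.low_eq h₂, R.low_eq rfl, lower_lmul_lmul hR hp h₂ rfl hq]

lemma adjoint_low_lmul {j p q r s : Fin k → ℕ} (h : p ≤ q) (hp : j + p = r)
    (hq : j + q = s) (x : X j) (z : Tensor (X p) R.σ) :
    ContinuousLinearMap.adjoint (R.low r s) (lmul R.σ hp x z) =
      lmul R.σ hq x (ContinuousLinearMap.adjoint (R.low p q) z) := by
  obtain ⟨a, rfl⟩ := exists_add_of_le h
  have h₂ : r + a = s := by rw [← hp, ← hq, add_assoc]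
  rw [R.low_eq h₂, R.low_eq rfl, adjoint_lower_lmul hp h₂ rfl hq]

variable (R)

/-- The operator `∑_{u ⊆ s} (-1)^{|u|} (I_{p - e(u)} ⊗ T̃_{e(u)}⋆ T̃_{e(u)})` on `X p ⊗ H`. -/
noncomputable def defectAt (p : Fin k → ℕ) (s : Finset (Fin k)) :
    Tensor (X p) R.σ →L[ℂ] Tensor (X p) R.σ :=
  ∑ u ∈ s.powerset, (-1 : ℂ) ^ u.card •
    (ContinuousLinearMap.adjoint (R.low (p - eSet u) p) ∘L R.low (p - eSet u) p)

lemma defect_eq (v : Finset (Fin k)) : R.defect v = R.defectAt (eSet v) v := by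
  rw [defect, defectAt, ← Finset.sum_coe_sort v.powerset]
  refine Finset.sum_congr rfl fun u _ => ?_
  rw [amplSq_eq, ← R.low_eq]

lemma inner_defectAt (p : Fin k → ℕ) (s : Finset (Fin k)) (z w : Tensor (X p) R.σ) :
    inner ℂ z (R.defectAt p s w) = ∑ u ∈ s.powerset, (-1 : ℂ) ^ u.card *
      inner ℂ (R.low (p - eSet u) p z) (R.low (p - eSet u) p w) := by
  simp only [defectAt, sum_apply, inner_sum, smul_apply,
    inner_smul_right, ContinuousLinearMap.comp_apply, ContinuousLinearMap.adjoint_inner_right]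

lemma defectAt_intertwines (p : Fin k → ℕ) (s : Finset (Fin k)) :
    Intertwines (leftRep (X p) R.σ) (leftRep (X p) R.σ) (R.defectAt p s) := fun a => by
  ext z
  simp only [defectAt, ContinuousLinearMap.comp_apply, sum_apply, map_sum,
    smul_apply, map_smul]
  refine Finset.sum_congr rfl fun u _ => ?_
  congr 1
  exact DFunLike.congr_fun (((R.low_intertwines _ _).adjoint.comp (R.low_intertwines _ _)) a) z

variable {R}

/-- Since `e(u) ≤ q`, each term acts on the `X q` part alone and leaves `x` in place; the bound also
keeps `(j + q) - e(u) = j + (q - e(u))` free of truncation. -/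
lemma defectAt_lmul (hR : R.Nondegenerate) {j q p : Fin k → ℕ} (h : j + q = p)
    {s : Finset (Fin k)} (hs : eSet s ≤ q) (x : X j) (z : Tensor (X q) R.σ) :
    R.defectAt p s (lmul R.σ h x z) = lmul R.σ h x (R.defectAt q s z) := by
  simp only [defectAt, sum_apply, smul_apply, map_sum, map_smul]
  refine Finset.sum_congr rfl fun u hu => ?_
  have hu' : eSet u ≤ q := (eSet_mono (Finset.mem_powerset.mp hu)).trans hs
  have hj : j + (q - eSet u) = p - eSet u := by rw [← h, add_tsub_assoc_of_le hu']
  simp only [ContinuousLinearMap.comp_apply]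
  rw [low_lmul hR tsub_le_self hj h, adjoint_low_lmul tsub_le_self hj h]

/-- Positivity in the degrees `e(s)` suffices: in degree `j + e(s)` with `j ≠ 0` the operator is
`I_j ⊗ defect s` up to the unitary `ident`. For `j = 0` that map may fail to be onto, but there the
claim is the hypothesis itself. -/
lemma defectAt_isPositive (hR : R.Nondegenerate) (hpos : ∀ v, (R.defect v).IsPositive)
    {j p : Fin k → ℕ} {s : Finset (Fin k)} (h : j + eSet s = p) :
    (R.defectAt p s).IsPositive := by
  by_cases hj : j = 0
  · subst hj
    obtain rfl : eSet s = p := by rw [← h, zero_add]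
    rw [← defect_eq]
    exact hpos s
  · have hD := hpos s
    rw [defect_eq] at hD
    have : R.defectAt p s = ident h R.σ ∘L ampl (X j) (R.defectAt (eSet s) s)
        (R.defectAt_intertwines _ _) ∘L ContinuousLinearMap.adjoint (ident h R.σ) := by
      refine clm_ext_mul h (Or.inl hj) fun x y v => ?_
      simp only [ContinuousLinearMap.comp_apply]
      rw [← lmul_tmul, defectAt_lmul hR h le_rfl, adjoint_ident_lmul, ampl_tmul, ident_tmul]
    rw [this]
    exact (ampl_isPositive hD _).conj_adjoint _

end Lower

end Rep

end ProductSystem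

/-! ### Necessity: a regular isometric dilation forces the defect operators to be positive. -/

namespace ProductSystem

namespace Rep

section Necessity

variable {A : Type*} [NonUnitalCStarAlgebra A] [PartialOrder A] [StarOrderedRing A]
variable {k : ℕ} {X : (Fin k → ℕ) → Type*} [∀ n, NormedAddCommGroup (X n)]
  [∀ n, NormedSpace ℂ (X n)] [∀ n, CStarCorrespondence A (X n)] [ProductSystem A X]
variable {H : Type*} [NormedAddCommGroup H] [InnerProductSpace ℂ H] [CompleteSpace H]
variable {K : Type*} [NormedAddCommGroup K] [InnerProductSpace ℂ K] [CompleteSpace K]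
variable {σ : A →⋆ₙₐ[ℂ] (H →L[ℂ] H)}
variable {R : Rep A X H} {V : Rep A X K} {ι : H →ₗᵢ[ℂ] K}

/-- Two pairs of bounded operators on `X n ⊗ H` and `X m ⊗ H` have the same inner products of
their values if this holds on the vectors `x z` with `x ∈ X q`, where `q ≠ 0`. -/
lemma inner_ext_lmul {n m q n' m' : Fin k → ℕ} (hn : q + n' = n) (hm : q + m' = m) (hq : q ≠ 0)
    {L L' : Type*} [NormedAddCommGroup L] [InnerProductSpace ℂ L]
    [NormedAddCommGroup L'] [InnerProductSpace ℂ L']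
    (P : Tensor (X n) σ →L[ℂ] L) (Q : Tensor (X m) σ →L[ℂ] L)
    (P' : Tensor (X n) σ →L[ℂ] L') (Q' : Tensor (X m) σ →L[ℂ] L')
    (h : ∀ (x y : X q) (z : Tensor (X n') σ) (w : Tensor (X m') σ),
      inner ℂ (P (lmul σ hn x z)) (Q (lmul σ hm y w)) =
        inner ℂ (P' (lmul σ hn x z)) (Q' (lmul σ hm y w)))
    (z : Tensor (X n) σ) (w : Tensor (X m) σ) :
    inner ℂ (P z) (Q w) = inner ℂ (P' z) (Q' w) := by
  have h1 : ∀ (y : X q) (w : Tensor (X m') σ) (z : Tensor (X n) σ),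
      inner ℂ (P z) (Q (lmul σ hm y w)) = inner ℂ (P' z) (Q' (lmul σ hm y w)) := by
    intro y w z
    have : innerSL ℂ (Q (lmul σ hm y w)) ∘L P = innerSL ℂ (Q' (lmul σ hm y w)) ∘L P' := by
      refine clm_ext_mul hn (Or.inl hq) fun x z v => ?_
      simp only [ContinuousLinearMap.comp_apply, innerSL_apply_apply]
      rw [← inner_conj_symm, ← lmul_tmul, h, inner_conj_symm]
    have := DFunLike.congr_fun this z
    simp only [ContinuousLinearMap.comp_apply, innerSL_apply_apply] at this
    rw [← inner_conj_symm, this, inner_conj_symm]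
  have : innerSL ℂ (P z) ∘L Q = innerSL ℂ (P' z) ∘L Q' := by
    refine clm_ext_mul hm (Or.inl hq) fun y w v => ?_
    simp only [ContinuousLinearMap.comp_apply, innerSL_apply_apply]
    rw [← lmul_tmul, h1]
  exact DFunLike.congr_fun this w

/-- Regularity is indexed by `ℤᵏ`. Pairs with disjoint supports are exactly the pairs `(t₋, t₊)`,
with `t = m - n`. -/
lemma exists_posIdx_negIdx {n m : Fin k → ℕ} (h : n ⊓ m = 0) :
    ∃ t : Fin k → ℤ, negIdx t = n ∧ posIdx t = m := by
  refine ⟨fun i => (m i : ℤ) - n i, ?_, ?_⟩ <;> ext i <;>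
  · have : min (n i) (m i) = 0 := congrFun h i
    simp only [negIdx, posIdx]
    omega

namespace IsRegularIsometricDilation

variable (hV : IsRegularIsometricDilation R V ι)

/-- The operator `Ṽ_n` restricted to `X n ⊗ H`. -/
noncomputable def restr (n : Fin k → ℕ) : Tensor (X n) R.σ →L[ℂ] K :=
  V.tildeN n ∘L ampl (X n) ι.toContinuousLinearMap hV.restrict

lemma inner_restr_of_inf_eq_zero {n m : Fin k → ℕ} (h : n ⊓ m = 0) (z : Tensor (X n) R.σ)
    (w : Tensor (X m) R.σ) :
    inner ℂ (hV.restr n z) (hV.restr m w) = inner ℂ (R.tildeN n z) (R.tildeN m w) := by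
  obtain ⟨t, rfl, rfl⟩ := exists_posIdx_negIdx h
  have h1 := congrArg (inner ℂ z) (DFunLike.congr_fun (hV.regular t) w)
  rw [← adjoint_ampl _ hV.restrict] at h1
  simpa only [opZ, restr, ContinuousLinearMap.comp_apply,
    ContinuousLinearMap.adjoint_inner_right] using h1

lemma restr_lmul {n m p : Fin k → ℕ} (h : n + m = p) (x : X n) (z : Tensor (X m) R.σ) :
    hV.restr p (lmul R.σ h x z) = V.tildeN n (tmul V.σ x (hV.restr m z)) := by
  have : ampl (X p) ι.toContinuousLinearMap hV.restrict ∘L lmul R.σ h x =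
      lmul V.σ h x ∘L ampl (X m) ι.toContinuousLinearMap hV.restrict := by
    apply clm_ext; intro y v
    simp only [ContinuousLinearMap.comp_apply, lmul_tmul, ampl_tmul]
  have := DFunLike.congr_fun this z
  simp only [ContinuousLinearMap.comp_apply] at this
  rw [restr, ContinuousLinearMap.comp_apply, this, tildeN_lmul]
  rfl

lemma rep_restr (n : Fin k → ℕ) (a : A) (z : Tensor (X n) R.σ) :
    V.σ a (hV.restr n z) = hV.restr n (leftRep (X n) R.σ a z) :=
  (DFunLike.congr_fun
    (((V.tildeN_intertwines n).comp (ampl_intertwines (E := X n) _ hV.restrict)) a) z).symm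

/-- Isometry of `Ṽ_q` cancels the common degree `q = n ∧ m`, leaving degrees with disjoint supports,
to which regularity applies. Thus the dilation kernel depends on `R` alone. -/
lemma inner_restr (hR : R.Nondegenerate) (n m : Fin k → ℕ) (z : Tensor (X n) R.σ)
    (w : Tensor (X m) R.σ) :
    inner ℂ (hV.restr n z) (hV.restr m w) =
      inner ℂ (R.low (n ⊓ m) n z) (R.low (n ⊓ m) m w) := by
  obtain ⟨q, hq⟩ : ∃ q, q = n ⊓ m := ⟨_, rfl⟩
  rw [← hq]
  by_cases hq0 : q = 0
  · subst hq0
    rw [inner_restr_of_inf_eq_zero hV hq.symm, low_zero hR, low_zero hR]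
    have := DFunLike.congr_fun hR.tildeZero_comp_adjoint (R.tildeN m w)
    simp only [ContinuousLinearMap.comp_apply, ContinuousLinearMap.id_apply] at this ⊢
    rw [ContinuousLinearMap.adjoint_inner_left, this]
  · obtain ⟨n', rfl⟩ : ∃ n', n = q + n' := exists_add_of_le (hq ▸ inf_le_left)
    obtain ⟨m', rfl⟩ : ∃ m', m = q + m' := exists_add_of_le (hq ▸ inf_le_right)
    have h0 : n' ⊓ m' = 0 := by
      ext i
      have : q i = min (q i + n' i) (q i + m' i) := congrFun hq i
      show min (n' i) (m' i) = 0
      omega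
    refine inner_ext_lmul rfl rfl hq0 _ _ _ _ (fun x y z w => ?_) z w
    -- With `x`, `y` split off, the left side is `⟨Ṽ_{n'} z, ρ(⟨x, y⟩) Ṽ_{m'} w⟩`; covariance moves
    -- `⟨x, y⟩` onto `w`.
    rw [restr_lmul, restr_lmul, R.low_eq rfl, R.low_eq rfl, lower_lmul, lower_lmul, inner_tmul,
      ← ContinuousLinearMap.adjoint_inner_right, ← ContinuousLinearMap.comp_apply,
      V.adjoint_tildeN_comp hV.isometry, ContinuousLinearMap.id_apply, inner_tmul, rep_restr,
      inner_restr_of_inf_eq_zero hV h0]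
    congr 1
    exact DFunLike.congr_fun (R.tildeN_intertwines m' _) w

/-- The defect operator is exhibited as `Z⋆ Z`, where `Z` is the alternating combination of dilated
vectors. -/
lemma defect_isPositive (hV : IsRegularIsometricDilation R V ι) (hR : R.Nondegenerate)
    (v : Finset (Fin k)) : (R.defect v).IsPositive := by
  set Z : Tensor (X (eSet v)) R.σ →L[ℂ] K := ∑ u ∈ v.powerset, (-1 : ℂ) ^ u.card •
    (hV.restr (eSet v - eSet u) ∘L R.low (eSet v - eSet u) (eSet v)) with hZ
  have : R.defect v = ContinuousLinearMap.adjoint Z ∘L Z := by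
    ext z
    refine ext_inner_left ℂ fun y => ?_
    rw [ContinuousLinearMap.comp_apply, ContinuousLinearMap.adjoint_inner_right, defect_eq,
      inner_defectAt, ← Finset.sum_powerset_union]
    simp only [hZ, sum_apply, smul_apply, sum_inner, inner_sum, inner_smul_left, inner_smul_right,
      ContinuousLinearMap.comp_apply, hV.inner_restr hR]
    rw [Finset.sum_comm]
    refine Finset.sum_congr rfl fun w _ => ?_
    rw [Finset.mul_sum]
    refine Finset.sum_congr rfl fun u _ => ?_
    -- The kernel formula reduces the cross term to the meet of the two degrees, which depends on `u
    -- ∪ w` only; this is what `Finset.sum_powerset_union` requires.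
    have h1 : (eSet v - eSet u) ⊓ (eSet v - eSet w) = eSet v - eSet (u ∪ w) := by
      ext i
      show min (eSet v i - eSet u i) (eSet v i - eSet w i) = eSet v i - eSet (u ∪ w) i
      by_cases hu : i ∈ u <;> by_cases hw : i ∈ w <;> simp [eSet, hu, hw]
    have h2 := low_low hR (inf_le_left : (eSet v - eSet u) ⊓ (eSet v - eSet w) ≤ _)
      (tsub_le_self : eSet v - eSet u ≤ eSet v)
    have h3 := low_low hR (inf_le_right : (eSet v - eSet u) ⊓ (eSet v - eSet w) ≤ _)
      (tsub_le_self : eSet v - eSet w ≤ eSet v)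
    rw [← ContinuousLinearMap.comp_apply (R.low _ _), ← ContinuousLinearMap.comp_apply (R.low _ _),
      h2, h3, h1]
    simp
    ring
  rw [this]
  exact ContinuousLinearMap.isPositive_adjoint_comp_self _

end IsRegularIsometricDilation

end Necessity

end Rep

end ProductSystem

/-! ### Operators defined on a family with dense span -/

section FamSum

variable {J : Type*} [DecidableEq J] {G : J → Type*} [∀ j, NormedAddCommGroup (G j)]
  [∀ j, NormedSpace ℂ (G j)]
variable {K : Type*} [NormedAddCommGroup K] [NormedSpace ℂ K]
variable {M : Type*} [NormedAddCommGroup M] [NormedSpace ℂ M] [CompleteSpace M]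

/-- The map `(z j) ↦ ∑ j, F j (z j)` on the algebraic direct sum. -/
noncomputable def famSum (F : ∀ j, G j →L[ℂ] K) : (Π₀ j, G j) →ₗ[ℂ] K :=
  DFinsupp.lsum ℕ fun j => (F j).toLinearMap

lemma famSum_single (F : ∀ j, G j →L[ℂ] K) (j : J) (z : G j) :
    famSum F (DFinsupp.single j z) = F j z := by
  simp [famSum]

lemma denseRange_famSum {F : ∀ j, G j →L[ℂ] K}
    (hF : Dense (Submodule.span ℂ {y | ∃ j z, F j z = y} : Set K)) : DenseRange (famSum F) := by
  refine hF.mono ?_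
  have : Submodule.span ℂ {y | ∃ j z, F j z = y} ≤ LinearMap.range (famSum F) := by
    rw [Submodule.span_le]
    rintro _ ⟨j, z, rfl⟩
    exact ⟨DFinsupp.single j z, famSum_single F j z⟩
  exact this

/-- A bounded operator is determined by its values on a family with dense span, and every
family of values that satisfies a norm bound is attained. -/
lemma exists_clm_of_famSum {F : ∀ j, G j →L[ℂ] K}
    (hF : Dense (Submodule.span ℂ {y | ∃ j z, F j z = y} : Set K)) (F' : ∀ j, G j →L[ℂ] M) (C : ℝ)
    (hC : ∀ z, ‖famSum F' z‖ ≤ C * ‖famSum F z‖) : ∃ T : K →L[ℂ] M, ∀ j z, T (F j z) = F' j z :=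
  ⟨(famSum F').extendOfNorm (famSum F), fun j z => by
    rw [← famSum_single F, LinearMap.extendOfNorm_eq (denseRange_famSum hF) ⟨C, hC⟩,
      famSum_single]⟩

end FamSum

/-! ### From a generating family to a minimal regular isometric dilation. -/

namespace ProductSystem

namespace Rep

/-- A family of operators `Φ n : X n ⊗ H → K` whose ranges span a dense subspace, with
`Φ(n)⋆ Φ(m) = (I ⊗ T̃_{n - n ∧ m})⋆ (I ⊗ T̃_{m - n ∧ m})`. -/
structure GeneratingFamily {A : Type*} [NonUnitalCStarAlgebra A] [PartialOrder A]
    [StarOrderedRing A] {k : ℕ} {X : (Fin k → ℕ) → Type*} [∀ n, NormedAddCommGroup (X n)]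
    [∀ n, NormedSpace ℂ (X n)] [∀ n, CStarCorrespondence A (X n)] [ProductSystem A X]
    {H : Type*} [NormedAddCommGroup H] [InnerProductSpace ℂ H] [CompleteSpace H] (R : Rep A X H)
    (K : Type*) [NormedAddCommGroup K] [InnerProductSpace ℂ K] where
  Φ : ∀ n, Tensor (X n) R.σ →L[ℂ] K
  dense : Dense (Submodule.span ℂ {y | ∃ n z, Φ n z = y} : Set K)
  inner_Φ : ∀ n m z w, inner ℂ (Φ n z) (Φ m w) =
    inner ℂ (R.low (n ⊓ m) n z) (R.low (n ⊓ m) m w)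
  -- This makes `ρ(a)` well defined and bounded; in the `ℓ²` model it holds coordinatewise.
  norm_action_le : ∀ (a : A) (z : Π₀ n, Tensor (X n) R.σ),
    ‖famSum (fun n => Φ n ∘L leftRep (X n) R.σ a) z‖ ≤ ‖a‖ * ‖famSum Φ z‖

namespace GeneratingFamily

variable {A : Type*} [NonUnitalCStarAlgebra A] [PartialOrder A] [StarOrderedRing A]
variable {k : ℕ} {X : (Fin k → ℕ) → Type*} [∀ n, NormedAddCommGroup (X n)]
  [∀ n, NormedSpace ℂ (X n)] [∀ n, CStarCorrespondence A (X n)] [ProductSystem A X]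
variable {H : Type*} [NormedAddCommGroup H] [InnerProductSpace ℂ H] [CompleteSpace H]
variable {K : Type*} [NormedAddCommGroup K] [InnerProductSpace ℂ K]
variable {R : Rep A X H} (F : GeneratingFamily R K)

lemma clm_ext {M : Type*} [NormedAddCommGroup M] [NormedSpace ℂ M] {S T : K →L[ℂ] M}
    (h : ∀ n z, S (F.Φ n z) = T (F.Φ n z)) : S = T := by
  refine ContinuousLinearMap.ext_on F.dense ?_
  rintro _ ⟨n, z, rfl⟩
  exact h n z

lemma vec_ext {u v : K} (h : ∀ n z, inner ℂ (F.Φ n z) u = inner ℂ (F.Φ n z) v) : u = v := by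
  have : innerSL ℂ u = innerSL ℂ v := F.clm_ext fun n z => by
    rw [innerSL_apply_apply, innerSL_apply_apply, ← inner_conj_symm, h, inner_conj_symm]
  refine ext_inner_right ℂ fun w => ?_
  exact DFunLike.congr_fun this w

lemma inner_Φ_action (n m : Fin k → ℕ) (a : A) (z : Tensor (X n) R.σ) (w : Tensor (X m) R.σ) :
    inner ℂ (F.Φ n (leftRep (X n) R.σ a z)) (F.Φ m w) =
      inner ℂ (F.Φ n z) (F.Φ m (leftRep (X m) R.σ (star a) w)) := by
  have h1 := DFunLike.congr_fun (R.low_intertwines (n ⊓ m) n a) z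
  have h2 := DFunLike.congr_fun (R.low_intertwines (n ⊓ m) m (star a)) w
  simp only [ContinuousLinearMap.comp_apply] at h1 h2
  rw [F.inner_Φ, F.inner_Φ, h1, h2, inner_rep_left]

/-- The kernel is invariant under translation: `(p + n) ∧ (p + m) = p + n ∧ m`, so `x` and `y` pass
through `low` and leave only `⟨x, y⟩`. This makes the operators `V(x)` isometric in the module
sense. -/
lemma inner_Φ_lmul (hR : R.Nondegenerate) {p n m pn pm : Fin k → ℕ} (hn : p + n = pn)
    (hm : p + m = pm) (x y : X p) (z : Tensor (X n) R.σ) (w : Tensor (X m) R.σ) :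
    inner ℂ (F.Φ pn (lmul R.σ hn x z)) (F.Φ pm (lmul R.σ hm y w)) =
      inner ℂ (F.Φ n z) (F.Φ m (leftRep (X m) R.σ (inn A x y) w)) := by
  have hq : p + n ⊓ m = pn ⊓ pm := by
    rw [← hn, ← hm]
    ext i
    show p i + min (n i) (m i) = min (p i + n i) (p i + m i)
    omega
  have h2 := DFunLike.congr_fun (R.low_intertwines (n ⊓ m) m (inn A x y)) w
  simp only [ContinuousLinearMap.comp_apply] at h2
  rw [F.inner_Φ, F.inner_Φ, low_lmul hR inf_le_left hq hn, low_lmul hR inf_le_right hq hm,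
    inner_lmul, h2]

lemma eq_top {M : Submodule ℂ K} (hM : IsClosed (M : Set K)) (h : ∀ n z, F.Φ n z ∈ M) :
    M = ⊤ := by
  rw [← hM.submodule_topologicalClosure_eq, ← Submodule.dense_iff_topologicalClosure_eq_top]
  refine F.dense.mono (Submodule.span_le.mpr ?_)
  rintro _ ⟨n, z, rfl⟩
  exact h n z

variable [CompleteSpace K]

lemma exists_action (a : A) :
    ∃ T : K →L[ℂ] K, ∀ n z, T (F.Φ n z) = F.Φ n (leftRep (X n) R.σ a z) :=
  exists_clm_of_famSum F.dense (fun n => F.Φ n ∘L leftRep (X n) R.σ a) ‖a‖ (F.norm_action_le a)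

/-- The operator on `K` induced by the action of `a ∈ A`. -/
noncomputable def actionCLM (a : A) : K →L[ℂ] K := (F.exists_action a).choose

@[simp] lemma actionCLM_Φ (a : A) (n : Fin k → ℕ) (z : Tensor (X n) R.σ) :
    F.actionCLM a (F.Φ n z) = F.Φ n (leftRep (X n) R.σ a z) :=
  (F.exists_action a).choose_spec n z

/-- The representation of `A` on `K` with `ρ(a) Φ(n) = Φ(n) (φ(a) ⊗ I)`. -/
noncomputable def ρ : A →⋆ₙₐ[ℂ] (K →L[ℂ] K) where
  toFun a := F.actionCLM a
  map_smul' c a := F.clm_ext fun n z => by simp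
  map_zero' := F.clm_ext fun n z => by simp
  map_add' a b := F.clm_ext fun n z => by simp
  map_mul' a b := F.clm_ext fun n z => by simp
  map_star' a := F.clm_ext fun n z => F.vec_ext fun m w => by
    rw [actionCLM_Φ, ContinuousLinearMap.star_eq_adjoint,
      ContinuousLinearMap.adjoint_inner_right, actionCLM_Φ, F.inner_Φ_action]

@[simp] lemma ρ_Φ (a : A) (n : Fin k → ℕ) (z : Tensor (X n) R.σ) :
    F.ρ a (F.Φ n z) = F.Φ n (leftRep (X n) R.σ a z) :=
  F.actionCLM_Φ a n z

lemma inner_famSum_lmul (hR : R.Nondegenerate) {p : Fin k → ℕ} (x y : X p)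
    (z w : Π₀ n, Tensor (X n) R.σ) :
    inner ℂ (famSum (fun n => F.Φ (p + n) ∘L lmul R.σ rfl x) z)
      (famSum (fun n => F.Φ (p + n) ∘L lmul R.σ rfl y) w) =
      inner ℂ (famSum F.Φ z) (F.ρ (inn A x y) (famSum F.Φ w)) := by
  induction z using DFinsupp.induction with
  | h0 => simp
  | ha n z f _ _ ih =>
    rw [map_add, map_add, inner_add_left, inner_add_left, ih, famSum_single, famSum_single]
    congr 1
    clear ih
    induction w using DFinsupp.induction with
    | h0 => simp
    | ha m w f _ _ ih =>
      rw [map_add, map_add, map_add, inner_add_right, inner_add_right, ih, famSum_single,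
        famSum_single, ρ_Φ, ContinuousLinearMap.comp_apply, ContinuousLinearMap.comp_apply,
        F.inner_Φ_lmul hR]

variable (hR : R.Nondegenerate)

/-- On finite sums `u` of vectors `Φ(n) z`, the invariance of the kernel gives `‖V(x) u‖² = ⟨u,
ρ(⟨x, x⟩) u⟩ ≤ ‖x‖² ‖u‖²`. -/
lemma exists_act (hR : R.Nondegenerate) {p : Fin k → ℕ} (x : X p) :
    ∃ T : K →L[ℂ] K, ∀ n z, T (F.Φ n z) = F.Φ (p + n) (lmul R.σ rfl x z) := by
  refine exists_clm_of_famSum F.dense (fun n => F.Φ (p + n) ∘L lmul R.σ rfl x) ‖x‖ fun z => ?_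
  rw [← sq_le_sq₀ (by positivity) (by positivity), mul_pow,
    CStarCorrespondence.norm_sq_eq (A := A) x, ← inner_self_eq_norm_sq (𝕜 := ℂ),
    F.inner_famSum_lmul hR]
  refine (RCLike.re_le_norm _).trans ((norm_inner_le_norm _ _).trans ?_)
  refine (mul_le_mul_of_nonneg_left (norm_rep_apply_le _ _) (norm_nonneg _)).trans (le_of_eq ?_)
  ring

/-- The operator `V(x)` on `K` with `V(x) Φ(n) z = Φ(p + n) (x z)`, for `x ∈ X p`. -/
noncomputable def act {p : Fin k → ℕ} (x : X p) : K →L[ℂ] K := (F.exists_act hR x).choose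

lemma act_Φ {p n m : Fin k → ℕ} (h : p + n = m) (x : X p) (z : Tensor (X n) R.σ) :
    F.act hR x (F.Φ n z) = F.Φ m (lmul R.σ h x z) := by
  subst h
  exact (F.exists_act hR x).choose_spec n z

/-- The relation `V(x)⋆ V(y) = ρ(⟨x, y⟩)` yields both complete contractivity and isometry of `Ṽ`. -/
lemma inner_act {p : Fin k → ℕ} (x y : X p) (u v : K) :
    inner ℂ (F.act hR x u) (F.act hR y v) = inner ℂ u (F.ρ (inn A x y) v) := by
  have : ContinuousLinearMap.adjoint (F.act hR x) ∘L F.act hR y = F.ρ (inn A x y) :=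
    F.clm_ext fun n z => F.vec_ext fun m w => by
      rw [ContinuousLinearMap.comp_apply, ContinuousLinearMap.adjoint_inner_right,
        F.act_Φ hR rfl, F.act_Φ hR rfl, F.inner_Φ_lmul hR, ρ_Φ]
  rw [← this, ContinuousLinearMap.comp_apply, ContinuousLinearMap.adjoint_inner_right]

/-- The operator `V(x)` as a linear function of `x`. -/
noncomputable def actₗ (p : Fin k → ℕ) : X p →ₗ[ℂ] (K →L[ℂ] K) where
  toFun x := F.act hR x
  map_add' x y := F.clm_ext fun n z => by
    simp [F.act_Φ hR rfl, lmul_add_left]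
  map_smul' c x := F.clm_ext fun n z => by
    simp [F.act_Φ hR rfl, lmul_smul_left]

@[simp] lemma actₗ_apply {p : Fin k → ℕ} (x : X p) : F.actₗ hR p x = F.act hR x := rfl

lemma act_mul {p q r : Fin k → ℕ} (h : p + q = r) (x : X p) (y : X q) (u : K) :
    F.act hR (mul A h x y : X r) u = F.act hR x (F.act hR y u) := by
  have : F.act hR (mul A h x y : X r) = F.act hR x ∘L F.act hR y := F.clm_ext fun n z => by
    have h₂ : p + (q + n) = r + n := by rw [← h, add_assoc]
    rw [ContinuousLinearMap.comp_apply, F.act_Φ hR rfl, F.act_Φ hR rfl, F.act_Φ hR h₂,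
      lmul_lmul h rfl rfl h₂]
  rw [this, ContinuousLinearMap.comp_apply]

lemma act_unit (a : A) : F.act hR (unit a : X 0) = F.ρ a := F.clm_ext fun n z => by
  rw [F.act_Φ hR (zero_add n), lmul_unit, ρ_Φ]

/-- Both module actions are multiplications by elements of `X 0`, so covariance is the case of
degree `0` in `act_mul`. -/
lemma isCCRep_actₗ (p : Fin k → ℕ) : IsCCRep F.ρ (F.actₗ hR p) where
  completelyContractive := completelyContractive_of_inner fun x y u v => F.inner_act hR x y u v
  map_left a x := by
    ext u
    rw [actₗ_apply, ← unit_mul, F.act_mul, F.act_unit]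
    rfl
  map_right a x := by
    ext u
    rw [actₗ_apply, ← mul_unit, F.act_mul, F.act_unit]
    rfl

lemma isometry_tilde (p : Fin k → ℕ) : Isometry (F.isCCRep_actₗ hR p).tilde := by
  have : ContinuousLinearMap.adjoint (F.isCCRep_actₗ hR p).tilde ∘L (F.isCCRep_actₗ hR p).tilde =
      .id ℂ _ := by
    apply CStarCorrespondence.clm_ext; intro x u
    refine ext_inner_left ℂ fun v => ?_
    rw [ContinuousLinearMap.comp_apply, ContinuousLinearMap.adjoint_inner_right,
      ContinuousLinearMap.id_apply]
    have : innerSL ℂ ((F.isCCRep_actₗ hR p).tilde (tmul _ x u)) ∘L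
        (F.isCCRep_actₗ hR p).tilde = innerSL ℂ (tmul _ x u) := by
      apply CStarCorrespondence.clm_ext; intro y w
      rw [ContinuousLinearMap.comp_apply, innerSL_apply_apply, innerSL_apply_apply,
        IsCCRep.tilde_tmul, IsCCRep.tilde_tmul, inner_tmul, actₗ_apply, actₗ_apply, F.inner_act]
    have := DFunLike.congr_fun this v
    simp only [ContinuousLinearMap.comp_apply, innerSL_apply_apply] at this
    rw [← inner_conj_symm, this, inner_conj_symm]
  exact (AddMonoidHomClass.isometry_iff_norm _).mpr
    ((ContinuousLinearMap.norm_map_iff_adjoint_comp_self _).mpr this)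

/-- Every degree has its own `Ṽ`, so a product of two of them factors through the operator of the
total degree; the commutation relations are read off from this. -/
lemma tilde_comp_ampl {p q r : Fin k → ℕ} (h : p + q = r) :
    (F.isCCRep_actₗ hR p).tilde ∘L
      ampl (X p) (F.isCCRep_actₗ hR q).tilde (F.isCCRep_actₗ hR q).tilde_intertwines =
      (F.isCCRep_actₗ hR r).tilde ∘L ident h F.ρ := by
  apply CStarCorrespondence.clm_ext; intro x z
  have : F.act hR x ∘L (F.isCCRep_actₗ hR q).tilde =
      (F.isCCRep_actₗ hR r).tilde ∘L lmul F.ρ h x := by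
    apply CStarCorrespondence.clm_ext; intro y u
    simp [F.act_mul]
  rw [ContinuousLinearMap.comp_apply, ContinuousLinearMap.comp_apply, ampl_tmul, ident_tmul,
    IsCCRep.tilde_tmul, actₗ_apply]
  exact DFunLike.congr_fun this z

/-- The isometric representation of `X` on `K` determined by a generating family. -/
noncomputable def rep : Rep A X K where
  σ := F.ρ
  T i := F.actₗ hR (eIdx i)
  isCCRep i := F.isCCRep_actₗ hR (eIdx i)
  commute i j := by
    -- Both sides become the operator of degree `e_i + e_j` after `ident`; on the right the factor
    -- `ident ident⋆` coming from `swap` cancels.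
    rw [← ContinuousLinearMap.comp_assoc, F.tilde_comp_ampl hR (rfl : eIdx i + eIdx j = _),
      F.tilde_comp_ampl hR (add_comm (eIdx j) (eIdx i)), swap, ContinuousLinearMap.comp_assoc,
      ← ContinuousLinearMap.comp_assoc (ident _ _),
      ident_comp_adjoint _ (Or.inl (eIdx_ne_zero j)), ContinuousLinearMap.id_comp]

/-- The operators `act` in all degrees satisfy the recursion that characterizes `Ṽ_n`. -/
lemma tildeN_rep_tmul (n : Fin k → ℕ) (x : X n) (u : K) :
    (F.rep hR).tildeN n (tmul (F.rep hR).σ x u) = F.act hR x u := by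
  have := (F.rep hR).tildeN_unique (fun n => (F.isCCRep_actₗ hR n).tilde)
    (fun a v => by
      refine ((F.isCCRep_actₗ hR 0).tilde_tmul _ _).trans ?_
      rw [actₗ_apply, act_unit]; rfl)
    (fun i m n h x y v => by
      refine ((F.isCCRep_actₗ hR n).tilde_tmul _ _).trans ?_
      rw [actₗ_apply, act_mul]
      exact congrArg _ ((F.isCCRep_actₗ hR m).tilde_tmul _ _).symm) n
  rw [this]
  exact (F.isCCRep_actₗ hR n).tilde_tmul _ _

/-- The embedding of `H` into `K`. -/
noncomputable def incl : H →ₗᵢ[ℂ] K where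
  -- Nondegeneracy makes `T̃_0` unitary from `X 0 ⊗ H` onto `H`, so its adjoint places a vector of
  -- `H` in the domain of `Φ 0`.
  toLinearMap := (F.Φ 0 ∘L ContinuousLinearMap.adjoint (tildeZero X R.σ)).toLinearMap
  norm_map' v := by
    have h1 := DFunLike.congr_fun hR.tildeZero_comp_adjoint v
    simp only [ContinuousLinearMap.comp_apply, ContinuousLinearMap.id_apply] at h1
    rw [← sq_eq_sq₀ (norm_nonneg _) (norm_nonneg _), ← inner_self_eq_norm_sq (𝕜 := ℂ),
      ← inner_self_eq_norm_sq (𝕜 := ℂ)]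
    simp only [ContinuousLinearMap.coe_coe, ContinuousLinearMap.comp_apply]
    rw [F.inner_Φ, inf_idem, low_self, ContinuousLinearMap.id_apply,
      ContinuousLinearMap.adjoint_inner_left, h1]

lemma incl_apply (v : H) :
    F.incl hR v = F.Φ 0 (ContinuousLinearMap.adjoint (tildeZero X R.σ) v) := rfl

lemma act_incl {n : Fin k → ℕ} (x : X n) (v : H) :
    F.act hR x (F.incl hR v) = F.Φ n (tmul R.σ x v) := by
  have h1 := DFunLike.congr_fun hR.tildeZero_comp_adjoint v
  simp only [ContinuousLinearMap.comp_apply, ContinuousLinearMap.id_apply] at h1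
  rw [incl_apply, F.act_Φ hR (add_zero n), lmul_zero_right, ContinuousLinearMap.comp_apply, h1,
    tmulRight_apply]

lemma incl_tildeZero (z : Tensor (X 0) R.σ) : F.incl hR (tildeZero X R.σ z) = F.Φ 0 z := by
  rw [incl_apply]
  exact congrArg _ (DFunLike.congr_fun adjoint_tildeZero_comp z)

/-- Since `0 ∧ n = 0`, the kernel formula gives `P_H Φ(n) = T̃_n`. -/
lemma inner_incl_Φ (v : H) (n : Fin k → ℕ) (z : Tensor (X n) R.σ) :
    inner ℂ (F.incl hR v) (F.Φ n z) = inner ℂ v (R.tildeN n z) := by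
  have h0 : (0 : Fin k → ℕ) ⊓ n = 0 := inf_eq_left.mpr zero_le
  have h1 := DFunLike.congr_fun hR.tildeZero_comp_adjoint v
  simp only [ContinuousLinearMap.comp_apply, ContinuousLinearMap.id_apply] at h1
  rw [incl_apply, F.inner_Φ, h0, low_self, low_zero hR, ContinuousLinearMap.id_apply,
    ContinuousLinearMap.comp_apply, ContinuousLinearMap.adjoint_inner_right, h1]

lemma inner_Φ_of_inf_eq_zero (hR : R.Nondegenerate) {n m : Fin k → ℕ} (h : n ⊓ m = 0)
    (z : Tensor (X n) R.σ) (w : Tensor (X m) R.σ) :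
    inner ℂ (F.Φ n z) (F.Φ m w) = inner ℂ (R.tildeN n z) (R.tildeN m w) := by
  have h1 := DFunLike.congr_fun hR.tildeZero_comp_adjoint (R.tildeN m w)
  simp only [ContinuousLinearMap.comp_apply, ContinuousLinearMap.id_apply] at h1
  rw [F.inner_Φ, h, low_zero hR, low_zero hR, ContinuousLinearMap.comp_apply,
    ContinuousLinearMap.comp_apply, ContinuousLinearMap.adjoint_inner_left, h1]

lemma rep_σ_apply (a : A) : (F.rep hR).σ a = F.ρ a := rfl

lemma incl_intertwines :
    Intertwines R.σ (F.rep hR).σ (F.incl hR).toContinuousLinearMap := fun a => by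
  ext v
  have := DFunLike.congr_fun ((tildeZero_intertwines (X := X) R.σ).adjoint a) v
  simp only [ContinuousLinearMap.comp_apply] at this
  simp only [ContinuousLinearMap.comp_apply, LinearIsometry.coe_toContinuousLinearMap, incl_apply,
    rep_σ_apply, ρ_Φ, this]

lemma tildeN_ampl_incl (n : Fin k → ℕ) (z : Tensor (X n) R.σ) :
    (F.rep hR).tildeN n (ampl (X n) (F.incl hR).toContinuousLinearMap (F.incl_intertwines hR) z) =
      F.Φ n z := by
  have : (F.rep hR).tildeN n ∘L
      ampl (X n) (F.incl hR).toContinuousLinearMap (F.incl_intertwines hR) = F.Φ n := by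
    apply CStarCorrespondence.clm_ext; intro x v
    rw [ContinuousLinearMap.comp_apply, ampl_tmul, LinearIsometry.coe_toContinuousLinearMap,
      tildeN_rep_tmul, act_incl]
  exact DFunLike.congr_fun this z

/-- On `X n ⊗ H` the operator `Ṽ_n` is `Φ(n)`, so regularity is the kernel formula for degrees with
disjoint supports. -/
lemma isRegularIsometricDilation :
    IsRegularIsometricDilation R (F.rep hR) (F.incl hR) where
  isometry i := F.isometry_tilde hR (eIdx i)
  invariant i x v := by
    -- From `P_H Φ(n) = T̃_n` and multiplicativity, `P_H V(x) = T(x) P_H`; hence `V(x)⋆` restricts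
    -- to `T(x)⋆` on `H`.
    refine ⟨ContinuousLinearMap.adjoint (R.T i x) v, ?_⟩
    refine ext_inner_right ℂ fun w => ?_
    revert w
    refine DFunLike.congr_fun (?_ : innerSL ℂ _ = innerSL ℂ _)
    refine F.clm_ext fun n z => ?_
    rw [innerSL_apply_apply, innerSL_apply_apply, inner_incl_Φ,
      ContinuousLinearMap.adjoint_inner_left, ContinuousLinearMap.adjoint_inner_left]
    refine Eq.symm ((congrArg _ (F.act_Φ hR rfl x z)).trans ?_)
    rw [inner_incl_Φ, tildeN_eIdx_lmul]
  restrict := F.incl_intertwines hR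
  regular t := by
    ext w
    refine ext_inner_left ℂ fun z => ?_
    rw [← adjoint_ampl _ (F.incl_intertwines hR)]
    simp only [opZ, ContinuousLinearMap.comp_apply, ContinuousLinearMap.adjoint_inner_right]
    have h : negIdx t ⊓ posIdx t = 0 := by
      ext i
      show min (-t i).toNat (t i).toNat = 0
      omega
    rw [← F.inner_Φ_of_inf_eq_zero hR h]
    exact congrArg₂ _ (F.tildeN_ampl_incl hR _ z) (F.tildeN_ampl_incl hR _ w)

lemma isMinimal : IsMinimal (F.rep hR) (F.incl hR) := by
  intro M hM hH hV
  have key : ∀ n z, F.Φ n z ∈ M := by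
    intro n
    induction n using idx_induction with
    | h0 =>
      intro z
      rw [← F.incl_tildeZero hR]
      exact hH _
    | h1 i m n h ih =>
      -- As `M` is closed, membership is the vanishing of a bounded map into the normed quotient `K
      -- / M`, which can be tested on products.
      have : M.mkQL ∘L F.Φ n = 0 := by
        refine clm_ext_mul h (Or.inl (eIdx_ne_zero i)) fun x y v => ?_
        have := hV i x _ (ih (tmul R.σ y v))
        rw [← lmul_tmul, ContinuousLinearMap.comp_apply, ← F.act_Φ hR h]
        exact (Submodule.Quotient.mk_eq_zero M).mpr this
      intro z
      exact (Submodule.Quotient.mk_eq_zero M).mp (DFunLike.congr_fun this z)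
  exact F.eq_top hM key

/-- In degree `0` nondegeneracy of `σ` suffices. In degree `e_i + m` the vectors are of the form
`V(x) u` with `x ∈ E_i`; essentiality reduces to `x = φ(a) x'`, and `V(φ(a) x') = ρ(a) V(x')`. -/
lemma rep_nondegenerate (hE : ∀ i, Essential A (X (eIdx i))) : (F.rep hR).Nondegenerate := by
  set S := Submodule.span ℂ {y : K | ∃ a u, (F.rep hR).σ a u = y} with hS
  set N := S.topologicalClosure with hN
  have hcl : IsClosed (N : Set K) := S.isClosed_topologicalClosure
  have hmem : ∀ a u, N.mkQL (F.ρ a u) = 0 := fun a u =>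
    (Submodule.Quotient.mk_eq_zero N).mpr
      (S.le_topologicalClosure (Submodule.subset_span ⟨a, u, rfl⟩))
  refine F.eq_top hcl fun n => ?_
  suffices h : N.mkQL ∘L F.Φ n = 0 from fun z =>
    (Submodule.Quotient.mk_eq_zero N).mp (DFunLike.congr_fun h z)
  induction n using idx_induction with
  | h0 =>
    have h1 : N.mkQL ∘L (F.incl hR).toContinuousLinearMap = 0 := by
      refine ContinuousLinearMap.ext_on (Submodule.dense_iff_topologicalClosure_eq_top.mpr hR) ?_
      rintro _ ⟨a, v, rfl⟩
      have := DFunLike.congr_fun (F.incl_intertwines hR a) v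
      simp only [ContinuousLinearMap.comp_apply] at this
      rw [ContinuousLinearMap.comp_apply, this, rep_σ_apply, hmem]
      rfl
    ext z
    rw [ContinuousLinearMap.comp_apply, ← F.incl_tildeZero hR]
    exact DFunLike.congr_fun h1 _
  | h1 i m n h _ =>
    have h1 : N.mkQL ∘L (F.isCCRep_actₗ hR (eIdx i)).tilde = 0 := by
      refine clm_ext_of_dense (hE i) ?_
      rintro _ ⟨a, x, rfl⟩ u
      rw [ContinuousLinearMap.comp_apply, IsCCRep.tilde_tmul,
        (F.isCCRep_actₗ hR (eIdx i)).map_left, ContinuousLinearMap.comp_apply, hmem]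
      rfl
    refine clm_ext_mul h (Or.inl (eIdx_ne_zero i)) fun x y v => ?_
    have := DFunLike.congr_fun h1 (tmul _ x (F.Φ m (tmul R.σ y v)))
    rw [ContinuousLinearMap.comp_apply, IsCCRep.tilde_tmul, actₗ_apply, F.act_Φ hR h,
      lmul_tmul] at this
    exact this

end GeneratingFamily

end Rep

end ProductSystem

/-- Compare the norms of two square summable families with comparable entries. -/
lemma lp.norm_le_mul_norm {J : Type*} {E : J → Type*} [∀ j, NormedAddCommGroup (E j)]
    (f g : lp E 2) {C : ℝ} (hC : 0 ≤ C) (h : ∀ j, ‖f j‖ ≤ C * ‖g j‖) : ‖f‖ ≤ C * ‖g‖ := by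
  have h2 : 0 < (2 : ENNReal).toReal := by simp
  rw [← Real.rpow_le_rpow_iff (norm_nonneg _) (by positivity) h2,
    Real.mul_rpow hC (norm_nonneg _)]
  refine hasSum_le (fun j => ?_) (lp.hasSum_norm h2 f) ((lp.hasSum_norm h2 g).mul_left _)
  rw [← Real.mul_rpow hC (norm_nonneg _)]
  exact Real.rpow_le_rpow (norm_nonneg _) (h j) h2.le

/-! ### Sufficiency: factorization of the kernel over an `ℓ²` sum. -/

namespace ProductSystem

lemma eSet_supp_le {k : ℕ} (p : Fin k → ℕ) : eSet (supp p) ≤ p := fun i => by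
  by_cases hi : i ∈ supp p
  · have := mem_supp.mp hi
    simp only [eSet, if_pos hi]
    omega
  · simp [eSet, hi]

namespace Rep

section Sufficiency

variable {A : Type*} [NonUnitalCStarAlgebra A] [PartialOrder A] [StarOrderedRing A]
variable {k : ℕ} {X : (Fin k → ℕ) → Type*} [∀ n, NormedAddCommGroup (X n)]
  [∀ n, NormedSpace ℂ (X n)] [∀ n, CStarCorrespondence A (X n)] [ProductSystem A X]
variable {H : Type*} [NormedAddCommGroup H] [InnerProductSpace ℂ H] [CompleteSpace H]
variable {R : Rep A X H}

/-- Restriction of a family of operators to the closed span of their ranges. -/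
noncomputable def GeneratingFamily.ofFamily {L : Type*} [NormedAddCommGroup L]
    [InnerProductSpace ℂ L] (Φ : ∀ n, Tensor (X n) R.σ →L[ℂ] L)
    (hi : ∀ n m z w, inner ℂ (Φ n z) (Φ m w) =
      inner ℂ (R.low (n ⊓ m) n z) (R.low (n ⊓ m) m w))
    (hn : ∀ (a : A) (z : Π₀ n, Tensor (X n) R.σ),
      ‖famSum (fun n => Φ n ∘L leftRep (X n) R.σ a) z‖ ≤ ‖a‖ * ‖famSum Φ z‖) :
    GeneratingFamily R (Submodule.span ℂ {y | ∃ n z, Φ n z = y}).topologicalClosure where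
  Φ n := (Φ n).codRestrict _ fun z =>
    Submodule.le_topologicalClosure _ (Submodule.subset_span ⟨n, z, rfl⟩)
  dense := by
    rw [Subtype.dense_iff]
    have h : Submodule.span ℂ {y | ∃ n z, Φ n z = y} ≤
        Submodule.map (Submodule.span ℂ {y | ∃ n z, Φ n z = y}).topologicalClosure.subtype
          (Submodule.span ℂ {y | ∃ n z, (Φ n).codRestrict
            (Submodule.span ℂ {y | ∃ n z, Φ n z = y}).topologicalClosure (fun z =>
              Submodule.le_topologicalClosure _ (Submodule.subset_span ⟨n, z, rfl⟩)) z = y}) := by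
      rw [Submodule.span_le]
      rintro _ ⟨n, z, rfl⟩
      exact ⟨_, Submodule.subset_span ⟨n, z, rfl⟩, rfl⟩
    exact closure_mono h
  inner_Φ := hi
  norm_action_le a z := by
    have h : ∀ (Ψ : ∀ n, Tensor (X n) R.σ →L[ℂ] L)
        (Ψ' : ∀ n, Tensor (X n) R.σ →L[ℂ]
          (Submodule.span ℂ {y | ∃ n z, Φ n z = y}).topologicalClosure),
        (∀ n z, (Ψ' n z : L) = Ψ n z) → ‖famSum Ψ' z‖ = ‖famSum Ψ z‖ := by
      intro Ψ Ψ' hΨ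
      change ‖((famSum Ψ' z :
        (Submodule.span ℂ {y | ∃ n z, Φ n z = y}).topologicalClosure) : L)‖ = _
      congr 1
      induction z using DFinsupp.induction with
      | h0 => simp
      | ha n z f _ _ ih =>
        rw [map_add, map_add, famSum_single, famSum_single, Submodule.coe_add, ih, hΨ]
    refine (h (fun n => Φ n ∘L leftRep (X n) R.σ a) _ fun _ _ => rfl).trans_le
      ((hn a z).trans_eq ?_)
    exact congrArg _ (h Φ _ fun _ _ => rfl).symm

end Sufficiency

section Existence

variable {A : Type uA} [NonUnitalCStarAlgebra A] [PartialOrder A] [StarOrderedRing A]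
variable {k : ℕ} {X : (Fin k → ℕ) → Type uX} [∀ n, NormedAddCommGroup (X n)]
  [∀ n, NormedSpace ℂ (X n)] [∀ n, CStarCorrespondence A (X n)] [ProductSystem A X]
variable {H : Type uH} [NormedAddCommGroup H] [InnerProductSpace ℂ H] [CompleteSpace H]
variable {R : Rep A X H}

/-- If all defect operators are positive, then there is a generating family: a Cholesky type
factorization of the kernel in terms of the square roots of the defect operators. -/
lemma exists_generatingFamily (hR : R.Nondegenerate) (hpos : ∀ v, (R.defect v).IsPositive) :
    ∃ (K : Type (max uX uH w)) (_ : NormedAddCommGroup K) (_ : InnerProductSpace ℂ K)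
      (_ : CompleteSpace K), Nonempty (GeneratingFamily R K) := by
  -- Positivity is applied to the splitting `p = (p - e(supp p)) + e(supp p)`.
  have hD : ∀ p, (R.defectAt p (supp p)).IsPositive := fun p =>
    defectAt_isPositive hR hpos (tsub_add_cancel_of_le (eSet_supp_le p))
  choose C hCi hC using fun p => exists_sqrt_intertwines (hD p) (R.defectAt_intertwines p (supp p))
  -- Lifting the index set puts the `ℓ²` sum in the universe required of `K`.
  let E : ULift.{w} (Fin k → ℕ) → Type (max uX uH) := fun p => Tensor (X p.down) R.σ
  -- Column `n` of a triangular factor: its coordinate at `p ≤ n` is `C_p (I ⊗ T̃_{n-p})`, and the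
  -- other coordinates vanish.
  let Φ : ∀ n, Tensor (X n) R.σ →L[ℂ] lp E 2 := fun n => ∑ p ∈ Finset.Iic n,
    lp.singleContinuousLinearMap ℂ E 2 (ULift.up p) ∘L (C p ∘L R.low p n)
  have hΦ : ∀ n z, Φ n z = ∑ p ∈ Finset.Iic n,
      lp.single (E := E) 2 (ULift.up p) (C p (R.low p n z)) := fun n z => by
    simp [Φ, sum_apply]
  have hΦ' : ∀ n z p, (Φ n z : ∀ p, E p) (ULift.up p) = C p (R.low p n z) := fun n z p => by
    rw [hΦ, lp.coeFn_sum, Finset.sum_apply]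
    by_cases hp : p ≤ n
    · rw [Finset.sum_eq_single p]
      · exact lp.single_apply_self _ _ _
      · intro q _ hq
        exact lp.single_apply_ne _ _ _ fun h => hq (congrArg ULift.down h).symm
      · intro h; exact absurd (Finset.mem_Iic.mpr hp) h
    · rw [low_of_not_le R hp]
      refine (Finset.sum_eq_zero fun q hq => ?_).trans (map_zero (C p)).symm
      refine lp.single_apply_ne _ _ _ fun h => hp ?_
      rw [show p = q from congrArg ULift.down h]
      exact Finset.mem_Iic.mp hq
  have hi : ∀ n m z w, inner ℂ (Φ n z) (Φ m w) =
      inner ℂ (R.low (n ⊓ m) n z) (R.low (n ⊓ m) m w) := by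
    intro n m z w
    -- Möbius inversion at `N = n ∧ m` turns the kernel into a sum over `p ≤ n ∧ m`, whose terms are
    -- the forms of `D_p = C_p⋆ C_p`.
    rw [← sum_Iic_alternating (fun q => inner ℂ (R.low q n z) (R.low q m w)), hΦ, sum_inner]
    have h1 : ∀ p, inner ℂ (lp.single (E := E) 2 (ULift.up p) (C p (R.low p n z))) (Φ m w) =
        inner ℂ (R.low p n z) (R.defectAt p (supp p) (R.low p m w)) := fun p => by
      rw [lp.inner_single_left, hΦ', ← hC, ContinuousLinearMap.comp_apply,
        ContinuousLinearMap.adjoint_inner_right]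
    simp only [h1]
    -- The terms with `p ≤ n` but not `p ≤ m` vanish, because `low p m` is extended by zero.
    rw [← Finset.sum_subset (Finset.Iic_subset_Iic.mpr (inf_le_left : n ⊓ m ≤ n))]
    · refine Finset.sum_congr rfl fun p hp => ?_
      have hp' := le_inf_iff.mp (Finset.mem_Iic.mp hp)
      rw [inner_defectAt]
      refine Finset.sum_congr rfl fun u _ => ?_
      rw [← low_low hR tsub_le_self hp'.1, ← low_low hR tsub_le_self hp'.2]
      rfl
    · intro p hp hp'
      have : ¬ p ≤ m := fun h =>
        hp' (Finset.mem_Iic.mpr (le_inf (Finset.mem_Iic.mp hp) h))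
      rw [low_of_not_le R this]
      simp
  have hn : ∀ (a : A) (z : Π₀ n, Tensor (X n) R.σ),
      ‖famSum (fun n => Φ n ∘L leftRep (X n) R.σ a) z‖ ≤ ‖a‖ * ‖famSum Φ z‖ := by
    intro a z
    refine lp.norm_le_mul_norm _ _ (norm_nonneg a) ?_
    rintro ⟨p⟩
    -- Each coordinate `C_p ∘ low p n` intertwines the actions, so `a` acts diagonally on the `ℓ²`
    -- sum, coordinate by coordinate.
    have : (famSum (fun n => Φ n ∘L leftRep (X n) R.σ a) z : ∀ p, E p) (ULift.up p) =
        leftRep (X p) R.σ a ((famSum Φ z : ∀ p, E p) (ULift.up p)) := by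
      induction z using DFinsupp.induction with
      | h0 => simp
      | ha n z f _ _ ih =>
        have h1 := DFunLike.congr_fun (((hCi p).comp (R.low_intertwines p n)) a) z
        rw [map_add, map_add, lp.coeFn_add, lp.coeFn_add, Pi.add_apply, Pi.add_apply, ih,
          map_add, famSum_single, famSum_single, ContinuousLinearMap.comp_apply, hΦ', hΦ']
        exact congrArg (· + _) h1
    rw [this]
    exact norm_rep_apply_le a _
  exact ⟨_, inferInstance, inferInstance,
    (Submodule.isClosed_topologicalClosure _).completeSpace_coe,
    ⟨GeneratingFamily.ofFamily Φ hi hn⟩⟩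

end Existence

end Rep

end ProductSystem

theorem theorem3p3 {A : Type uA} [NonUnitalCStarAlgebra A] [PartialOrder A]
    [StarOrderedRing A] {k : ℕ} (X : (Fin k → ℕ) → Type uX) [∀ n, NormedAddCommGroup (X n)]
    [∀ n, NormedSpace ℂ (X n)] [∀ n, CompleteSpace (X n)] [∀ n, CStarCorrespondence A (X n)]
    [ProductSystem A X] {H : Type uH} [NormedAddCommGroup H] [InnerProductSpace ℂ H]
    [CompleteSpace H] (R : ProductSystem.Rep A X H) (hR : R.Nondegenerate) :
    (R.HasRegularIsometricDilation.{uA, uX, uH, w} ↔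
      ∀ v : Finset (Fin k), (R.defect v).IsPositive) ∧
    (R.HasRegularIsometricDilation.{uA, uX, uH, w} →
      R.HasMinimalRegularIsometricDilation.{uA, uX, uH, w}) ∧
    ((∀ i, CStarCorrespondence.Essential A (X (ProductSystem.eIdx i))) →
      R.HasRegularIsometricDilation.{uA, uX, uH, w} →
      R.HasMinimalNondegenerateRegularIsometricDilation.{uA, uX, uH, w}) := by
  have h1 : R.HasRegularIsometricDilation.{uA, uX, uH, w} →
      ∀ v : Finset (Fin k), (R.defect v).IsPositive := by
    rintro ⟨K, _, _, _, V, ι, hV⟩ v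
    exact hV.defect_isPositive hR v
  refine ⟨⟨h1, fun hpos => ?_⟩, fun h => ?_, fun hE h => ?_⟩
  · obtain ⟨K, _, _, _, ⟨F⟩⟩ := ProductSystem.Rep.exists_generatingFamily.{uA, uX, uH, w} hR hpos
    exact ⟨K, _, _, inferInstance, F.rep hR, F.incl hR, F.isRegularIsometricDilation hR⟩
  -- The given dilation serves only to establish positivity; the minimal one is constructed afresh.
  · obtain ⟨K, _, _, _, ⟨F⟩⟩ :=
      ProductSystem.Rep.exists_generatingFamily.{uA, uX, uH, w} hR (h1 h)
    exact ⟨K, _, _, inferInstance, F.rep hR, F.incl hR, F.isRegularIsometricDilation hR,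
      F.isMinimal hR⟩
  · obtain ⟨K, _, _, _, ⟨F⟩⟩ :=
      ProductSystem.Rep.exists_generatingFamily.{uA, uX, uH, w} hR (h1 h)
    exact ⟨K, _, _, inferInstance, F.rep hR, F.incl hR, F.isRegularIsometricDilation hR,
      F.isMinimal hR, F.rep_nondegenerate hR hE⟩
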